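/- A \emph{$\Box$-set} $X$ consists of sets $X_n$ ($n\ge 0$) and face maps $\delta^\epsilon_i\colon X_n\to X_{n-1}$ ($\epsilon\in\{0,1\}$, $1\le i\le n$) with $\delta^\eta_{j-1}\delta^\epsilon_i=\delta^\epsilon_i\delta^\eta_j$ for $1\le i<j\le n$. Its realization $\|X\|$ is the quotient space of $\coprod_n X_n\times[0,1]^n$ (with $X_n$ discrete) by the identifications $(\delta^\epsilon_i x,t)\sim(x,d^\epsilon_i t)$, where $d^\epsilon_i$ inserts $\epsilon$ as $i$-th coordinate. Let $R$ be a commutative ring. Let $C^\bullet(X)$ be the cochain complex of all functions $X_n\to R$, with coboundary dual to $\partial=\sum_i(-1)^i(\delta^0_i-\delta^1_i)$, and let $S^\bullet(\|X\|)$ be the complex of singular cochains with values in $R$, i.e. functions on singular simplices with $(dc)(y)=\sum_i(-1)^i c(\delta_i y)$. For $A=\{a_1<\dots<a_m\}\subseteq\{1,\dots,n\}$ with complement $B=\{b_1<\dots<b_k\}$ put $\delta^\epsilon_A=\delta^\epsilon_{a_1}\circ\dots\circ\delta^\epsilon_{a_m}$ and let $\epsilon(A)$ be the sign of the permutation taking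 $(1,\dots,n)$ to $(b_1,\dots,b_k,a_1,\dots,a_m)$. For $f\in C^k(X)$, $g\in C^m(X)$ and $x\in X_{k+m}$ define $$(f\cup g)(x)=(-1)^{km}\sum_{|A|=m}\epsilon(A)\,f(\delta^0_A x)\,g(\delta^1_B x).$$ For $f\in S^k(\|X\|)$, $g\in S^m(\|X\|)$ and a singular $(k+m)$-simplex $y$ define the cup product by $(f\cup g)(y)=(-1)^{km}f(y|_{[0,\dots,k]})\,g(y|_{[k,\dots,k+m]})$. \textbf{Proposition.} Let $X$ be a $\Box$-set. 1. The product $\cup$ on $C^\bullet(X)$ is strictly associative, and the $0$-cochain $\mathbf 1$ with value $1$ on every vertex is a strict two-sided unit. 2. There is an $R$-linear chain homotopy equivalence $\Phi\colon S^\bullet(\|X\|)\to C^\bullet(X)$ with $\Phi(f\cup g)=\Phi(f)\cup\Phi(g)$ for all singular cochains $f,g$ and $\Phi(\mathbf 1)=\mathbf 1$. It is given by triangulating cubes: for $x\in X_n$, $$\Phi(c)(x)=\sum_{\sigma\in\mathcal S_n}\epsilon(\sigma)\,c(\sigma(x)),$$ where $\epsilon(\sigma)$ is the sign of $\sigma$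 and $\sigma(x)$ is the singular simplex of $\|X\|$ obtained by composing the characteristic map $[0,1]^n\to\|X\|$ of $x$ with the affine map $\Delta^n\to[0,1]^n$ whose ordered vertices are $0,\ e_{\sigma(1)},\ e_{\sigma(1)}+e_{\sigma(2)},\ \dots,\ e_{\sigma(1)}+\dots+e_{\sigma(n)}$. -/

import Mathlib

open CategoryTheory Opposite

universe u v

/-- A `□`-set: sets `cells n` of `n`-cubes together with face maps
`face ε i : cells (n + 1) → cells n` in the direction `i : Fin (n + 1)`, where `ε = false` is the
face on which the `i`-th coordinate is `0` and `ε = true` the face on which it is `1`. Directions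
are counted from `0`. The single relation is `δ^η_{j-1} δ^ε_i = δ^ε_i δ^η_j` for `i < j`. -/
structure BoxSet where
  cells : ℕ → Type u
  face : ∀ {n : ℕ}, Bool → Fin (n + 1) → cells (n + 1) → cells n
  face_face : ∀ {n : ℕ} (ε η : Bool) (i j : Fin (n + 1)), i ≤ j → ∀ x : cells (n + 2),
    face η j (face ε i.castSucc x) = face ε i (face η j.succ x)

namespace BoxSet

variable (X : BoxSet.{u})

/-! ### Cochains -/

/-- The coboundary `C^n(X; R) → C^{n+1}(X; R)`, where `C^n(X; R)` is the module of all functions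
`X_n → R`; it is dual to the boundary operator `∂ = ∑_i (-1)^i (δ^0_i - δ^1_i)`, in which `i` is
counted from `1`. -/
def coboundary (R : Type v) [CommRing R] (n : ℕ) :
    (X.cells n → R) →ₗ[R] (X.cells (n + 1) → R) where
  toFun f x := ∑ i : Fin (n + 1),
    (-1 : R) ^ ((i : ℕ) + 1) * (f (X.face false i x) - f (X.face true i x))
  map_add' f g := by
    funext x
    simp only [Pi.add_apply, ← Finset.sum_add_distrib]
    exact Finset.sum_congr rfl fun i _ => by ring
  map_smul' r f := by
    funext x
    simp only [Pi.smul_apply, smul_eq_mul, RingHom.id_apply, Finset.mul_sum]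
    exact Finset.sum_congr rfl fun i _ => by ring

theorem coboundary_coboundary (R : Type v) [CommRing R] (n : ℕ) (f : X.cells n → R) :
    X.coboundary R (n + 1) (X.coboundary R n f) = 0 := by
  funext x
  let P := Fin (n + 2) × Fin (n + 1)
  let F : Bool → Bool → P → R := fun η ε p => f (X.face ε p.2 (X.face η p.1 x))
  let G : P → R := fun p => (-1 : R) ^ ((p.1 : ℕ) + (p.2 : ℕ)) *
    (F false false p - F false true p - F true false p + F true true p)
  have hG : X.coboundary R (n + 1) (X.coboundary R n f) x = ∑ p : P, G p := by
    rw [Fintype.sum_prod_type]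
    simp only [coboundary, LinearMap.coe_mk, AddHom.coe_mk]
    refine Finset.sum_congr rfl fun j _ => ?_
    rw [← Finset.sum_sub_distrib, Finset.mul_sum]
    refine Finset.sum_congr rfl fun i _ => ?_
    simp only [G, F, pow_add]
    ring
  rw [hG, Pi.zero_apply]
  let S : Finset P := Finset.univ.filter fun p => (p.1 : ℕ) ≤ (p.2 : ℕ)
  rw [← Finset.sum_add_sum_compl S, ← eq_neg_iff_add_eq_zero, ← Finset.sum_neg_distrib]
  refine Finset.sum_bij'
    (fun p hp => (p.2.succ, p.1.castLT (lt_of_le_of_lt (Finset.mem_filter.mp hp).2 p.2.2)))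
    (fun p hp => (p.2.castSucc, p.1.pred (by
      rintro h
      simp [S, h] at hp))) ?_ ?_ ?_ ?_ ?_
  · rintro ⟨i, j⟩ hp
    simp only [S, Finset.mem_filter, Finset.mem_univ, true_and, Finset.mem_compl, Fin.val_succ,
      Fin.val_castLT] at hp ⊢
    omega
  · rintro ⟨i, j⟩ hp
    simp only [S, Finset.mem_filter, Finset.mem_univ, true_and, Finset.mem_compl, Fin.val_pred,
      Fin.val_castSucc] at hp ⊢
    omega
  · rintro ⟨i, j⟩ hp
    simp
  · rintro ⟨i, j⟩ hp
    simp
  · rintro ⟨i, j⟩ hp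
    have hij : (i : ℕ) ≤ (j : ℕ) := (Finset.mem_filter.mp hp).2
    have key : ∀ ε η : Bool, F ε η (i, j) =
        F η ε (j.succ, i.castLT (lt_of_le_of_lt hij j.2)) := by
      intro ε η
      have h := X.face_face ε η (i.castLT (lt_of_le_of_lt hij j.2)) j hij x
      rw [Fin.castSucc_castLT] at h
      exact congrArg f h
    simp only [G, key, Fin.val_succ, Fin.val_castLT]
    ring

/-- The cochain complex `C^•(X; R)` of a `□`-set. -/
def cochainComplex (R : Type v) [CommRing R] : CochainComplex (ModuleCat.{max u v} R) ℕ :=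
  CochainComplex.of (fun n => ModuleCat.of R (X.cells n → R))
    (fun n => ModuleCat.ofHom (X.coboundary R n))
    (fun n => by
      ext f : 2
      exact X.coboundary_coboundary R n f)

/-! ### The cup product -/

variable {X}

/-- The iterated face `δ^ε_{a_1} ∘ ⋯ ∘ δ^ε_{a_m}` for directions `a_1 < ⋯ < a_m`; the face in the
largest direction is taken first. -/
def iteratedFace (ε : Bool) : ∀ {m k n : ℕ}, k + m = n → (Fin m ↪o Fin n) → X.cells n → X.cells k
  | 0, _, _, rfl, _, x => x
  | m + 1, k, _, rfl, a, x =>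
    iteratedFace ε (m := m) (k := k) rfl
      (OrderEmbedding.ofStrictMono
        (fun i => (a i.castSucc).castLT
          (lt_of_lt_of_le (Fin.lt_def.mp (a.strictMono (Fin.castSucc_lt_last i)))
            (Nat.le_of_lt_succ (a (Fin.last m)).isLt)))
        (fun _ _ hij => Fin.lt_def.mpr (a.strictMono (Fin.castSucc_lt_castSucc_iff.mpr hij))))
      (X.face ε (a (Fin.last m)) x)

/-- The face `δ^ε_A` for a set `A` of `m` directions of a cube of dimension `n = k + m`. -/
def faceOfFinset (ε : Bool) {k m n : ℕ} (h : k + m = n) (A : Finset (Fin n)) (hA : A.card = m) :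
    X.cells n → X.cells k :=
  iteratedFace ε h (A.orderEmbOfFin hA)

theorem card_compl_of_card {k m n : ℕ} (h : k + m = n) {A : Finset (Fin n)} (hA : A.card = m) :
    Aᶜ.card = k := by
  rw [Finset.card_compl, Fintype.card_fin]
  omega

/-- The permutation of `{1, …, n}` that maps `(1, …, n)` to `(b_1, …, b_k, a_1, …, a_m)`, where
`a_1 < ⋯ < a_m` are the elements of `A` and `b_1 < ⋯ < b_k` those of its complement. -/
def shuffle {k m n : ℕ} (h : k + m = n) (A : Finset (Fin n)) (hA : A.card = m) :
    Equiv.Perm (Fin n) :=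
  (finCongr h.symm).trans <| finSumFinEquiv.symm.trans <| (Equiv.sumComm _ _).trans <|
    finSumEquivOfFinset hA (card_compl_of_card h hA)

/-- The cubical cup product
`(f ∪ g)(x) = (-1)^{km} ∑_A ε(A) f(δ^0_A x) g(δ^1_B x)` of `f ∈ C^k(X; R)` and `g ∈ C^m(X; R)`,
where `A` runs over the sets of `m` directions and `B` is the complement of `A`. The degree `n` of
the product is a variable, subject to `k + m = n`. -/
def cup {R : Type v} [CommRing R] {k m n : ℕ} (h : k + m = n)
    (f : X.cells k → R) (g : X.cells m → R) : X.cells n → R := fun x =>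
  (-1 : R) ^ (k * m) * ∑ A : {A : Finset (Fin n) // A.card = m},
    ((Equiv.Perm.sign (shuffle h A.1 A.2) : ℤ) : R) *
      f (faceOfFinset false h A.1 A.2 x) *
      g (faceOfFinset true ((Nat.add_comm m k).trans h) A.1ᶜ (card_compl_of_card h A.2) x)

/-! ### The realization -/

variable (X)

/-- The topological sum of the `X_n × [0,1]^n`, with `X_n` discrete. -/
abbrev PreRealization : Type u := Σ p : (Σ n : ℕ, X.cells n), (Fin p.1 → unitInterval)

/-- The identifications `(δ^ε_i x, t) ∼ (x, d^ε_i t)`, where `d^ε_i` inserts `ε` at position `i`. -/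
inductive Glue : X.PreRealization → X.PreRealization → Prop
  | glue {n : ℕ} (ε : Bool) (i : Fin (n + 1)) (x : X.cells (n + 1)) (t : Fin n → unitInterval) :
      Glue ⟨⟨n, X.face ε i x⟩, t⟩
        ⟨⟨n + 1, x⟩, Fin.insertNth (α := fun _ => unitInterval) i (if ε then 1 else 0) t⟩

/-- The realization `‖X‖`, with the quotient topology. -/
def Realization : Type u := Quot X.Glue

instance : TopologicalSpace X.Realization := inferInstanceAs (TopologicalSpace (Quot X.Glue))

/-- The characteristic map `[0,1]^n → ‖X‖` of an `n`-cube `x`. -/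
def charMap {n : ℕ} (x : X.cells n) : C(Fin n → unitInterval, X.Realization) where
  toFun t := Quot.mk X.Glue ⟨⟨n, x⟩, t⟩
  continuous_toFun := continuous_quot_mk.comp
    (continuous_sigmaMk (σ := fun p : (Σ n : ℕ, X.cells n) => (Fin p.1 → unitInterval))
      (i := ⟨n, x⟩))

end BoxSet

/-- The simplex `t_{σ(1)} ≥ ⋯ ≥ t_{σ(n)}` of the standard triangulation of the cube `[0,1]^n`: the
affine map `Δ^n → [0,1]^n` with vertices `0, e_{σ(1)}, e_{σ(1)} + e_{σ(2)}, …, (1, …, 1)`, in this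
order. In barycentric coordinates its `σ(i)`-th coordinate is `s_i + ⋯ + s_n`. -/
noncomputable def cubeSimplex {n : ℕ} (σ : Equiv.Perm (Fin n)) :
    C(stdSimplex ℝ (Fin (n + 1)), Fin n → unitInterval) where
  toFun s a := ⟨∑ j ∈ Finset.univ.filter (fun j : Fin (n + 1) => (σ.symm a).castSucc < j), s.1 j,
    Finset.sum_nonneg fun j _ => s.2.1 j,
    (Finset.sum_le_sum_of_subset_of_nonneg (Finset.filter_subset _ _)
      fun j _ _ => s.2.1 j).trans_eq s.2.2⟩
  continuous_toFun := by
    refine continuous_pi fun a => Continuous.subtype_mk ?_ _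
    exact continuous_finsetSum _ fun j _ => (continuous_apply j).comp continuous_subtype_val

/-- The singular `n`-simplex of `‖X‖` which is the simplex of the triangulation of the `n`-cube `x`
given by the permutation `σ`. -/
noncomputable def BoxSet.simplex (X : BoxSet.{u}) {n : ℕ} (σ : Equiv.Perm (Fin n))
    (x : X.cells n) : (TopCat.toSSet.obj (TopCat.of X.Realization)).obj (op (SimplexCategory.mk n)) :=
  (TopCat.toSSetObjEquiv (TopCat.of X.Realization) (op (SimplexCategory.mk n))).symm
    ((X.charMap x).comp (cubeSimplex σ))

/-! ### Singular cochains -/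

/-- The cosimplicial module of the functions `Y_n → R` on a simplicial set `Y`. -/
def SSet.cosimplicialCochains (Y : SSet.{u}) (R : Type v) [CommRing R] :
    CosimplicialObject (ModuleCat.{max u v} R) where
  obj n := ModuleCat.of R (Y.obj (op n) → R)
  map φ := ModuleCat.ofHom (LinearMap.funLeft R R (Y.map φ.op))
  map_id n := by
    ext f : 2
    funext y
    simp [LinearMap.funLeft]
  map_comp φ ψ := by
    ext f : 2
    funext y
    simp [LinearMap.funLeft]

/-- The complex of singular cochains of a space `T` with coefficients in `R`: an `n`-cochain is a
function on the singular `n`-simplices, and the coboundary is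
`(d c)(y) = ∑_i (-1)^i c(δ_i y)`. -/
noncomputable def singularCochainComplex (R : Type v) [CommRing R] (T : TopCat.{u}) :
    CochainComplex (ModuleCat.{max u v} R) ℕ :=
  (AlgebraicTopology.alternatingCofaceMapComplex (ModuleCat.{max u v} R)).obj
    ((TopCat.toSSet.obj T).cosimplicialCochains R)

/-- The (Alexander-Whitney) cup product
`(f ∪ g)(y) = (-1)^{km} f(y restricted to the first k + 1 vertices) g(y restricted to the last
m + 1 vertices)` of cochains on a simplicial set. The degree `n` of the product is a variable,
subject to `k + m = n`. -/
def SSet.cup {Y : SSet.{u}} {R : Type v} [CommRing R] {k m n : ℕ} (h : k + m = n)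
    (f : Y.obj (op (SimplexCategory.mk k)) → R) (g : Y.obj (op (SimplexCategory.mk m)) → R) : Y.obj (op (SimplexCategory.mk n)) → R := fun y =>
  (-1 : R) ^ (k * m) *
    f (Y.map (SimplexCategory.subinterval 0 k (by omega)).op y) *
    g (Y.map (SimplexCategory.subinterval k m (by omega)).op y)

/-! Let T send a cube to the signed sum of the simplices of its standard triangulation; `Φ` is the
dual of T. Dropping the first or the last vertex of such a simplex leaves a simplex of a facet with
a coordinate equal to 1 or 0, and the inner faces cancel in pairs under adjacent transpositions, so
T is a chain map (`sum_sign_faces`, `bdry_triangulate`).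

T is a quasi-isomorphism by comparison along skeleta. The chains of a family of cubes modulo its
boundary have homology free on the triangulated cubes (`cube_homology`, by induction on dimension:
the boundary modulo all of its facets but one is compared with a cube of lower dimension). Excision
along the characteristic maps carries this over to a skeleton modulo the preceding one
(`skeleton_homology`). Induction over skeleta, together with a deformation that pushes any singular
chain into some skeleton, yields `exists_of_bdry_eq_triangulate`, which says that the mapping cone
of T is acyclic. No homology groups appear: working modulo a subspace means that a difference
belongs to `chainsIn`. The deformations used in both excisions stretch the middle third of every
coordinate.

The prism and subdivision operators are first built on lists of points. There the empty list serves
as an augmentation, so that the homotopy formulas need no exception in degree 0; naturality then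
transports them to singular chains.

The cone consists of free modules and ends in degree 0, hence it is contractible
(`exists_contraction`). The matrix entries of a contraction are a homotopy inverse of T and the two
homotopies (`exists_homotopy_inverse`), and dualizing gives the equivalence of cochain complexes.

For the product, a permutation of `k + m` directions is the same as a set `A` of `m` directions with
an ordering of `A` and one of its complement `B`. The front face of the corresponding simplex lies
in the face `δ^0_A`, the back face in `δ^1_B` (`simplex_front`, `simplex_back`), so the two products
match term by term.

Finally the simplices `σ(x)` are pairwise distinct, so `Φ` is surjective on cochains. The cubical
product therefore inherits strict associativity and units from the singular one. -/

/-! ### Chains of finite lists of points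

The chain complex of ordered lists of points of a type, the empty list being included in degree
`-1`, serves as a combinatorial model of the affine simplices in a convex set. -/

namespace ListChain

open Finsupp

variable (R : Type v) [CommRing R] {α β : Type*}

/-- Two linear maps on a free module agree if they agree on the basis. -/
theorem _root_.Finsupp.lhom_ext_single {ι M : Type*} {R : Type v} [CommRing R] [AddCommGroup M]
    [Module R M] {f g : (ι →₀ R) →ₗ[R] M} (h : ∀ i, f (single i 1) = g (single i 1)) : f = g :=
  Finsupp.lhom_ext' fun i => LinearMap.ext_ring (h i)

/-- Two linear maps on a free module agree on the span of the part `s` of the basis if they agree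
on `s`. -/
theorem _root_.Finsupp.eqOn_supported {ι M : Type*} {R : Type v} [CommRing R] [AddCommGroup M]
    [Module R M] {f g : (ι →₀ R) →ₗ[R] M} {s : Set ι}
    (h : ∀ i ∈ s, f (single i 1) = g (single i 1)) {c : ι →₀ R} (hc : c ∈ supported R R s) :
    f c = g c := by
  rw [supported_eq_span_single] at hc
  refine LinearMap.eqOn_span (f := f) (g := g) ?_ hc
  rintro _ ⟨i, hi, rfl⟩
  exact h i hi

/-- A linear map carries the span of the part `s` of the basis into the submodule `P` if it does so
on `s`. -/
theorem _root_.Finsupp.map_supported_mem {ι M : Type*} {R : Type v} [CommRing R] [AddCommGroup M]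
    [Module R M] {f : (ι →₀ R) →ₗ[R] M} {s : Set ι} {P : Submodule R M}
    (h : ∀ i ∈ s, f (single i 1) ∈ P) {c : ι →₀ R} (hc : c ∈ supported R R s) : f c ∈ P := by
  rw [supported_eq_span_single] at hc
  have : Submodule.span R ((fun i => single i (1 : R)) '' s) ≤ P.comap f := by
    rw [Submodule.span_le]
    rintro _ ⟨i, hi, rfl⟩
    exact h i hi
  exact this hc

/-- The cone operator: a point is put in front of every list. -/
noncomputable def cons (a : α) : (List α →₀ R) →ₗ[R] (List α →₀ R) := lmapDomain R R (a :: ·)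

@[simp] theorem cons_single (a : α) (l : List α) (r : R) :
    cons R a (single l r) = single (a :: l) r := by
  simp [cons]

/-- The boundary of a list, the alternating sum of the lists with one entry removed. -/
noncomputable def bdryList : List α → (List α →₀ R)
  | [] => 0
  | a :: l => single l 1 - cons R a (bdryList l)

/-- The boundary operator on chains of lists. -/
noncomputable def bdry : (List α →₀ R) →ₗ[R] (List α →₀ R) := linearCombination R (bdryList R)

@[simp] theorem bdry_single (l : List α) : bdry R (single l 1) = bdryList R l := by
  simp [bdry]

theorem bdry_cons (a : α) (c : List α →₀ R) : bdry R (cons R a c) = c - cons R a (bdry R c) := by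
  have : bdry R ∘ₗ cons R a = LinearMap.id - cons R a ∘ₗ bdry R :=
    Finsupp.lhom_ext_single fun l => by simp [bdryList]
  exact LinearMap.congr_fun this c

theorem bdry_bdryList (l : List α) : bdry R (bdryList R l) = 0 := by
  induction l with
  | nil => simp [bdryList]
  | cons a l ih => simp [bdryList, bdry_cons, ih]

/-- The length clause drives every induction on lists below; the inclusion of entries is what the
mesh estimate for subdivision needs. -/
theorem bdryList_mem_supported (l : List α) :
    bdryList R l ∈ supported R R {l' : List α | l'.length + 1 = l.length ∧ l' ⊆ l} := by
  induction l with
  | nil => simp [bdryList]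
  | cons a l ih =>
    refine Submodule.sub_mem _ (single_mem_supported R _ (by simp)) ?_
    refine Finsupp.map_supported_mem (fun l' hl' => ?_) ih
    rw [cons_single]
    exact single_mem_supported R _ ⟨by simpa using hl'.1, List.cons_subset_cons a hl'.2⟩

theorem bdryList_ofFn {k : ℕ} (w : Fin (k + 1) → α) :
    bdryList R (List.ofFn w) =
      ∑ i : Fin (k + 1), (-1 : R) ^ (i : ℕ) • single (List.ofFn (w ∘ i.succAbove)) 1 := by
  induction k with
  | zero => simp [bdryList]
  | succ k ih =>
    conv_rhs => rw [Fin.sum_univ_succ]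
    rw [List.ofFn_succ, bdryList, ih, map_sum, sub_eq_add_neg, ← Finset.sum_neg_distrib]
    congr 1
    · simp [Function.comp_def]
    · refine Finset.sum_congr rfl fun i _ => ?_
      rw [map_smul, cons_single, List.ofFn_succ (f := w ∘ _), Fin.val_succ, pow_succ, mul_neg_one,
        neg_smul]
      simp [Function.comp_def]

/-- The chain map induced by a map of points. -/
noncomputable def map (f : α → β) : (List α →₀ R) →ₗ[R] (List β →₀ R) :=
  lmapDomain R R (List.map f)

@[simp] theorem map_single (f : α → β) (l : List α) (r : R) :
    map R f (single l r) = single (l.map f) r := by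
  simp [map]

theorem map_cons (f : α → β) (a : α) (c : List α →₀ R) :
    map R f (cons R a c) = cons R (f a) (map R f c) := by
  have : map R f ∘ₗ cons R a = cons R (f a) ∘ₗ map R f :=
    Finsupp.lhom_ext_single fun l => by simp
  exact LinearMap.congr_fun this c

theorem map_bdryList (f : α → β) (l : List α) :
    map R f (bdryList R l) = bdryList R (l.map f) := by
  induction l with
  | nil => simp [bdryList]
  | cons a l ih => simp [bdryList, map_cons, ih]

theorem bdry_map (f : α → β) (c : List α →₀ R) :
    bdry R (map R f c) = map R f (bdry R c) := by
  have : bdry R ∘ₗ map R f = map R f ∘ₗ bdry R :=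
    Finsupp.lhom_ext_single fun l => by simp [map_bdryList]
  exact LinearMap.congr_fun this c

/-! #### The prism operator -/

/-- The prism over a list. -/
noncomputable def prismList : List α → (List (α × unitInterval) →₀ R)
  | [] => 0
  | a :: l => single ((a, 0) :: (a, 1) :: l.map (·, 1)) 1 - cons R (a, 0) (prismList l)

/-- The prism operator. -/
noncomputable def prism : (List α →₀ R) →ₗ[R] (List (α × unitInterval) →₀ R) :=
  linearCombination R (prismList R)

@[simp] theorem prism_single (l : List α) : prism R (single l 1) = prismList R l := by
  simp [prism]

theorem prism_cons (a : α) (c : List α →₀ R) :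
    prism R (cons R a c) =
      cons R (a, 0) (cons R (a, 1) (map R (·, 1) c)) - cons R (a, 0) (prism R c) := by
  have : prism R ∘ₗ cons R a = cons R (a, 0) ∘ₗ cons R (a, 1) ∘ₗ map R (·, 1) -
      cons R (a, 0) ∘ₗ prism R :=
    Finsupp.lhom_ext_single fun l => by simp [prismList]
  exact LinearMap.congr_fun this c

/-- Both operators are recursive in the first entry, so one induction on the list suffices. Since
the empty list is kept as a chain, one-point lists are not an exceptional case. -/
theorem bdry_prism (c : List α →₀ R) :
    bdry R (prism R c) + prism R (bdry R c) = map R (·, 1) c - map R (·, 0) c := by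
  have : bdry R ∘ₗ prism R + prism R ∘ₗ bdry R =
      map R (fun a : α => (a, (1 : unitInterval))) - map R (fun a : α => (a, 0)) := by
    refine Finsupp.lhom_ext_single fun l => ?_
    simp only [LinearMap.add_apply, LinearMap.comp_apply, bdry_single, prism_single,
      LinearMap.sub_apply, map_single]
    induction l with
    | nil => simp [prismList, bdryList]
    | cons a l ih =>
      simp only [prismList, bdryList, map_sub, prism_single, bdry_single, bdry_cons, prism_cons,
        List.map_cons, map_bdryList]
      rw [← eq_sub_iff_add_eq] at ih
      rw [ih]
      simp only [map_sub, cons_single]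
      abel
  exact LinearMap.congr_fun this c

theorem map_prism (f : α → β) (c : List α →₀ R) :
    map R (Prod.map f id) (prism R c) = prism R (map R f c) := by
  have : map R (Prod.map f id) ∘ₗ prism R = prism R ∘ₗ map R f := by
    refine Finsupp.lhom_ext_single fun l => ?_
    simp only [LinearMap.comp_apply, prism_single, map_single]
    induction l with
    | nil => simp [prismList]
    | cons a l ih => simp [prismList, map_cons, ih, Function.comp_def]
  exact LinearMap.congr_fun this c

/-! #### Subdivision -/

/-- Auxiliary recursion for `coneRec`, on the length of the lists. -/
noncomputable def coneRecAux (b : List α → α) (Φ : (List α →₀ R) →ₗ[R] (List α →₀ R)) (s r : R) :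
    ℕ → (List α →₀ R) →ₗ[R] (List α →₀ R)
  | 0 => r • LinearMap.id
  | n + 1 => linearCombination R fun l =>
      cons R (b l) (Φ (single l 1) + s • coneRecAux b Φ s r n (bdryList R l))

/-- The operator `K` with `K [] = r []` and `K l = b(l) · (Φ l + s K(∂ l))` for nonempty lists
`l`. -/
noncomputable def coneRec (b : List α → α) (Φ : (List α →₀ R) →ₗ[R] (List α →₀ R)) (s r : R) :
    (List α →₀ R) →ₗ[R] (List α →₀ R) :=
  linearCombination R fun l => coneRecAux R b Φ s r l.length (single l 1)

theorem coneRec_nil (b : List α → α) (Φ : (List α →₀ R) →ₗ[R] (List α →₀ R)) (s r : R) :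
    coneRec R b Φ s r (single [] 1) = r • single [] 1 := by
  simp [coneRec, coneRecAux]

theorem coneRec_cons (b : List α → α) (Φ : (List α →₀ R) →ₗ[R] (List α →₀ R)) (s r : R) {l : List α}
    (hl : l ≠ []) : coneRec R b Φ s r (single l 1) =
      cons R (b l) (Φ (single l 1) + s • coneRec R b Φ s r (bdryList R l)) := by
  obtain ⟨a, l, rfl⟩ := List.exists_cons_of_ne_nil hl
  -- All lists in the boundary of `a :: l` have length `l.length`, exactly the recursion depth that
  -- remains.
  have : coneRecAux R b Φ s r l.length (bdryList R (a :: l)) =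
      coneRec R b Φ s r (bdryList R (a :: l)) := by
    refine Finsupp.eqOn_supported (fun l' hl' => ?_) (bdryList_mem_supported R (a :: l))
    have : l'.length = l.length := by simpa using hl'.1
    simp [coneRec, this]
  rw [← this]
  simp [coneRec, coneRecAux]

/-- Induction on the length of lists, for statements about linear maps. -/
theorem list_induction {P : List α → Prop} (h0 : P [])
    (h : ∀ l : List α, l ≠ [] → (∀ l' : List α, l'.length + 1 = l.length → P l') → P l)
    (l : List α) : P l := by
  induction hn : l.length generalizing l with
  | zero => rwa [List.length_eq_zero_iff.mp hn]
  | succ n ih =>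
    exact h l (by rintro rfl; simp at hn) fun l' hl' => ih l' (by omega)

/-- The recursion consults `b` only at nonempty lists, so `hb` may ignore the meaningless barycenter
of the empty list. This is the source of the naturality of subdivision. -/
theorem map_coneRec (f : α → β) {b : List α → α} {b' : List β → β}
    (hb : ∀ l : List α, l ≠ [] → f (b l) = b' (l.map f))
    {Φ : (List α →₀ R) →ₗ[R] (List α →₀ R)} {Φ' : (List β →₀ R) →ₗ[R] (List β →₀ R)}
    (hΦ : ∀ c, map R f (Φ c) = Φ' (map R f c)) (s r : R) (c : List α →₀ R) :
    map R f (coneRec R b Φ s r c) = coneRec R b' Φ' s r (map R f c) := by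
  have : map R f ∘ₗ coneRec R b Φ s r = coneRec R b' Φ' s r ∘ₗ map R f := by
    refine Finsupp.lhom_ext_single fun l => ?_
    induction l using list_induction with
    | h0 => simp [coneRec_nil]
    | h l hl ih =>
      have h2 := Finsupp.eqOn_supported (f := map R f ∘ₗ coneRec R b Φ s r)
        (g := coneRec R b' Φ' s r ∘ₗ map R f) (fun l' hl' => ih l' hl'.1)
        (bdryList_mem_supported R l)
      simp only [LinearMap.comp_apply, map_single] at h2 ⊢
      rw [coneRec_cons R b Φ s r hl, coneRec_cons R b' Φ' s r (by simpa using hl), map_cons,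
        map_add, hΦ, map_smul, h2, hb l hl, map_single, map_bdryList]
  exact LinearMap.congr_fun this c

/-- Barycentric subdivision, with respect to a choice `b` of barycenters. -/
noncomputable def sd (b : List α → α) : (List α →₀ R) →ₗ[R] (List α →₀ R) := coneRec R b 0 1 1

/-- A chain homotopy from the identity to barycentric subdivision. -/
noncomputable def sdHomotopy (b : List α → α) : (List α →₀ R) →ₗ[R] (List α →₀ R) :=
  coneRec R b (sd R b - LinearMap.id) (-1) 0

/-- Here `sd l` is the cone over `sd (∂ l)`. By induction `∂ sd ∂ l = sd ∂ ∂ l = 0`, and the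
boundary of the cone over a cycle is that cycle. -/
theorem bdry_sd (b : List α → α) (c : List α →₀ R) : bdry R (sd R b c) = sd R b (bdry R c) := by
  have : bdry R ∘ₗ sd R b = sd R b ∘ₗ bdry R := by
    refine Finsupp.lhom_ext_single fun l => ?_
    induction l using list_induction with
    | h0 => simp [sd, coneRec_nil, bdryList]
    | h l hl ih =>
      have h2 := Finsupp.eqOn_supported (f := bdry R ∘ₗ sd R b) (g := sd R b ∘ₗ bdry R)
        (fun l' hl' => ih l' hl'.1) (bdryList_mem_supported R l)
      simp only [LinearMap.comp_apply, bdry_single] at h2 ⊢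
      rw [sd, coneRec_cons R b 0 1 1 hl, ← sd, bdry_cons]
      simp [h2, bdry_bdryList]
  exact LinearMap.congr_fun this c

/-- The homotopy `K` is the cone over `sd l - l - K (∂ l)`, which is a cycle by the induction
hypothesis for `∂ l`; hence its boundary is this same expression. -/
theorem bdry_sdHomotopy (b : List α → α) (c : List α →₀ R) :
    bdry R (sdHomotopy R b c) + sdHomotopy R b (bdry R c) = sd R b c - c := by
  have : bdry R ∘ₗ sdHomotopy R b + sdHomotopy R b ∘ₗ bdry R = sd R b - LinearMap.id := by
    refine Finsupp.lhom_ext_single fun l => ?_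
    induction l using list_induction with
    | h0 => simp [sdHomotopy, sd, coneRec_nil, bdryList]
    | h l hl ih =>
      have h2 := Finsupp.eqOn_supported (f := bdry R ∘ₗ sdHomotopy R b + sdHomotopy R b ∘ₗ bdry R)
        (g := sd R b - LinearMap.id) (fun l' hl' => ih l' hl'.1) (bdryList_mem_supported R l)
      simp only [LinearMap.comp_apply, bdry_single, LinearMap.add_apply, LinearMap.sub_apply,
        LinearMap.id_apply, bdry_bdryList, map_zero, add_zero] at h2 ⊢
      rw [sdHomotopy, coneRec_cons R b _ _ _ hl, ← sdHomotopy, bdry_cons]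
      simp [h2, bdry_sd]
  exact LinearMap.congr_fun this c

theorem map_sd (f : α → β) {b : List α → α} {b' : List β → β}
    (hb : ∀ l : List α, l ≠ [] → f (b l) = b' (l.map f)) (c : List α →₀ R) :
    map R f (sd R b c) = sd R b' (map R f c) :=
  map_coneRec R f hb (fun _ => by simp) 1 1 c

theorem map_sdHomotopy (f : α → β) {b : List α → α} {b' : List β → β}
    (hb : ∀ l : List α, l ≠ [] → f (b l) = b' (l.map f)) (c : List α →₀ R) :
    map R f (sdHomotopy R b c) = sdHomotopy R b' (map R f c) :=
  map_coneRec R f hb (fun _ => by simp [map_sd R f hb]) (-1) 0 c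

end ListChain

/-! ### Singular chains

Singular chains of all degrees are collected into a single free module. -/

namespace SingularChain

open Finsupp

/-- The standard topological simplex of dimension `k`. -/
abbrev TopSimplex (k : ℕ) := stdSimplex ℝ (Fin (k + 1))

/-- The singular simplices of a space, of all dimensions. -/
abbrev Simp (T : Type*) [TopologicalSpace T] := Σ k : ℕ, C(TopSimplex k, T)

/-- The inclusion of a facet of the standard simplex. -/
noncomputable def face {k : ℕ} (i : Fin (k + 2)) : C(TopSimplex k, TopSimplex (k + 1)) :=
  ⟨stdSimplex.map i.succAbove, stdSimplex.continuous_map _⟩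

variable (R : Type v) [CommRing R] {T T' T'' : Type*} [TopologicalSpace T] [TopologicalSpace T']
  [TopologicalSpace T'']

/-- The boundary of a singular simplex. -/
noncomputable def bdrySimp : Simp T → (Simp T →₀ R)
  | ⟨0, _⟩ => 0
  | ⟨k + 1, s⟩ => ∑ i : Fin (k + 2), (-1 : R) ^ (i : ℕ) • single ⟨k, s.comp (face i)⟩ 1

/-- The boundary operator. -/
noncomputable def bdry : (Simp T →₀ R) →ₗ[R] (Simp T →₀ R) := linearCombination R (bdrySimp R)

@[simp] theorem bdry_single (s : Simp T) : bdry R (single s 1) = bdrySimp R s := by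
  simp [bdry]

/-- The chain map induced by a continuous map. -/
noncomputable def map (f : C(T, T')) : (Simp T →₀ R) →ₗ[R] (Simp T' →₀ R) :=
  lmapDomain R R fun s => ⟨s.1, f.comp s.2⟩

@[simp] theorem map_single (f : C(T, T')) (s : Simp T) (r : R) :
    map R f (single s r) = single ⟨s.1, f.comp s.2⟩ r := by
  simp [map]

theorem map_map (g : C(T', T'')) (f : C(T, T')) (c : Simp T →₀ R) :
    map R g (map R f c) = map R (g.comp f) c := by
  have : map R g ∘ₗ map R f = map R (g.comp f) :=
    Finsupp.lhom_ext_single fun s => by simp [ContinuousMap.comp_assoc]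
  exact LinearMap.congr_fun this c

@[simp] theorem map_id (c : Simp T →₀ R) : map R (ContinuousMap.id T) c = c := by
  have : map R (ContinuousMap.id T) = LinearMap.id :=
    Finsupp.lhom_ext_single fun s => by simp
  exact LinearMap.congr_fun this c

theorem map_bdrySimp (f : C(T, T')) (s : Simp T) :
    map R f (bdrySimp R s) = bdrySimp R ⟨s.1, f.comp s.2⟩ := by
  obtain ⟨_ | k, s⟩ := s
  · simp [bdrySimp]
  · simp [bdrySimp, ContinuousMap.comp_assoc]

theorem bdry_map (f : C(T, T')) (c : Simp T →₀ R) : bdry R (map R f c) = map R f (bdry R c) := by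
  have : bdry R ∘ₗ map R f = map R f ∘ₗ bdry R :=
    Finsupp.lhom_ext_single fun s => by simp [map_bdrySimp]
  exact LinearMap.congr_fun this c

/-- The chains all of whose simplices lie in `A`. -/
noncomputable def chainsIn (A : Set T) : Submodule R (Simp T →₀ R) :=
  supported R R {s : Simp T | ∀ t, s.2 t ∈ A}

theorem chainsIn_mono {A B : Set T} (h : A ⊆ B) : chainsIn R A ≤ chainsIn R B :=
  supported_mono fun _ hs t => h (hs t)

theorem chainsIn_univ (c : Simp T →₀ R) : c ∈ chainsIn R (Set.univ : Set T) := by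
  simp [chainsIn]

theorem bdry_mem {A : Set T} {c : Simp T →₀ R} (hc : c ∈ chainsIn R A) :
    bdry R c ∈ chainsIn R A := by
  refine Finsupp.map_supported_mem (fun s hs => ?_) hc
  rw [bdry_single]
  obtain ⟨_ | k, s⟩ := s
  · exact Submodule.zero_mem _
  · exact Submodule.sum_mem _ fun i _ => Submodule.smul_mem _ _
      (single_mem_supported R _ fun t => hs _)

theorem map_mem {A : Set T} {B : Set T'} {f : C(T, T')} (h : ∀ t ∈ A, f t ∈ B) {c : Simp T →₀ R}
    (hc : c ∈ chainsIn R A) : map R f c ∈ chainsIn R B := by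
  refine Finsupp.map_supported_mem (fun s hs => ?_) hc
  rw [map_single]
  exact single_mem_supported R _ fun t => h _ (hs t)

/-! #### Affine simplices -/

section Affine

variable {E : Type*} [NormedAddCommGroup E] [NormedSpace ℝ E] {C : Set E} (hC : Convex ℝ C)

/-- The affine simplex with given vertices in a convex set. -/
noncomputable def comb {k : ℕ} (w : Fin (k + 1) → C) : C(TopSimplex k, C) where
  toFun t := ⟨∑ i, t.1 i • (w i).1,
    hC.sum_mem (fun i _ => t.2.1 i) t.2.2 (fun i _ => (w i).2)⟩
  continuous_toFun := by
    refine Continuous.subtype_mk (continuous_finsetSum _ fun i _ => ?_) _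
    exact ((continuous_apply i).comp continuous_subtype_val).smul continuous_const

theorem comb_map {k m : ℕ} (w : Fin (k + 1) → C) (f : Fin (m + 1) → Fin (k + 1)) (t : TopSimplex m) :
    comb hC w (stdSimplex.map f t) = comb hC (w ∘ f) t := by
  refine Subtype.ext ?_
  change ∑ j, (stdSimplex.map f t) j • (w j).1 = ∑ i, t.1 i • (w (f i)).1
  rw [← Finset.sum_fiberwise Finset.univ f]
  refine Finset.sum_congr rfl fun j _ => ?_
  rw [stdSimplex.map_coe, FunOnFinite.linearMap_apply_apply, Finset.sum_smul]
  refine Finset.sum_congr rfl fun i hi => ?_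
  rw [(Finset.mem_filter.mp hi).2]
  rfl

theorem comb_face {k : ℕ} (w : Fin (k + 2) → C) (i : Fin (k + 2)) :
    (comb hC w).comp (face i) = comb hC (w ∘ i.succAbove) :=
  ContinuousMap.ext fun t => comb_map hC w _ t

theorem comb_comb {k m : ℕ} (w : Fin (k + 1) → C) (v : Fin (m + 1) → TopSimplex k)
    (t : TopSimplex m) :
    comb hC w (comb (convex_stdSimplex ℝ _) v t) = comb hC (fun i => comb hC w (v i)) t := by
  refine Subtype.ext ?_
  simp only [comb, ContinuousMap.coe_mk, Finset.sum_apply, Finset.sum_smul, Finset.smul_sum,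
    Pi.smul_apply, smul_eq_mul, mul_smul]
  exact Finset.sum_comm

theorem comb_vertex {k : ℕ} (w : Fin (k + 1) → C) (i : Fin (k + 1)) :
    comb hC w (stdSimplex.vertex i) = w i := by
  refine Subtype.ext ?_
  simp [comb, Pi.single_apply]

end Affine

/-- The affine simplex with given vertices in a standard simplex. -/
noncomputable abbrev scomb {k m : ℕ} (w : Fin (m + 1) → TopSimplex k) :
    C(TopSimplex m, TopSimplex k) :=
  comb (convex_stdSimplex ℝ _) w

theorem scomb_vertex_eq_id {k : ℕ} :
    scomb (fun i : Fin (k + 1) => stdSimplex.vertex i) = ContinuousMap.id (TopSimplex k) := by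
  refine ContinuousMap.ext fun t => Subtype.ext (funext fun j => ?_)
  simp [comb, Finset.sum_apply, Pi.single_apply]

/-- The affine simplex with given vertices in a prism. -/
noncomputable def pcomb {k m : ℕ} (w : Fin (m + 1) → TopSimplex k × unitInterval) :
    C(TopSimplex m, TopSimplex k × unitInterval) :=
  (scomb fun i => (w i).1).prodMk (comb (convex_Icc (0 : ℝ) 1) fun i => (w i).2)

theorem pcomb_face {k m : ℕ} (w : Fin (m + 2) → TopSimplex k × unitInterval) (i : Fin (m + 2)) :
    (pcomb w).comp (face i) = pcomb (w ∘ i.succAbove) :=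
  ContinuousMap.ext fun t => Prod.ext (comb_map _ _ _ t) (comb_map _ _ _ t)

/-! #### Realization of list chains -/

section Real

variable {κ : ∀ {m : ℕ}, (Fin (m + 1) → T) → C(TopSimplex m, T)}
  {κ' : ∀ {m : ℕ}, (Fin (m + 1) → T') → C(TopSimplex m, T')}

/-- The simplex with the vertices in a list, where `κ` says how to span a simplex. -/
noncomputable def realList (κ : ∀ {m : ℕ}, (Fin (m + 1) → T) → C(TopSimplex m, T)) :
    List T → (Simp T →₀ R)
  | [] => 0
  | a :: l => single ⟨l.length, κ (a :: l).get⟩ 1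

/-- The singular chain given by a chain of lists of vertices. -/
noncomputable def real (κ : ∀ {m : ℕ}, (Fin (m + 1) → T) → C(TopSimplex m, T)) :
    (List T →₀ R) →ₗ[R] (Simp T →₀ R) :=
  linearCombination R (realList R κ)

@[simp] theorem real_single (l : List T) : real R κ (single l 1) = realList R κ l := by
  simp [real]

theorem realList_ofFn {k : ℕ} (w : Fin (k + 1) → T) :
    realList R κ (List.ofFn w) = single ⟨k, κ w⟩ 1 := by
  have key : ∀ (a : T) (l : List T) (h : (a :: l).length = k + 1),
      realList R κ (a :: l) = single ⟨k, κ fun i => (a :: l).get (Fin.cast h.symm i)⟩ 1 := by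
    intro a l h
    obtain rfl : l.length = k := by simpa using h
    rfl
  have h1 : List.ofFn w = w 0 :: List.ofFn (fun i => w (Fin.succ i)) := List.ofFn_succ
  have h2 : (List.ofFn w).length = k + 1 := List.length_ofFn
  have h3 : w = fun i => (List.ofFn w).get (Fin.cast h2.symm i) := by
    funext i
    simp [-List.ofFn_succ]
  generalize List.ofFn w = l at h1 h2 h3
  subst h1
  rw [key _ _ h2, ← h3]

theorem exists_ofFn {α : Type*} {l : List α} (hl : l ≠ []) :
    ∃ (k : ℕ) (w : Fin (k + 1) → α), l = List.ofFn w := by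
  obtain ⟨a, l, rfl⟩ := List.exists_cons_of_ne_nil hl
  exact ⟨l.length, (a :: l).get, (List.ofFn_get _).symm⟩

theorem bdry_real (hκ : ∀ {m : ℕ} (w : Fin (m + 2) → T) (i : Fin (m + 2)),
    (κ w).comp (face i) = κ (w ∘ i.succAbove)) (c : List T →₀ R) :
    bdry R (real R κ c) = real R κ (ListChain.bdry R c) := by
  have : bdry R ∘ₗ real R κ = real R κ ∘ₗ ListChain.bdry R := by
    refine Finsupp.lhom_ext_single fun l => ?_
    rcases eq_or_ne l [] with rfl | hl
    · simp [realList, ListChain.bdryList]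
    obtain ⟨k, w, rfl⟩ := exists_ofFn hl
    simp only [LinearMap.comp_apply, real_single, realList_ofFn, bdry_single,
      ListChain.bdry_single, ListChain.bdryList_ofFn, map_sum, map_smul]
    cases k with
    -- The list boundary of a single point is the empty list, which is realized by zero: the
    -- augmentation is forgotten.
    | zero => simp [bdrySimp, realList]
    | succ k =>
      simp only [bdrySimp]
      refine Finset.sum_congr rfl fun i _ => ?_
      rw [realList_ofFn, hκ]
  exact LinearMap.congr_fun this c

theorem map_real (f : C(T, T'))
    (hf : ∀ {m : ℕ} (w : Fin (m + 1) → T), f.comp (κ w) = κ' (f ∘ w)) (c : List T →₀ R) :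
    map R f (real R κ c) = real R κ' (ListChain.map R f c) := by
  have : map R f ∘ₗ real R κ = real R κ' ∘ₗ ListChain.map R f := by
    refine Finsupp.lhom_ext_single fun l => ?_
    rcases eq_or_ne l [] with rfl | hl
    · simp [realList]
    obtain ⟨k, w, rfl⟩ := exists_ofFn hl
    simp [-List.ofFn_succ, realList_ofFn, List.map_ofFn, hf]
  exact LinearMap.congr_fun this c

end Real

/-! #### Natural operators -/

/-- The list of vertices of the standard simplex. -/
def vertices (k : ℕ) : List (TopSimplex k) := List.ofFn fun i => stdSimplex.vertex i

/-- A family of operators from list chains in a simplex to list chains in the prism over it. -/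
abbrev OpFamily := ∀ k : ℕ, (List (TopSimplex k) →₀ R) →ₗ[R]
  (List (TopSimplex k × unitInterval) →₀ R)

variable {R}

/-- Compatibility of a family of operators with affine maps. -/
structure OpFamily.Natural (G : OpFamily R) : Prop where
  nil : ∀ k, real R pcomb (G k (single [] 1)) = 0
  map : ∀ {k m : ℕ} (w : Fin (m + 1) → TopSimplex k) (c : List (TopSimplex m) →₀ R),
    ListChain.map R (Prod.map (scomb w) id) (G m c) = G k (ListChain.map R (scomb w) c)

/-- The operator on singular chains given by a family of operators on list chains and a map out of
the cylinder. -/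
noncomputable def op (G : OpFamily R) (F : C(T × unitInterval, T')) :
    (Simp T →₀ R) →ₗ[R] (Simp T' →₀ R) :=
  linearCombination R fun s => map R (F.comp (s.2.prodMap (ContinuousMap.id _)))
    (real R pcomb (G s.1 (single (vertices s.1) 1)))

@[simp] theorem op_single (G : OpFamily R) (F : C(T × unitInterval, T')) (s : Simp T) :
    op G F (single s 1) = map R (F.comp (s.2.prodMap (ContinuousMap.id _)))
      (real R pcomb (G s.1 (single (vertices s.1) 1))) := by
  simp [op]

theorem op_mem (G : OpFamily R) {F : C(T × unitInterval, T')} {A : Set T} {B : Set T'}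
    (h : ∀ t ∈ A, ∀ τ, F (t, τ) ∈ B) {c : Simp T →₀ R} (hc : c ∈ chainsIn R A) :
    op G F c ∈ chainsIn R B := by
  refine Finsupp.map_supported_mem (fun s hs => ?_) hc
  rw [op_single]
  exact map_mem R (A := Set.univ) (fun t _ => h _ (hs t.1) _) (chainsIn_univ R _)

theorem map_op (G : OpFamily R) {D D' : Type*} [TopologicalSpace D] [TopologicalSpace D']
    {F : C(T × unitInterval, T')} {F' : C(D × unitInterval, D')} {p : C(D, T)} {p' : C(D', T')}
    (h : ∀ d τ, p' (F' (d, τ)) = F (p d, τ)) (c : Simp D →₀ R) :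
    map R p' (op G F' c) = op G F (map R p c) := by
  have : map R p' ∘ₗ op G F' = op G F ∘ₗ map R p := by
    refine Finsupp.lhom_ext_single fun s => ?_
    simp only [LinearMap.comp_apply, op_single, map_map, map_single]
    congr 1
    congr 1
    exact ContinuousMap.ext fun t => h _ _
  exact LinearMap.congr_fun this c

theorem pcomb_natural {k m n : ℕ} (w : Fin (m + 1) → TopSimplex k)
    (v : Fin (n + 1) → TopSimplex m × unitInterval) :
    ((scomb w).prodMap (ContinuousMap.id unitInterval)).comp (pcomb v) =
      pcomb (((scomb w).prodMap (ContinuousMap.id unitInterval)) ∘ v) :=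
  ContinuousMap.ext fun t => Prod.ext (comb_comb _ _ _ t) rfl

theorem face_eq_scomb {k : ℕ} (i : Fin (k + 2)) :
    (face i : C(TopSimplex k, TopSimplex (k + 1))) =
      scomb ((fun j => stdSimplex.vertex j) ∘ i.succAbove) := by
  refine Eq.trans ?_ (comb_face (convex_stdSimplex ℝ (Fin (k + 2)))
    (fun j => stdSimplex.vertex j) i)
  exact (congrArg (fun f : C(TopSimplex (k + 1), TopSimplex (k + 1)) => f.comp (face i))
    (scomb_vertex_eq_id (k := k + 1))).symm

/-- Together with `bdry_op_single` this reduces identities of operators on singular chains to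
identities of list chains on the vertices of one standard simplex. Facet inclusions are affine, so
naturality moves `G` across them. For a 0-simplex the list boundary is the empty list, and the field
`nil` takes care of it. -/
theorem op_bdrySimp {G : OpFamily R} (hG : G.Natural) (F : C(T × unitInterval, T')) (s : Simp T) :
    op G F (bdrySimp R s) = map R (F.comp (s.2.prodMap (ContinuousMap.id _)))
      (real R pcomb (G s.1 (ListChain.bdryList R (vertices s.1)))) := by
  obtain ⟨_ | k, s⟩ := s
  · rw [vertices, ListChain.bdryList_ofFn]
    simp [bdrySimp, hG.nil]
  · rw [vertices, ListChain.bdryList_ofFn]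
    simp only [bdrySimp, map_sum, map_smul, op_single]
    refine Finset.sum_congr rfl fun i _ => ?_
    congr 1
    have h1 : List.ofFn ((fun j : Fin (k + 2) => (stdSimplex.vertex j : TopSimplex (k + 1))) ∘
        i.succAbove) = (vertices k).map (scomb ((fun j => stdSimplex.vertex j) ∘ i.succAbove)) := by
      rw [vertices, List.map_ofFn]
      congr 1
      funext j
      exact (comb_vertex _ _ j).symm
    rw [h1, ← ListChain.map_single, ← hG.map]
    have h2 := map_real R (κ := pcomb) (κ' := pcomb)
      ((scomb ((fun j => stdSimplex.vertex j) ∘ i.succAbove)).prodMap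
        (ContinuousMap.id unitInterval)) (pcomb_natural _)
        (G k (single (vertices k) 1))
    refine Eq.trans ?_ (congrArg _ h2)
    rw [map_map, face_eq_scomb]
    rfl

theorem bdry_op_single (G : OpFamily R) (F : C(T × unitInterval, T')) (s : Simp T) :
    bdry R (op G F (single s 1)) = map R (F.comp (s.2.prodMap (ContinuousMap.id _)))
      (real R pcomb (ListChain.bdry R (G s.1 (single (vertices s.1) 1)))) := by
  rw [op_single, bdry_map, bdry_real R pcomb_face]

/-- A family of operators acting through one end of the cylinder. -/
theorem map_real_end {k : ℕ} (τ : unitInterval) (f : C(TopSimplex k × unitInterval, T))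
    (c : List (TopSimplex k) →₀ R) :
    map R f (real R pcomb (ListChain.map R (·, τ) c)) =
      map R (f.comp ((ContinuousMap.id _).prodMk (ContinuousMap.const _ τ))) (real R scomb c) := by
  rw [← map_map]
  congr 1
  refine (map_real R (κ := scomb) (κ' := pcomb)
    ((ContinuousMap.id _).prodMk (ContinuousMap.const _ τ)) (fun {m} w => ?_) c).symm
  refine ContinuousMap.ext fun t => Prod.ext rfl (Subtype.ext ?_)
  have : ∑ i, t.1 i = 1 := t.2.2
  simp [pcomb, comb, ← Finset.sum_mul, this]

theorem real_vertices (k : ℕ) :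
    real R scomb (single (vertices k) 1) = single ⟨k, ContinuousMap.id (TopSimplex k)⟩ 1 := by
  rw [real_single, vertices, realList_ofFn, scomb_vertex_eq_id]

/-! #### The prism operator -/

variable (R) in
/-- The family of prism operators. -/
noncomputable def prismFamily : OpFamily R := fun _ => ListChain.prism R

theorem prismFamily_natural : (prismFamily R).Natural where
  nil k := by simp [prismFamily, ListChain.prismList]
  map w c := ListChain.map_prism R _ c

variable (R) in
/-- The chain homotopy given by a homotopy. -/
noncomputable def prism (F : C(T × unitInterval, T')) : (Simp T →₀ R) →ₗ[R] (Simp T' →₀ R) :=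
  op (prismFamily R) F

/-- One end of a homotopy. -/
def homotopyEnd (F : C(T × unitInterval, T')) (τ : unitInterval) : C(T, T') :=
  F.comp ((ContinuousMap.id _).prodMk (ContinuousMap.const _ τ))

theorem bdry_prism (F : C(T × unitInterval, T')) (c : Simp T →₀ R) :
    bdry R (prism R F c) + prism R F (bdry R c) =
      map R (homotopyEnd F 1) c - map R (homotopyEnd F 0) c := by
  have : bdry R ∘ₗ prism R F + prism R F ∘ₗ bdry R =
      map R (homotopyEnd F 1) - map R (homotopyEnd F 0) := by
    refine Finsupp.lhom_ext_single fun s => ?_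
    simp only [LinearMap.add_apply, LinearMap.comp_apply, prism, bdry_op_single, bdry_single,
      op_bdrySimp prismFamily_natural, LinearMap.sub_apply]
    rw [← LinearMap.map_add, ← LinearMap.map_add]
    have h := ListChain.bdry_prism R (single (vertices s.1) 1)
    rw [ListChain.bdry_single] at h
    simp only [prismFamily, h, LinearMap.map_sub, map_real_end, real_vertices, map_single]
    rfl
  exact LinearMap.congr_fun this c

end SingularChain

namespace SingularChain

open Finsupp

variable {R : Type v} [CommRing R] {T T' : Type*} [TopologicalSpace T] [TopologicalSpace T']

/-! #### Barycentric subdivision -/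

theorem list_sum_mem_stdSimplex {k : ℕ} {l : List (TopSimplex k)} (hl : l ≠ []) :
    (l.length : ℝ)⁻¹ • (l.map Subtype.val).sum ∈ stdSimplex ℝ (Fin (k + 1)) := by
  have h1 : ∀ l : List (TopSimplex k), (∀ i, 0 ≤ (l.map Subtype.val).sum i) ∧
      ∑ i, (l.map Subtype.val).sum i = l.length := by
    intro l
    induction l with
    | nil => simp
    | cons a l ih =>
      have : ∑ i, a.1 i = 1 := a.2.2
      refine ⟨fun i => ?_, ?_⟩
      · simpa using add_nonneg (a.2.1 i) (ih.1 i)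
      · rw [List.map_cons, List.sum_cons]
        simp only [Pi.add_apply, Finset.sum_add_distrib, ih.2, List.length_cons]
        rw [this]
        push_cast
        ring
  have h2 : (l.length : ℝ) ≠ 0 := by
    simpa [List.length_eq_zero_iff] using hl
  refine ⟨fun i => ?_, ?_⟩
  · exact mul_nonneg (by positivity) ((h1 l).1 i)
  · simp only [Pi.smul_apply, smul_eq_mul, ← Finset.mul_sum, (h1 l).2]
    exact inv_mul_cancel₀ h2

open Classical in
/-- The barycenter of a list of points of a simplex. -/
noncomputable def bary {k : ℕ} (l : List (TopSimplex k)) : TopSimplex k :=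
  if h : l = [] then stdSimplex.vertex 0 else ⟨_, list_sum_mem_stdSimplex h⟩

theorem bary_coe {k : ℕ} {l : List (TopSimplex k)} (hl : l ≠ []) :
    (bary l).1 = (l.length : ℝ)⁻¹ • (l.map Subtype.val).sum := by
  simp [bary, hl]

/-- The only property of `bary` on which the naturality of subdivision rests; it holds because
`scomb w` is affine. -/
theorem scomb_bary {k m : ℕ} (w : Fin (m + 1) → TopSimplex k) {l : List (TopSimplex m)}
    (hl : l ≠ []) : scomb w (bary l) = bary (l.map (scomb w)) := by
  refine Subtype.ext ?_
  rw [bary_coe (by simpa using hl), List.length_map]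
  have h : ∀ l : List (TopSimplex m), ∑ i, (l.map Subtype.val).sum i • (w i).1 =
      ((l.map (scomb w)).map Subtype.val).sum := by
    intro l
    induction l with
    | nil => simp
    | cons a l ih =>
      simp only [List.map_cons, List.sum_cons, Pi.add_apply, add_smul, Finset.sum_add_distrib, ih]
      rfl
  rw [← h, Finset.smul_sum]
  simp only [comb, ContinuousMap.coe_mk, bary_coe hl, Pi.smul_apply, smul_assoc]

theorem norm_list_sum_sub_le {E : Type*} [NormedAddCommGroup E] {d : ℝ} (v : E) (l : List E)
    (h : ∀ x ∈ l, ‖x - v‖ ≤ d) : ‖l.sum - l.length • v‖ ≤ l.length * d := by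
  induction l with
  | nil => simp
  | cons a l ih =>
    have h1 := ih fun x hx => h x (List.mem_cons_of_mem _ hx)
    have h2 := h a List.mem_cons_self
    rw [List.sum_cons, List.length_cons, succ_nsmul,
      show a + l.sum - (l.length • v + v) = (a - v) + (l.sum - l.length • v) by abel]
    refine (norm_add_le _ _).trans ?_
    push_cast
    linarith

/-- With one occurrence of `v` removed, `m` entries remain, and the barycenter minus `v` is `1 / (m
+ 1)` times the sum of their differences from `v`. This gives the factor `m / (m + 1)`, which is at
most `n / (n + 1)`. -/
theorem dist_bary_le {k n : ℕ} {d : ℝ} {l : List (TopSimplex k)} (hn : l.length ≤ n + 1)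
    (hd : ∀ x ∈ l, ∀ y ∈ l, dist x y ≤ d) {v : TopSimplex k} (hv : v ∈ l) :
    dist (bary l) v ≤ (n / (n + 1) : ℝ) * d := by
  classical
  have hl : l ≠ [] := List.ne_nil_of_mem hv
  have hd0 : 0 ≤ d := dist_nonneg.trans (hd v hv v hv)
  have hperm := List.perm_cons_erase hv
  have hlen : l.length = (l.erase v).length + 1 := by simpa using hperm.length_eq
  have hsum : (l.map Subtype.val).sum = v.1 + ((l.erase v).map Subtype.val).sum := by
    simpa using (hperm.map Subtype.val).sum_eq
  set m := (l.erase v).length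
  have hm : (0 : ℝ) < m + 1 := by positivity
  have h1 := norm_list_sum_sub_le (d := d) v.1 ((l.erase v).map Subtype.val) (by
    intro x hx
    obtain ⟨y, hy, rfl⟩ := List.mem_map.mp hx
    rw [← dist_eq_norm]
    exact hd y (List.mem_of_mem_erase hy) v hv)
  rw [List.length_map] at h1
  have h2 : (bary l).1 - v.1 =
      ((m : ℝ) + 1)⁻¹ • (((l.erase v).map Subtype.val).sum - m • v.1) := by
    rw [bary_coe hl, hlen, hsum, eq_inv_smul_iff₀ hm.ne', smul_sub, Nat.cast_add, Nat.cast_one,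
      smul_inv_smul₀ hm.ne', add_smul, one_smul, ← Nat.cast_smul_eq_nsmul ℝ]
    abel
  have hmn : (m : ℝ) ≤ n := by exact_mod_cast (by omega : m ≤ n)
  rw [Subtype.dist_eq, dist_eq_norm, h2, norm_smul, Real.norm_of_nonneg (by positivity)]
  refine (mul_le_mul_of_nonneg_left h1 (by positivity)).trans ?_
  rw [← mul_assoc, inv_mul_eq_div]
  refine mul_le_mul_of_nonneg_right ?_ hd0
  rw [div_le_div_iff₀ hm (by positivity)]
  nlinarith

/-- The lists of a given length in the convex hull of a list with small mutual distances. -/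
theorem sd_mem_supported {k n : ℕ} {d : ℝ} (l : List (TopSimplex k)) (hn : l.length ≤ n + 1)
    (hd : ∀ x ∈ l, ∀ y ∈ l, dist x y ≤ d) :
    ListChain.sd R bary (single l 1) ∈ supported R R {l' : List (TopSimplex k) |
      l'.length = l.length ∧ (∀ x ∈ l', x.1 ∈ convexHull ℝ (Subtype.val '' {x | x ∈ l})) ∧
      ∀ x ∈ l', ∀ y ∈ l', dist x y ≤ (n / (n + 1) : ℝ) * d} := by
  induction l using ListChain.list_induction with
  | h0 =>
    simp only [ListChain.sd, ListChain.coneRec_nil, one_smul]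
    exact single_mem_supported R _ (by simp)
  | h l hl ih =>
    rw [ListChain.sd, ListChain.coneRec_cons R _ _ _ _ hl, LinearMap.zero_apply, zero_add, one_smul,
      ← ListChain.sd, ← LinearMap.comp_apply]
    refine Finsupp.map_supported_mem (fun l₁ hl₁ => ?_) (ListChain.bdryList_mem_supported R l)
    rw [LinearMap.comp_apply]
    obtain ⟨hlen, hsub⟩ := hl₁
    refine Finsupp.map_supported_mem (fun l₂ hl₂ => ?_)
      (ih l₁ hlen (by omega) fun x hx y hy => hd x (hsub hx) y (hsub hy))
    obtain ⟨h1, h2, h3⟩ := hl₂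
    rw [ListChain.cons_single]
    have hmono : convexHull ℝ (Subtype.val '' {x | x ∈ l₁}) ⊆
        convexHull ℝ (Subtype.val '' {x | x ∈ l}) :=
      convexHull_mono (Set.image_mono fun x hx => hsub hx)
    -- The vertices of a subdivided facet are not entries of `l`, but they lie in its convex hull.
    -- This is why the hull is part of the induction: a ball around the barycenter that contains the
    -- entries contains the hull.
    have hball : convexHull ℝ (Subtype.val '' {x | x ∈ l}) ⊆
        Metric.closedBall (bary l).1 ((n / (n + 1) : ℝ) * d) := by
      refine convexHull_min ?_ (convex_closedBall _ _)
      rintro _ ⟨v, hv, rfl⟩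
      rw [Metric.mem_closedBall, dist_comm]
      exact dist_bary_le hn hd hv
    have hd0 : 0 ≤ (n / (n + 1) : ℝ) * d := by
      obtain ⟨a, ha⟩ := List.exists_mem_of_ne_nil l hl
      exact dist_nonneg.trans (dist_bary_le hn hd ha)
    have hb : ∀ y ∈ l₂, dist y (bary l) ≤ (n / (n + 1) : ℝ) * d :=
      fun y hy => hball (hmono (h2 y hy))
    refine single_mem_supported R _ ⟨by simp [h1, hlen], ?_, ?_⟩
    · intro x hx
      rcases List.mem_cons.mp hx with rfl | hx
      · rw [bary_coe hl]
        have hmem : ∀ i : Fin l.length, l[i].1 ∈ convexHull ℝ (Subtype.val '' {x | x ∈ l}) :=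
          fun i => subset_convexHull ℝ _ ⟨_, List.getElem_mem i.2, rfl⟩
        have hlen0 : (l.length : ℝ) ≠ 0 := by
          simpa [List.length_eq_zero_iff] using hl
        have := (convex_convexHull ℝ (Subtype.val '' {x | x ∈ l})).sum_mem
          (t := Finset.univ) (w := fun _ : Fin l.length => (l.length : ℝ)⁻¹)
          (fun _ _ => by positivity) (by simp [hlen0]) (fun i _ => hmem i)
        rw [← Finset.smul_sum] at this
        convert this using 2
        rw [← Fin.sum_univ_fun_getElem]
        rfl
      · exact hmono (h2 x hx)
    · intro x hx y hy
      rcases List.mem_cons.mp hx with rfl | hx <;> rcases List.mem_cons.mp hy with rfl | hy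
      · rwa [dist_self]
      · rw [dist_comm]; exact hb y hy
      · exact hb x hx
      · exact h3 x hx y hy

theorem sd_iterate_mem_supported {k n : ℕ} {d : ℝ} (N : ℕ) (l : List (TopSimplex k))
    (hn : l.length ≤ n + 1) (hd : ∀ x ∈ l, ∀ y ∈ l, dist x y ≤ d) :
    (ListChain.sd R bary ^ N) (single l 1) ∈ supported R R {l' : List (TopSimplex k) |
      l'.length = l.length ∧ ∀ x ∈ l', ∀ y ∈ l', dist x y ≤ (n / (n + 1) : ℝ) ^ N * d} := by
  induction N with
  | zero => exact single_mem_supported R _ ⟨rfl, by simpa using hd⟩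
  | succ N ih =>
    rw [pow_succ' (ListChain.sd R bary), Module.End.mul_apply]
    refine Finsupp.map_supported_mem (fun l₁ hl₁ => ?_) ih
    refine supported_mono ?_ (sd_mem_supported (n := n) l₁ (hl₁.1.trans_le hn) hl₁.2)
    rintro l₂ ⟨h1, -, h2⟩
    refine ⟨h1.trans hl₁.1, fun x hx y hy => (h2 x hx y hy).trans_eq ?_⟩
    rw [pow_succ']
    ring

variable (R) in
/-- The family of subdivision operators. -/
noncomputable def sdFamily : OpFamily R := fun _ =>
  ListChain.map R (fun a => (a, (0 : unitInterval))) ∘ₗ ListChain.sd R bary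

variable (R) in
/-- The family of homotopies from the identity to subdivision. -/
noncomputable def sdHomotopyFamily : OpFamily R := fun _ =>
  ListChain.map R (fun a => (a, (0 : unitInterval))) ∘ₗ ListChain.sdHomotopy R bary

theorem map_prodMap_map {α β : Type*} (f : α → β) (c : List α →₀ R) :
    ListChain.map R (Prod.map f id) (ListChain.map R (fun a => (a, (0 : unitInterval))) c) =
      ListChain.map R (fun a => (a, (0 : unitInterval))) (ListChain.map R f c) := by
  have : ListChain.map R (Prod.map f id) ∘ₗ ListChain.map R (fun a => (a, (0 : unitInterval))) =
      ListChain.map R (fun a => (a, (0 : unitInterval))) ∘ₗ ListChain.map R f :=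
    Finsupp.lhom_ext_single fun l => by simp [Function.comp_def]
  exact LinearMap.congr_fun this c

theorem sdFamily_natural : (sdFamily R).Natural where
  nil k := by simp [sdFamily, ListChain.sd, ListChain.coneRec_nil, realList]
  map w c := by
    simp only [sdFamily, LinearMap.comp_apply, map_prodMap_map]
    rw [ListChain.map_sd R (scomb w) (b := bary) (b' := bary) fun l hl => scomb_bary w hl]

theorem sdHomotopyFamily_natural : (sdHomotopyFamily R).Natural where
  nil k := by simp [sdHomotopyFamily, ListChain.sdHomotopy, ListChain.coneRec_nil]
  map w c := by
    simp only [sdHomotopyFamily, LinearMap.comp_apply, map_prodMap_map]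
    rw [ListChain.map_sdHomotopy R (scomb w) (b := bary) (b' := bary) fun l hl => scomb_bary w hl]

variable (R) in
/-- Barycentric subdivision of singular chains. -/
noncomputable def sd : (Simp T →₀ R) →ₗ[R] (Simp T →₀ R) := op (sdFamily R) ContinuousMap.fst

variable (R) in
/-- The chain homotopy from the identity to barycentric subdivision. -/
noncomputable def sdHomotopy : (Simp T →₀ R) →ₗ[R] (Simp T →₀ R) :=
  op (sdHomotopyFamily R) ContinuousMap.fst

theorem bdry_sd (c : Simp T →₀ R) : bdry R (sd R c) = sd R (bdry R c) := by
  have : bdry R ∘ₗ sd R = sd R ∘ₗ bdry R (T := T) := by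
    refine Finsupp.lhom_ext_single fun s => ?_
    simp only [LinearMap.comp_apply, sd, bdry_op_single, bdry_single,
      op_bdrySimp sdFamily_natural]
    simp only [sdFamily, LinearMap.comp_apply, ListChain.bdry_map, ListChain.bdry_sd,
      ListChain.bdry_single]
  exact LinearMap.congr_fun this c

theorem bdry_sdHomotopy (c : Simp T →₀ R) :
    bdry R (sdHomotopy R c) + sdHomotopy R (bdry R c) = sd R c - c := by
  have : bdry R ∘ₗ sdHomotopy R + sdHomotopy R ∘ₗ bdry R (T := T) = sd R - LinearMap.id := by
    refine Finsupp.lhom_ext_single fun s => ?_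
    simp only [LinearMap.add_apply, LinearMap.comp_apply, sdHomotopy, bdry_op_single, bdry_single,
      op_bdrySimp sdHomotopyFamily_natural, LinearMap.sub_apply]
    simp only [sd, op_single]
    rw [← LinearMap.map_add, ← LinearMap.map_add]
    have h := ListChain.bdry_sdHomotopy R bary (single (vertices s.1) 1)
    rw [ListChain.bdry_single] at h
    simp only [sdHomotopyFamily, sdFamily, LinearMap.comp_apply, ListChain.bdry_map]
    rw [← LinearMap.map_add, h]
    simp only [LinearMap.map_sub, map_real_end, real_vertices]
    congr 1
    simp
    rfl
  exact LinearMap.congr_fun this c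

/-- Lets iterated subdivisions of a simplex be computed on lists, where the mesh estimate is
available. -/
theorem sd_real {k : ℕ} (c : List (TopSimplex k) →₀ R) :
    sd R (real R scomb c) = real R scomb (ListChain.sd R bary c) := by
  have : sd R ∘ₗ real R scomb = real R scomb ∘ₗ ListChain.sd R (bary (k := k)) := by
    refine Finsupp.lhom_ext_single fun l => ?_
    rcases eq_or_ne l [] with rfl | hl
    · simp [realList, ListChain.sd, ListChain.coneRec_nil]
    obtain ⟨m, w, rfl⟩ := exists_ofFn hl
    simp only [LinearMap.comp_apply, real_single, realList_ofFn, sd, op_single, sdFamily,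
      map_real_end]
    have h1 : List.ofFn w = (vertices m).map (scomb w) := by
      rw [vertices, List.map_ofFn]
      congr 1
      funext j
      exact (comb_vertex _ _ j).symm
    rw [h1, ← ListChain.map_single,
      ← ListChain.map_sd R (scomb w) (b := bary) (b' := bary) fun l hl => scomb_bary w hl]
    refine Eq.trans ?_ (map_real R (κ := scomb) (κ' := scomb) (scomb w)
      (fun v => ContinuousMap.ext fun t => comb_comb _ _ _ t) _)
    rfl
  exact LinearMap.congr_fun this c

theorem map_sd (f : C(T, T')) (c : Simp T →₀ R) : map R f (sd R c) = sd R (map R f c) :=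
  map_op _ (fun _ _ => rfl) c

theorem map_sd_pow (f : C(T, T')) (N : ℕ) (c : Simp T →₀ R) :
    map R f ((sd R ^ N) c) = (sd R ^ N) (map R f c) := by
  induction N generalizing c with
  | zero => rfl
  | succ N ih => rw [pow_succ (sd R), pow_succ (sd R), Module.End.mul_apply, Module.End.mul_apply, ih,
    map_sd]

theorem sd_mem {A : Set T} {c : Simp T →₀ R} (hc : c ∈ chainsIn R A) : sd R c ∈ chainsIn R A :=
  op_mem _ (fun _ ht _ => ht) hc

theorem sd_pow_mem {A : Set T} (N : ℕ) {c : Simp T →₀ R} (hc : c ∈ chainsIn R A) :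
    (sd R ^ N) c ∈ chainsIn R A := by
  induction N with
  | zero => exact hc
  | succ N ih =>
    rw [pow_succ', Module.End.mul_apply]
    exact sd_mem ih

theorem sd_pow_real {k : ℕ} (N : ℕ) (c : List (TopSimplex k) →₀ R) :
    (sd R ^ N) (real R scomb c) = real R scomb ((ListChain.sd R bary ^ N) c) := by
  induction N generalizing c with
  | zero => rfl
  | succ N ih => rw [pow_succ, Module.End.mul_apply, sd_real, ih, pow_succ, Module.End.mul_apply]

/-- Sufficiently fine subdivisions of a simplex are sums of simplices in the members of an open
cover by two sets. -/
theorem exists_sd_pow_single_mem {U V : Set T} (hU : IsOpen U) (hV : IsOpen V) {s : Simp T}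
    (hs : ∀ t, s.2 t ∈ U ∪ V) :
    ∃ N, ∀ M, N ≤ M → (sd R ^ M) (single s 1) ∈ chainsIn R U ⊔ chainsIn R V := by
  obtain ⟨k, s⟩ := s
  -- A Lebesgue number for the preimages of `V` and `U`, indexed by `false` and `true`.
  obtain ⟨δ, hδ, hcov⟩ := lebesgue_number_lemma_of_metric (s := (Set.univ : Set (TopSimplex k)))
    (c := fun b : Bool => s ⁻¹' (if b then U else V)) isCompact_univ
    (by rintro (_ | _) <;> simp only [Bool.false_eq_true, if_true, if_false]
        · exact hV.preimage s.continuous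
        · exact hU.preimage s.continuous)
    (fun t _ => by
      rcases hs t with h | h
      · exact Set.mem_iUnion.mpr ⟨true, h⟩
      · exact Set.mem_iUnion.mpr ⟨false, h⟩)
  obtain ⟨N, hN⟩ : ∃ N : ℕ, ∀ M, N ≤ M → (k / (k + 1) : ℝ) ^ M * 1 < δ := by
    have h1 : (k / (k + 1) : ℝ) < 1 := by
      rw [div_lt_one (by positivity)]
      linarith
    obtain ⟨N, hN⟩ := exists_pow_lt_of_lt_one hδ h1
    refine ⟨N, fun M hM => ?_⟩
    rw [mul_one]
    exact (pow_le_pow_of_le_one (by positivity) h1.le hM).trans_lt hN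
  refine ⟨N, fun M hM => ?_⟩
  have hsingle : (single ⟨k, s⟩ 1 : Simp T →₀ R) = map R s (real R scomb (single (vertices k) 1)) := by
    rw [real_vertices, map_single]
    rfl
  rw [hsingle, ← map_sd_pow, sd_pow_real, ← LinearMap.comp_apply]
  have hdist : ∀ x ∈ vertices k, ∀ y ∈ vertices k, dist x y ≤ 1 := fun x _ y _ =>
    (Metric.dist_le_diam_of_mem (bounded_stdSimplex _) x.2 y.2).trans diam_stdSimplex_le
  refine Finsupp.map_supported_mem (fun l hl => ?_)
    (sd_iterate_mem_supported (n := k) M (vertices k) (by simp [vertices]) hdist)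
  rw [LinearMap.comp_apply]
  rcases eq_or_ne l [] with rfl | hl0
  · simp [realList]
  obtain ⟨m, w, rfl⟩ := exists_ofFn hl0
  obtain ⟨b, hb⟩ := hcov (w 0) trivial
  -- All vertices are closer than `δ` to the first one, and balls are convex, so the whole affine
  -- simplex lies in one ball.
  have hmem : ∀ t, scomb w t ∈ Metric.ball (w 0) δ := by
    intro t
    have hconv : (scomb w t).1 ∈ Metric.ball (w 0).1 δ := by
      refine (convex_ball (w 0).1 δ).sum_mem (fun i _ => t.2.1 i) t.2.2 fun i _ => ?_
      exact (hl.2 (w i) (by simp [-List.ofFn_succ]) (w 0) (by simp [-List.ofFn_succ])).trans_lt (hN M hM)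
    exact hconv
  rw [real_single, realList_ofFn, map_single]
  cases b
  · exact Submodule.mem_sup_right (single_mem_supported R _ fun t => hb (hmem t))
  · exact Submodule.mem_sup_left (single_mem_supported R _ fun t => hb (hmem t))

/-- A chain involves finitely many simplices, so a maximum of exponents works. Asking for all `M ≥
N` makes such maxima possible, and later allows two chains to be subdivided equally often. -/
theorem exists_sd_pow_mem {U V W : Set T} (hU : IsOpen U) (hV : IsOpen V) (hW : W ⊆ U ∪ V)
    {c : Simp T →₀ R} (hc : c ∈ chainsIn R W) :
    ∃ N, ∀ M, N ≤ M → (sd R ^ M) c ∈ chainsIn R (U ∩ W) ⊔ chainsIn R (V ∩ W) := by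
  have key : ∃ N, ∀ M, N ≤ M → (sd R ^ M) c ∈ chainsIn R U ⊔ chainsIn R V := by
    rw [chainsIn, supported_eq_span_single] at hc
    induction hc using Submodule.span_induction with
    | mem x hx =>
      obtain ⟨s, hs, rfl⟩ := hx
      exact exists_sd_pow_single_mem hU hV fun t => hW (hs t)
    | zero => exact ⟨0, fun M _ => by simp⟩
    | add x y _ _ hx hy =>
      obtain ⟨N, hN⟩ := hx
      obtain ⟨N', hN'⟩ := hy
      refine ⟨max N N', fun M hM => ?_⟩
      rw [map_add]
      exact Submodule.add_mem _ (hN M (le_of_max_le_left hM)) (hN' M (le_of_max_le_right hM))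
    | smul r x _ hx =>
      obtain ⟨N, hN⟩ := hx
      refine ⟨N, fun M hM => ?_⟩
      rw [map_smul]
      exact Submodule.smul_mem _ _ (hN M hM)
  obtain ⟨N, hN⟩ := key
  refine ⟨N, fun M hM => ?_⟩
  have h1 := hN M hM
  have h2 := sd_pow_mem M hc
  -- All submodules here are spanned by parts of the basis, so sums and intersections become unions
  -- and intersections of sets of simplices.
  rw [chainsIn, chainsIn, ← supported_union] at h1 ⊢
  have h3 : (sd R ^ M) c ∈ supported R R (({s : Simp T | ∀ t, s.2 t ∈ U} ∪
      {s : Simp T | ∀ t, s.2 t ∈ V}) ∩ {s : Simp T | ∀ t, s.2 t ∈ W}) := by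
    rw [supported_inter]
    exact ⟨h1, h2⟩
  refine supported_mono ?_ h3
  rintro s ⟨hs | hs, hs'⟩
  · exact Or.inl fun t => ⟨hs t, hs' t⟩
  · exact Or.inr fun t => ⟨hs t, hs' t⟩

end SingularChain

namespace SingularChain

open Finsupp

variable {R : Type v} [CommRing R] {T D J : Type*} [TopologicalSpace T] [TopologicalSpace D]

/-! #### Excision -/

theorem sdHomotopy_mem {A : Set T} {c : Simp T →₀ R} (hc : c ∈ chainsIn R A) :
    sdHomotopy R c ∈ chainsIn R A :=
  op_mem _ (fun _ ht _ => ht) hc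

theorem prism_mem {F : C(T × unitInterval, D)} {A : Set T} {B : Set D}
    (h : ∀ t ∈ A, ∀ τ, F (t, τ) ∈ B) {c : Simp T →₀ R} (hc : c ∈ chainsIn R A) :
    prism R F c ∈ chainsIn R B :=
  op_mem _ h hc

variable (R) in
/-- The chain homotopy between the identity and an iterated subdivision followed by the end map of
a homotopy. -/
noncomputable def sdPrism (F : C(T × unitInterval, T)) :
    ℕ → (Simp T →₀ R) →ₗ[R] (Simp T →₀ R)
  | 0 => prism R F
  | N + 1 => map R (homotopyEnd F 1) ∘ₗ (sd R ^ N) ∘ₗ sdHomotopy R + sdPrism F N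

theorem bdry_sd_pow (N : ℕ) (c : Simp T →₀ R) : bdry R ((sd R ^ N) c) = (sd R ^ N) (bdry R c) := by
  induction N generalizing c with
  | zero => rfl
  | succ N ih => rw [pow_succ (sd R), Module.End.mul_apply, Module.End.mul_apply, ih, bdry_sd]

/-- A telescoping sum: with `h` the end map, `h sd^N` composed with the subdivision homotopy
connects `h sd^N` to `h sd^(N+1)`, and the prism connects the identity to `h`. -/
theorem bdry_sdPrism {F : C(T × unitInterval, T)} (hF : ∀ t, F (t, 0) = t) (N : ℕ)
    (c : Simp T →₀ R) : bdry R (sdPrism R F N c) + sdPrism R F N (bdry R c) =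
      map R (homotopyEnd F 1) ((sd R ^ N) c) - c := by
  induction N with
  | zero =>
    have : homotopyEnd F 0 = ContinuousMap.id T := ContinuousMap.ext hF
    rw [sdPrism, bdry_prism, this, map_id]
    rfl
  | succ N ih =>
    have h := congrArg (fun x => map R (homotopyEnd F 1) ((sd R ^ N) x)) (bdry_sdHomotopy c)
    simp only [map_add, map_sub] at h
    simp only [sdPrism, LinearMap.add_apply, LinearMap.comp_apply, map_add, bdry_map, bdry_sd_pow]
    rw [pow_succ (sd R), Module.End.mul_apply, ← sub_add_sub_cancel _
      (map R (homotopyEnd F 1) ((sd R ^ N) c)) c, ← h, ← ih]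
    abel

theorem sdPrism_mem {F : C(T × unitInterval, T)} {A : Set T} (h : ∀ t ∈ A, ∀ τ, F (t, τ) ∈ A)
    (N : ℕ) {c : Simp T →₀ R} (hc : c ∈ chainsIn R A) : sdPrism R F N c ∈ chainsIn R A := by
  induction N with
  | zero => exact prism_mem h hc
  | succ N ih =>
    exact Submodule.add_mem _ (map_mem R (fun t ht => h t ht 1)
      (sd_pow_mem N (sdHomotopy_mem hc))) ih

theorem map_sdPrism {F : C(T × unitInterval, T)} {F' : C(D × unitInterval, D)} {p : C(D, T)}
    (h : ∀ d τ, p (F' (d, τ)) = F (p d, τ)) (N : ℕ) (c : Simp D →₀ R) :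
    map R p (sdPrism R F' N c) = sdPrism R F N (map R p c) := by
  induction N with
  | zero => exact map_op _ h c
  | succ N ih =>
    have h1 : p.comp (homotopyEnd F' 1) = (homotopyEnd F 1).comp p :=
      ContinuousMap.ext fun d => h d 1
    have h2 : map R p (sdHomotopy R c) = sdHomotopy R (map R p c) := map_op _ (fun _ _ => rfl) c
    simp only [sdPrism, LinearMap.add_apply, LinearMap.comp_apply, map_add, ih]
    rw [map_map, h1, ← map_map, map_sd_pow, h2]

open Classical in
variable (R) in
/-- Replace the simplices in `S` by their images under a map that is continuous on `S`; forget the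
other simplices. -/
noncomputable def partialMap (S : Set T) {j : T → D} (hj : ContinuousOn j S) :
    (Simp T →₀ R) →ₗ[R] (Simp D →₀ R) :=
  linearCombination R fun s => if h : ∀ t, s.2 t ∈ S then
    single ⟨s.1, ⟨fun t => j (s.2 t), hj.comp_continuous s.2.continuous h⟩⟩ 1 else 0

theorem partialMap_single_of_mem {S : Set T} {j : T → D} (hj : ContinuousOn j S) {s : Simp T}
    (h : ∀ t, s.2 t ∈ S) : partialMap R S hj (single s 1) =
      single ⟨s.1, ⟨fun t => j (s.2 t), hj.comp_continuous s.2.continuous h⟩⟩ 1 := by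
  simp [partialMap, h]

theorem partialMap_mem {S A : Set T} {B : Set D} {j : T → D} (hj : ContinuousOn j S)
    (h : ∀ t ∈ A ∩ S, j t ∈ B) {c : Simp T →₀ R} (hc : c ∈ chainsIn R A) :
    partialMap R S hj c ∈ chainsIn R B := by
  refine Finsupp.map_supported_mem (fun s hs => ?_) hc
  by_cases h' : ∀ t, s.2 t ∈ S
  · rw [partialMap_single_of_mem hj h']
    exact single_mem_supported R _ fun t => h _ ⟨hs t, h' t⟩
  · rw [partialMap, linearCombination_single, dif_neg h', smul_zero]
    exact Submodule.zero_mem _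

/-- The restriction to chains in `S` is essential: a simplex that leaves `S` is forgotten, although
some of its facets may lie in `S`. -/
theorem bdry_partialMap {S : Set T} {j : T → D} (hj : ContinuousOn j S) {c : Simp T →₀ R}
    (hc : c ∈ chainsIn R S) : bdry R (partialMap R S hj c) = partialMap R S hj (bdry R c) := by
  refine Finsupp.eqOn_supported (f := bdry R ∘ₗ partialMap R S hj)
    (g := partialMap R S hj ∘ₗ bdry R) (fun s hs => ?_) hc
  obtain ⟨k, s⟩ := s
  simp only [LinearMap.comp_apply, partialMap_single_of_mem hj hs, bdry_single]
  cases k with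
  | zero => simp [bdrySimp]
  | succ k =>
    simp only [bdrySimp, map_sum, map_smul]
    refine Finset.sum_congr rfl fun i _ => ?_
    have hi := partialMap_single_of_mem (R := R) hj (s := ⟨k, s.comp (face i)⟩) fun t => hs _
    rw [hi]
    rfl

/-- Excision, in elementwise form: relative cycles of the pair `(W, A)` come from relative cycles of
`(D, p⁻¹ A)`. Here `F` deforms a neighbourhood `U` of `A` in `W` into `A`, and `p` is a
homeomorphism over the other member `V` of the cover. -/
theorem excision {p : C(D, T)} {A W U V : Set T} {F : C(T × unitInterval, T)}
    {F' : C(D × unitInterval, D)} {j : T → D} (hU : IsOpen U) (hV : IsOpen V)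
    (hUV : W ⊆ U ∪ V) (hF : ∀ t, F (t, 0) = t) (hF' : ∀ d, F' (d, 0) = d)
    (hFW : ∀ t ∈ W, ∀ τ, F (t, τ) ∈ W) (hFA : ∀ t ∈ A, ∀ τ, F (t, τ) ∈ A)
    (hpF : ∀ d τ, p (F' (d, τ)) = F (p d, τ)) (hpW : ∀ d, p d ∈ W)
    (hUA : ∀ t ∈ U ∩ W, F (t, 1) ∈ A) (hj : ContinuousOn j (V ∩ W))
    (hpj : ∀ t ∈ V ∩ W, p (j t) = t) (hjp : ∀ d, p d ∈ V → j (p d) = d)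
    {z : Simp T →₀ R} {b : Simp D →₀ R} (hz : z ∈ chainsIn R W)
    (hb : bdry R b ∈ chainsIn R (p ⁻¹' A)) (hzb : bdry R z - map R p b ∈ chainsIn R A) :
    ∃ w, b - bdry R w ∈ chainsIn R (p ⁻¹' A) ∧
      ∃ u ∈ chainsIn R W, z - map R p w - bdry R u ∈ chainsIn R A := by
  set h := homotopyEnd F 1 with hh
  set h' := homotopyEnd F' 1 with hh'
  have hj' : ContinuousOn (fun t => h' (j t)) (V ∩ W) := h'.continuous.comp_continuousOn hj
  -- A chain-level inverse of `p`. Following `j` by the end map `h'` makes the simplices in the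
  -- overlap with `U` land in `p⁻¹' A`, so that the discontinuity of the construction is invisible
  -- modulo `p⁻¹' A`.
  set ρ := partialMap R (V ∩ W) hj' with hρ
  have hph : ∀ d, p (h' d) = h (p d) := fun d => hpF d 1
  have hUB : ∀ t ∈ U ∩ W, ∀ ht : t ∈ V ∩ W, h' (j t) ∈ p ⁻¹' A := by
    intro t htU htV
    rw [Set.mem_preimage, hph, hpj t htV]
    exact hUA t htU
  have hAB : ∀ t ∈ A, ∀ ht : t ∈ V ∩ W, h' (j t) ∈ p ⁻¹' A := by
    intro t htA htV
    rw [Set.mem_preimage, hph, hpj t htV]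
    exact hFA t htA 1
  have hρU : ∀ c ∈ chainsIn R (U ∩ W), ρ c ∈ chainsIn R (p ⁻¹' A) := fun c hc =>
    partialMap_mem hj' (fun t ht => hUB t ht.1 ht.2) hc
  have hρA : ∀ c ∈ chainsIn R A, ρ c ∈ chainsIn R (p ⁻¹' A) := fun c hc =>
    partialMap_mem hj' (fun t ht => hAB t ht.1 ht.2) hc
  -- Modulo chains in `p⁻¹' A`, the operator `ρ` commutes with boundaries of small chains: exactly
  -- on the `V` part, and negligibly on the `U` part.
  have h1 : ∀ c ∈ chainsIn R (U ∩ W) ⊔ chainsIn R (V ∩ W),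
      bdry R (ρ c) - ρ (bdry R c) ∈ chainsIn R (p ⁻¹' A) := by
    intro c hc
    obtain ⟨x, hx, y, hy, rfl⟩ := Submodule.mem_sup.mp hc
    have h2 := bdry_partialMap hj' hy
    have h3 : bdry R (ρ (x + y)) - ρ (bdry R (x + y)) = bdry R (ρ x) - ρ (bdry R x) := by
      simp only [map_add, hρ, h2]
      abel
    rw [h3]
    exact Submodule.sub_mem _ (bdry_mem R (hρU x hx)) (hρU _ (bdry_mem R hx))
  -- On small chains `p ρ` agrees with `h` modulo `A`; the next claim is the counterpart `ρ p = h'`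
  -- modulo `p⁻¹' A`.
  have h2 : ∀ c ∈ chainsIn R (U ∩ W) ⊔ chainsIn R (V ∩ W),
      map R p (ρ c) - map R h c ∈ chainsIn R A := by
    intro c hc
    obtain ⟨x, hx, y, hy, rfl⟩ := Submodule.mem_sup.mp hc
    have h2 : map R p (ρ y) = map R h y := by
      refine Finsupp.eqOn_supported (f := map R p ∘ₗ ρ) (g := map R h) (fun s hs => ?_) hy
      rw [LinearMap.comp_apply, hρ, partialMap_single_of_mem hj' hs, map_single, map_single]
      congr 2
      refine ContinuousMap.ext fun t => ?_
      change p (h' (j (s.2 t))) = h (s.2 t)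
      rw [hph, hpj _ (hs t)]
    have h3 : map R p (ρ (x + y)) - map R h (x + y) = map R p (ρ x) - map R h x := by
      simp only [map_add, h2]
      abel
    rw [h3]
    exact Submodule.sub_mem _ (map_mem R (fun t ht => ht) (hρU x hx)) (map_mem R hUA hx)
  have h3 : ∀ c ∈ chainsIn R (p ⁻¹' U ∩ Set.univ) ⊔ chainsIn R (p ⁻¹' V ∩ Set.univ),
      ρ (map R p c) - map R h' c ∈ chainsIn R (p ⁻¹' A) := by
    intro c hc
    obtain ⟨x, hx, y, hy, rfl⟩ := Submodule.mem_sup.mp hc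
    have h2 : ρ (map R p y) = map R h' y := by
      refine Finsupp.eqOn_supported (f := ρ ∘ₗ map R p) (g := map R h') (fun s hs => ?_) hy
      have hs' := partialMap_single_of_mem (R := R) hj' (s := ⟨s.1, p.comp s.2⟩)
        fun t => (⟨(hs t).1, hpW _⟩ : p (s.2 t) ∈ V ∩ W)
      rw [LinearMap.comp_apply, map_single, hρ, hs', map_single]
      congr 2
      refine ContinuousMap.ext fun t => ?_
      change h' (j (p (s.2 t))) = h' (s.2 t)
      rw [hjp _ (hs t).1]
    have h3 : ρ (map R p (x + y)) - map R h' (x + y) = ρ (map R p x) - map R h' x := by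
      simp only [map_add, h2]
      abel
    rw [h3]
    refine Submodule.sub_mem _ (hρU _ (map_mem R (fun t ht => (⟨ht.1, hpW t⟩ : p t ∈ U ∩ W)) hx))
      (map_mem R (fun t ht => ?_) hx)
    rw [Set.mem_preimage, hph]
    exact hUA _ ⟨ht.1, hpW t⟩
  obtain ⟨N₁, hN₁⟩ := exists_sd_pow_mem hU hV hUV hz
  obtain ⟨N₂, hN₂⟩ := exists_sd_pow_mem (hU.preimage p.continuous) (hV.preimage p.continuous)
    (W := Set.univ) (fun d _ => hUV (hpW d)) (chainsIn_univ R b)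
  set N := max N₁ N₂
  have hzN := hN₁ N (le_max_left _ _)
  have hbN := hN₂ N (le_max_right _ _)
  have hpF' : ∀ t ∈ p ⁻¹' A, ∀ τ, F' (t, τ) ∈ p ⁻¹' A := by
    intro t ht τ
    rw [Set.mem_preimage, hpF]
    exact hFA _ ht τ
  -- Pull back the subdivided `z` by `ρ`. Its boundary is then `h' sd^N b` modulo `p⁻¹' A`, and
  -- `sdPrism` turns this back into `b`. Downstairs the same correction joins `h sd^N z` to `z`.
  refine ⟨ρ ((sd R ^ N) z) - sdPrism R F' N b, ?_, -sdPrism R F N z,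
    Submodule.neg_mem _ (sdPrism_mem hFW N hz), ?_⟩
  · have e1 := h1 _ hzN
    have e2 := h3 _ hbN
    have e3 := hρA _ (sd_pow_mem N hzb)
    have e4 := bdry_sdPrism hF' N b
    have e5 := sdPrism_mem hpF' N hb
    rw [map_sub, map_sub, ← bdry_sd_pow, ← map_sd_pow] at e3
    have : b - bdry R (ρ ((sd R ^ N) z) - sdPrism R F' N b) =
        -(bdry R (ρ ((sd R ^ N) z)) - ρ (bdry R ((sd R ^ N) z))) -
        (ρ (bdry R ((sd R ^ N) z)) - ρ (map R p ((sd R ^ N) b))) -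
        (ρ (map R p ((sd R ^ N) b)) - map R h' ((sd R ^ N) b)) - sdPrism R F' N (bdry R b) := by
      rw [map_sub, eq_sub_iff_add_eq.mpr e4]
      abel
    rw [this]
    exact Submodule.sub_mem _ (Submodule.sub_mem _ (Submodule.sub_mem _
      (Submodule.neg_mem _ e1) e3) e2) e5
  · have e1 := h2 _ hzN
    have e2 := bdry_sdPrism hF N z
    have e3 := sdPrism_mem hFA N hzb
    rw [map_sub] at e3
    rw [map_sub, map_sdPrism hpF, map_neg]
    have : z - (map R p (ρ ((sd R ^ N) z)) - sdPrism R F N (map R p b)) -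
        -bdry R (sdPrism R F N z) =
        -(map R p (ρ ((sd R ^ N) z)) - map R h ((sd R ^ N) z)) -
        (sdPrism R F N (bdry R z) - sdPrism R F N (map R p b)) := by
      rw [eq_sub_iff_add_eq.mpr e2]
      abel
    rw [this]
    exact Submodule.sub_mem _ (Submodule.neg_mem _ e1) e3

/-! #### Contractible spaces -/

variable (R) in
/-- The `0`-chain given by a linear combination of points. -/
noncomputable def points (i : J → T) : (J →₀ R) →ₗ[R] (Simp T →₀ R) :=
  linearCombination R fun j => single ⟨0, ContinuousMap.const _ (i j)⟩ 1

@[simp] theorem points_single (i : J → T) (j : J) :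
    points R i (single j 1) = single ⟨0, ContinuousMap.const _ (i j)⟩ 1 := by
  simp [points]

theorem points_mem {i : J → T} {A : Set T} (h : ∀ j, i j ∈ A) (c : J →₀ R) :
    points R i c ∈ chainsIn R A := by
  refine Finsupp.map_supported_mem (s := Set.univ) (fun j _ => ?_) (by simp)
  rw [points_single]
  exact single_mem_supported R _ fun _ => h j

theorem map_points (f : C(T, D)) (i : J → T) (c : J →₀ R) :
    map R f (points R i c) = points R (fun j => f (i j)) c := by
  have : map R f ∘ₗ points R i = points R (fun j => f (i j)) :=
    Finsupp.lhom_ext_single fun j => by simp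
  exact LinearMap.congr_fun this c

/-- All `k + 2` facets coincide, so only the alternating signs matter: they cancel for even `k` and
leave one term for odd `k`. -/
theorem bdrySimp_const (k : ℕ) (t : T) :
    bdrySimp R ⟨k + 1, ContinuousMap.const _ t⟩ =
      (if Even k then (0 : R) else 1) • single ⟨k, ContinuousMap.const _ t⟩ 1 := by
  have h : ∀ i : Fin (k + 2), (ContinuousMap.const (TopSimplex (k + 1)) t).comp (face i) =
      ContinuousMap.const _ t := fun i => rfl
  simp only [bdrySimp, h, ← Finset.sum_smul, Fin.sum_neg_one_pow]
  simp [Nat.even_add]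

open Classical in
/-- The chains of a discrete space are acyclic in positive degrees. -/
theorem discrete_acyclic [TopologicalSpace J] [DiscreteTopology J] {z : Simp J →₀ R} {c : J →₀ R}
    (h : bdry R z = points R id c) : c = 0 ∧ ∃ c' u, z - points R id c' = bdry R u := by
  -- On constant simplices the boundary is an isomorphism from positive even degrees and zero from
  -- odd degrees. `G` inverts it, and only degree 0 is left over; `E` reads off that degree.
  let G : (Simp J →₀ R) →ₗ[R] (Simp J →₀ R) := linearCombination R fun s =>
    if Odd s.1 then single ⟨s.1 + 1, ContinuousMap.const _ (s.2 (stdSimplex.vertex 0))⟩ 1 else 0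
  let E : (Simp J →₀ R) →ₗ[R] (J →₀ R) := linearCombination R fun s =>
    if s.1 = 0 then single (s.2 (stdSimplex.vertex 0)) 1 else 0
  -- A simplex is connected, so its maps to a discrete space are constant.
  have hconst : ∀ s : Simp J, ∃ (k : ℕ) (j : J), s = ⟨k, ContinuousMap.const _ j⟩ := by
    rintro ⟨k, s⟩
    refine ⟨k, s (stdSimplex.vertex 0), ?_⟩
    congr 1
    refine ContinuousMap.ext fun t => ?_
    have : PreconnectedSpace (TopSimplex k) :=
      Subtype.preconnectedSpace (convex_stdSimplex ℝ _).isPreconnected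
    exact PreconnectedSpace.constant inferInstance s.continuous
  have hG : bdry R ∘ₗ G + G ∘ₗ bdry R = LinearMap.id - points R id ∘ₗ E := by
    refine Finsupp.lhom_ext_single fun s => ?_
    obtain ⟨k, j, rfl⟩ := hconst s
    simp only [LinearMap.add_apply, LinearMap.comp_apply, LinearMap.sub_apply, LinearMap.id_apply,
      bdry_single, G, E, linearCombination_single, one_smul]
    cases k with
    | zero => simp [bdrySimp]
    | succ k =>
      rw [bdrySimp_const]
      rcases Nat.even_or_odd k with hk | hk
      · have h1 : Odd (k + 1) := hk.add_one
        simp [hk, h1, bdrySimp_const]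
      · have h1 : ¬ Odd (k + 1) := by simpa [Nat.odd_add_one] using hk
        simp [hk, h1, Nat.not_even_iff_odd.mpr hk]
  have hE : E ∘ₗ bdry R = 0 := by
    refine Finsupp.lhom_ext_single fun s => ?_
    obtain ⟨k, j, rfl⟩ := hconst s
    simp only [LinearMap.comp_apply, bdry_single, LinearMap.zero_apply]
    cases k with
    | zero => simp [bdrySimp]
    | succ k =>
      rw [bdrySimp_const]
      rcases Nat.eq_zero_or_pos k with rfl | hk
      · simp
      · rw [map_smul]
        simp [E, hk.ne']
  have hEp : E ∘ₗ points R id = LinearMap.id :=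
    Finsupp.lhom_ext_single fun j => by simp [E]
  have hc : c = 0 := by
    rw [← LinearMap.id_apply (R := R) c, ← hEp, LinearMap.comp_apply, ← h, ← LinearMap.comp_apply,
      hE, LinearMap.zero_apply]
  refine ⟨hc, E z, G z, ?_⟩
  have := LinearMap.congr_fun hG z
  simp only [LinearMap.add_apply, LinearMap.comp_apply, h, hc, map_zero, add_zero,
    LinearMap.sub_apply, LinearMap.id_apply] at this
  exact this.symm

/-- The chains of a space that contracts onto a discrete set of points. -/
theorem acyclic_of_contraction [TopologicalSpace J] [DiscreteTopology J] {A : Set T} (i : C(J, T)) (π : C(T, J))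
    {F : C(T × unitInterval, T)} (hF : ∀ t, F (t, 0) = t) (hF1 : ∀ t, F (t, 1) = i (π t))
    (hFA : ∀ t ∈ A, ∀ τ, F (t, τ) ∈ A) (hi : ∀ j, i j ∈ A) (hπ : ∀ j, π (i j) = j)
    {z : Simp T →₀ R} (hz : z ∈ chainsIn R A) {c : J →₀ R} (h : bdry R z = points R i c) :
    c = 0 ∧ ∃ c', ∃ u ∈ chainsIn R A, z - points R i c' = bdry R u := by
  have h1 : bdry R (map R π z) = points R id c := by
    rw [bdry_map, h, map_points]
    simp only [hπ]
    rfl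
  obtain ⟨hc, c', u, hu⟩ := discrete_acyclic h1
  -- As `z` is a cycle, the prism has boundary `i π z - z`, while `i u` bounds the difference of `i
  -- π z` and the points.
  refine ⟨hc, c', map R i u - prism R F z, Submodule.sub_mem _
    (map_mem R (A := Set.univ) (fun j _ => hi j) (chainsIn_univ R u)) (prism_mem hFA hz), ?_⟩
  have h2 := bdry_prism (R := R) F z
  have h3 : homotopyEnd F 1 = i.comp π := ContinuousMap.ext hF1
  have h4 : homotopyEnd F 0 = ContinuousMap.id T := ContinuousMap.ext hF
  rw [h, hc, map_zero, map_zero, add_zero, h3, h4, map_id, ← map_map] at h2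
  have h5 := congrArg (map R i) hu
  rw [map_sub, map_points] at h5
  rw [map_sub, bdry_map, h2, ← h5]
  simp only [id]
  abel

end SingularChain

/-! ### The triangulation of the cube -/

theorem cubeSimplex_map_apply {n k : ℕ} (σ : Equiv.Perm (Fin n)) (f : Fin (k + 1) → Fin (n + 1))
    (s : stdSimplex ℝ (Fin (k + 1))) (a : Fin n) :
    (cubeSimplex σ (stdSimplex.map f s) a : ℝ) =
      ∑ i ∈ Finset.univ.filter (fun i => (σ.symm a).castSucc < f i), s.1 i := by
  change ∑ j ∈ Finset.univ.filter (fun j : Fin (n + 1) => (σ.symm a).castSucc < j),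
    (stdSimplex.map f s) j = _
  simp only [stdSimplex.map_coe, FunOnFinite.linearMap_apply_apply]
  rw [Finset.sum_filter, Finset.sum_filter, ← Finset.sum_fiberwise Finset.univ f]
  refine Finset.sum_congr rfl fun j _ => ?_
  rw [← Finset.sum_filter, Finset.filter_filter]
  split_ifs with h
  · refine Finset.sum_congr (Finset.filter_congr fun i _ => ?_) fun _ _ => rfl
    exact ⟨fun hi => ⟨hi, hi ▸ h⟩, fun hi => hi.1⟩
  · refine (Finset.sum_eq_zero fun i hi => ?_).symm
    obtain ⟨h1, h2⟩ := (Finset.mem_filter.mp hi).2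
    exact absurd (h1 ▸ h2) h

namespace SingularChain

open Finsupp

variable {R : Type v} [CommRing R] {T : Type*} [TopologicalSpace T]

/-- The inclusion of a facet of the cube. -/
def cubeFace {n : ℕ} (i : Fin (n + 1)) (a : unitInterval) :
    C(Fin n → unitInterval, Fin (n + 1) → unitInterval) where
  toFun t := Fin.insertNth (α := fun _ => unitInterval) i a t
  continuous_toFun := Continuous.finInsertNth i continuous_const continuous_id

@[simp] theorem cubeFace_apply_same {n : ℕ} (i : Fin (n + 1)) (a : unitInterval)
    (t : Fin n → unitInterval) : cubeFace i a t i = a := by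
  simp [cubeFace]

@[simp] theorem cubeFace_apply_succAbove {n : ℕ} (i : Fin (n + 1)) (a : unitInterval)
    (t : Fin n → unitInterval) (k : Fin n) : cubeFace i a t (i.succAbove k) = t k := by
  simp [cubeFace]

/-- The permutation that sends `0` to `a` and is given by `σ` on the other elements. -/
def insertPerm {n : ℕ} (p : Fin (n + 1) × Equiv.Perm (Fin n)) : Equiv.Perm (Fin (n + 1)) :=
  p.1.cycleRange⁻¹ * Equiv.Perm.decomposeFin.symm (0, p.2)

@[simp] theorem insertPerm_zero {n : ℕ} (p : Fin (n + 1) × Equiv.Perm (Fin n)) :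
    insertPerm p 0 = p.1 := by
  simp [insertPerm, Equiv.Perm.inv_def]

@[simp] theorem insertPerm_succ {n : ℕ} (p : Fin (n + 1) × Equiv.Perm (Fin n)) (i : Fin n) :
    insertPerm p i.succ = p.1.succAbove (p.2 i) := by
  simp [insertPerm, Equiv.Perm.inv_def]

theorem sign_insertPerm {n : ℕ} (p : Fin (n + 1) × Equiv.Perm (Fin n)) :
    Equiv.Perm.sign (insertPerm p) = (-1) ^ (p.1 : ℕ) * Equiv.Perm.sign p.2 := by
  simp [insertPerm, Fin.sign_cycleRange, Equiv.Perm.decomposeFin.symm_sign]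

theorem insertPerm_bijective (n : ℕ) : Function.Bijective (insertPerm (n := n)) := by
  rw [Fintype.bijective_iff_injective_and_card]
  constructor
  · rintro ⟨a, σ⟩ ⟨b, τ⟩ h
    have h0 := congrArg (fun f : Equiv.Perm (Fin (n + 1)) => f 0) h
    simp only [insertPerm_zero] at h0
    subst h0
    refine Prod.ext rfl (Equiv.ext fun i => ?_)
    have hi := congrArg (fun f : Equiv.Perm (Fin (n + 1)) => f i.succ) h
    simpa using hi
  · simp [Fintype.card_perm, Nat.factorial_succ]

/-- Every vertex except the first contains `e_{σ(0)}`, so without it the simplex lies in the facet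
where this coordinate is 1, ordered by the remaining values of `σ`. -/
theorem cubeSimplex_face_zero {n : ℕ} {σ : Equiv.Perm (Fin (n + 1))} {τ : Equiv.Perm (Fin n)}
    (h : ∀ i, σ i.succ = (σ 0).succAbove (τ i)) :
    (cubeSimplex σ).comp (face 0) = (cubeFace (σ 0) 1).comp (cubeSimplex τ) := by
  refine ContinuousMap.ext fun s => funext fun a => Subtype.ext ?_
  change (cubeSimplex σ (stdSimplex.map _ s) a : ℝ) = cubeFace (σ 0) 1 (cubeSimplex τ s) a
  rw [cubeSimplex_map_apply]
  rcases Fin.eq_self_or_eq_succAbove (σ 0) a with rfl | ⟨b, rfl⟩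
  · have : ∑ i, s.1 i = 1 := s.2.2
    simp [this]
  · have hb : σ.symm ((σ 0).succAbove b) = (τ.symm b).succ := by
      rw [Equiv.symm_apply_eq, h, Equiv.apply_symm_apply]
    rw [hb, cubeFace_apply_succAbove]
    change _ = ∑ j ∈ Finset.univ.filter (fun j => (τ.symm b).castSucc < j), s.1 j
    refine Finset.sum_congr (Finset.filter_congr fun i _ => ?_) fun _ _ => rfl
    rw [Fin.zero_succAbove, ← Fin.succ_castSucc, Fin.succ_lt_succ_iff]

/-- Only the last vertex contains the direction `σ (Fin.last n)`; on the other vertices this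
coordinate is 0. -/
theorem cubeSimplex_face_last {n : ℕ} {σ : Equiv.Perm (Fin (n + 1))} {τ : Equiv.Perm (Fin n)}
    (h : ∀ i : Fin n, σ i.castSucc = (σ (Fin.last n)).succAbove (τ i)) :
    (cubeSimplex σ).comp (face (Fin.last (n + 1))) =
      (cubeFace (σ (Fin.last n)) 0).comp (cubeSimplex τ) := by
  refine ContinuousMap.ext fun s => funext fun a => Subtype.ext ?_
  change (cubeSimplex σ (stdSimplex.map _ s) a : ℝ) =
    cubeFace (σ (Fin.last n)) 0 (cubeSimplex τ s) a
  rw [cubeSimplex_map_apply]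
  rcases Fin.eq_self_or_eq_succAbove (σ (Fin.last n)) a with rfl | ⟨b, rfl⟩
  · rw [cubeFace_apply_same, Equiv.symm_apply_apply, Finset.filter_false_of_mem]
    · simp
    · intro i _
      rw [Fin.succAbove_last, Fin.castSucc_lt_castSucc_iff, not_lt]
      exact Fin.le_last i
  · have hb : σ.symm ((σ (Fin.last n)).succAbove b) = (τ.symm b).castSucc := by
      rw [Equiv.symm_apply_eq, h, Equiv.apply_symm_apply]
    rw [hb, cubeFace_apply_succAbove]
    change _ = ∑ j ∈ Finset.univ.filter (fun j => (τ.symm b).castSucc < j), s.1 j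
    refine Finset.sum_congr (Finset.filter_congr fun i _ => ?_) fun _ _ => rfl
    rw [Fin.succAbove_last, Fin.castSucc_lt_castSucc_iff]

/-- The vertex number `j + 1` is the only one that contains `σ(j)` without `σ(j + 1)`, so once it is
removed the order of these two directions is lost. -/
theorem cubeSimplex_face_inner {n : ℕ} (σ : Equiv.Perm (Fin (n + 1))) (j : Fin n) :
    (cubeSimplex (σ * Equiv.swap j.castSucc j.succ)).comp (face j.castSucc.succ) =
      (cubeSimplex σ).comp (face j.castSucc.succ) := by
  refine ContinuousMap.ext fun s => funext fun a => Subtype.ext ?_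
  change (cubeSimplex _ (stdSimplex.map _ s) a : ℝ) = cubeSimplex _ (stdSimplex.map _ s) a
  rw [cubeSimplex_map_apply, cubeSimplex_map_apply]
  refine Finset.sum_congr (Finset.filter_congr fun i _ => ?_) fun _ _ => rfl
  have h1 : (σ * Equiv.swap j.castSucc j.succ).symm a =
      Equiv.swap j.castSucc j.succ (σ.symm a) := by
    rw [Equiv.symm_apply_eq, Equiv.Perm.mul_apply, Equiv.swap_apply_self, Equiv.apply_symm_apply]
  have h2 := Fin.succAbove_ne j.castSucc.succ i
  have h3 : ((j.castSucc.succ.succAbove i : Fin (n + 2)) : ℕ) ≠ j + 1 := fun h =>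
    h2 (Fin.ext (by simpa using h))
  rw [h1]
  generalize σ.symm a = p
  rcases eq_or_ne p j.castSucc with rfl | hp
  · rw [Equiv.swap_apply_left, Fin.lt_def, Fin.lt_def]
    simp only [Fin.val_castSucc, Fin.val_succ]
    omega
  rcases eq_or_ne p j.succ with rfl | hp'
  · rw [Equiv.swap_apply_right, Fin.lt_def, Fin.lt_def]
    simp only [Fin.val_castSucc, Fin.val_succ]
    omega
  · rw [Equiv.swap_apply_of_ne_of_ne hp hp']

/-! ### The boundary of the triangulated cube -/

variable (R) in
/-- The signed sum of the simplices of the standard triangulation of a singular cube. -/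
noncomputable def cubeChain {n : ℕ} (g : C(Fin n → unitInterval, T)) : Simp T →₀ R :=
  ∑ σ : Equiv.Perm (Fin n), ((Equiv.Perm.sign σ : ℤ) : R) • single ⟨n, g.comp (cubeSimplex σ)⟩ 1

theorem cubeChain_mem {n : ℕ} {g : C(Fin n → unitInterval, T)} {A : Set T} (h : ∀ t, g t ∈ A) :
    cubeChain R g ∈ chainsIn R A :=
  Submodule.sum_mem _ fun _ _ => Submodule.smul_mem _ _ (single_mem_supported R _ fun _ => h _)

theorem map_cubeChain {T' : Type*} [TopologicalSpace T'] {n : ℕ} (f : C(T, T'))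
    (g : C(Fin n → unitInterval, T)) : map R f (cubeChain R g) = cubeChain R (f.comp g) := by
  simp [cubeChain, ContinuousMap.comp_assoc]

theorem sum_sign_face_zero {M : Type*} [AddCommGroup M] [Module R M] {n : ℕ}
    (φ : C(TopSimplex n, Fin (n + 1) → unitInterval) → M) :
    ∑ σ : Equiv.Perm (Fin (n + 1)), ((Equiv.Perm.sign σ : ℤ) : R) •
        φ ((cubeSimplex σ).comp (face 0)) =
      ∑ a : Fin (n + 1), (-1 : R) ^ (a : ℕ) • ∑ τ : Equiv.Perm (Fin n),
        ((Equiv.Perm.sign τ : ℤ) : R) • φ ((cubeFace a 1).comp (cubeSimplex τ)) := by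
  rw [← (insertPerm_bijective n).sum_comp, Fintype.sum_prod_type]
  refine Finset.sum_congr rfl fun a _ => ?_
  rw [Finset.smul_sum]
  refine Finset.sum_congr rfl fun τ _ => ?_
  rw [cubeSimplex_face_zero (σ := insertPerm (a, τ)) (τ := τ) (fun i => by simp), sign_insertPerm,
    smul_smul, insertPerm_zero]
  push_cast
  rfl

/-- Precomposition with the cyclic rotation moves the distinguished first value to the last
position, at the cost of its sign `(-1)^n`. -/
theorem sum_sign_face_last {M : Type*} [AddCommGroup M] [Module R M] {n : ℕ}
    (φ : C(TopSimplex n, Fin (n + 1) → unitInterval) → M) :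
    ∑ σ : Equiv.Perm (Fin (n + 1)), ((Equiv.Perm.sign σ : ℤ) : R) •
        φ ((cubeSimplex σ).comp (face (Fin.last (n + 1)))) =
      ∑ a : Fin (n + 1), (-1 : R) ^ (a + n : ℕ) • ∑ τ : Equiv.Perm (Fin n),
        ((Equiv.Perm.sign τ : ℤ) : R) • φ ((cubeFace a 0).comp (cubeSimplex τ)) := by
  rw [← Equiv.sum_comp (Equiv.mulRight (finRotate (n + 1))), ← (insertPerm_bijective n).sum_comp,
    Fintype.sum_prod_type]
  refine Finset.sum_congr rfl fun a _ => ?_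
  rw [Finset.smul_sum]
  refine Finset.sum_congr rfl fun τ _ => ?_
  have hlast : (insertPerm (a, τ) * finRotate (n + 1)) (Fin.last n) = a := by
    rw [Equiv.Perm.mul_apply, finRotate_last, insertPerm_zero]
  have hcast : ∀ i : Fin n, (insertPerm (a, τ) * finRotate (n + 1)) i.castSucc =
      a.succAbove (τ i) := by
    intro i
    have : finRotate (n + 1) i.castSucc = i.succ := by
      rw [finRotate_apply, Fin.coeSucc_eq_succ]
    rw [Equiv.Perm.mul_apply, this, insertPerm_succ]
  rw [Equiv.coe_mulRight, cubeSimplex_face_last (τ := τ) (fun i => by rw [hcast, hlast]), hlast,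
    Equiv.Perm.sign_mul, sign_insertPerm, sign_finRotate, smul_smul]
  push_cast
  congr 1
  rw [pow_add]
  ring

theorem sum_sign_face_inner {M : Type*} [AddCommGroup M] [Module R M] {n : ℕ} (j : Fin n)
    (φ : C(TopSimplex n, Fin (n + 1) → unitInterval) → M) :
    ∑ σ : Equiv.Perm (Fin (n + 1)), ((Equiv.Perm.sign σ : ℤ) : R) •
        φ ((cubeSimplex σ).comp (face j.castSucc.succ)) = 0 := by
  have hne : j.castSucc ≠ j.succ := (Fin.castSucc_lt_succ (i := j)).ne
  refine Finset.sum_involution (fun σ _ => σ * Equiv.swap j.castSucc j.succ) (fun σ _ => ?_)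
    (fun σ _ _ h => ?_) (fun _ _ => Finset.mem_univ _) (fun σ _ => ?_)
  · rw [cubeSimplex_face_inner, Equiv.Perm.sign_mul, Equiv.Perm.sign_swap hne]
    simp
  · have h1 : Equiv.swap j.castSucc j.succ = 1 := mul_eq_left.mp h
    exact hne (Equiv.swap_eq_one_iff.mp h1)
  · simp [mul_assoc]

/-- The alternating sum of the faces of the triangulated cube, in the form in which it enters both
the boundary of chains and the coboundary of cochains. -/
theorem sum_sign_faces {M : Type*} [AddCommGroup M] [Module R M] {n : ℕ}
    (φ : C(TopSimplex n, Fin (n + 1) → unitInterval) → M) :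
    ∑ σ : Equiv.Perm (Fin (n + 1)), ((Equiv.Perm.sign σ : ℤ) : R) •
        ∑ i : Fin (n + 2), (-1 : R) ^ (i : ℕ) • φ ((cubeSimplex σ).comp (face i)) =
      ∑ a : Fin (n + 1), (-1 : R) ^ (a + 1 : ℕ) •
        (∑ τ : Equiv.Perm (Fin n),
            ((Equiv.Perm.sign τ : ℤ) : R) • φ ((cubeFace a 0).comp (cubeSimplex τ)) -
          ∑ τ : Equiv.Perm (Fin n),
            ((Equiv.Perm.sign τ : ℤ) : R) • φ ((cubeFace a 1).comp (cubeSimplex τ))) := by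
  simp only [Finset.smul_sum (r := ((Equiv.Perm.sign _ : ℤ) : R))]
  rw [Finset.sum_comm]
  have h1 : ∀ i : Fin (n + 2), ∑ σ : Equiv.Perm (Fin (n + 1)), ((Equiv.Perm.sign σ : ℤ) : R) •
        (-1 : R) ^ (i : ℕ) • φ ((cubeSimplex σ).comp (face i)) =
      (-1 : R) ^ (i : ℕ) • ∑ σ : Equiv.Perm (Fin (n + 1)), ((Equiv.Perm.sign σ : ℤ) : R) •
        φ ((cubeSimplex σ).comp (face i)) := by
    intro i
    rw [Finset.smul_sum]
    exact Finset.sum_congr rfl fun σ _ => smul_comm _ _ _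
  simp only [h1]
  rw [Fin.sum_univ_succ, Fin.sum_univ_castSucc]
  simp only [sum_sign_face_inner, smul_zero, Finset.sum_const_zero, zero_add, Fin.succ_last,
    sum_sign_face_zero, sum_sign_face_last, Fin.val_zero, pow_zero, one_smul]
  rw [Finset.smul_sum, ← Finset.sum_add_distrib]
  refine Finset.sum_congr rfl fun a _ => ?_
  rw [smul_smul, smul_sub, add_comm, sub_eq_add_neg]
  congr 1
  · congr 1
    simp only [Fin.val_last, pow_add, pow_one, Nat.succ_eq_add_one]
    -- The face index contributes `(-1)^(n+1)` and the rotation `(-1)^n`, leaving `(-1)^(a+1)` for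
    -- the facet with coordinate 0.
    have : ((-1 : R) ^ n) * (-1) ^ n = 1 := by rw [← mul_pow]; simp
    linear_combination (-(-1 : R) ^ (a : ℕ)) * this
  · rw [pow_succ, mul_neg_one, neg_smul, neg_neg]

/-- The boundary of the triangulated cube. -/
theorem bdry_cubeChain {n : ℕ} (g : C(Fin (n + 1) → unitInterval, T)) :
    bdry R (cubeChain R g) = ∑ a : Fin (n + 1), (-1 : R) ^ (a + 1 : ℕ) •
      (cubeChain R (g.comp (cubeFace a 0)) - cubeChain R (g.comp (cubeFace a 1))) := by
  have := sum_sign_faces (R := R) (n := n)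
    (fun f => (single ⟨n, g.comp f⟩ 1 : Simp T →₀ R))
  simpa only [cubeChain, map_sum, map_smul, bdry_single, bdrySimp, ContinuousMap.comp_assoc]
    using this

/-- Every singular simplex is the image of the identity simplex, which is the realization of the
list of vertices; the claim is inherited from lists. -/
theorem bdry_bdry (c : Simp T →₀ R) : bdry R (bdry R c) = 0 := by
  have : bdry R ∘ₗ bdry R (T := T) = 0 := by
    refine Finsupp.lhom_ext_single fun s => ?_
    have hsingle : (single s 1 : Simp T →₀ R) =
        map R s.2 (real R scomb (single (vertices s.1) 1)) := by
      rw [real_vertices, map_single]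
      rfl
    rw [LinearMap.comp_apply, hsingle, bdry_map, bdry_map, bdry_real R (comb_face _),
      bdry_real R (comb_face _), ListChain.bdry_single, ListChain.bdry_bdryList, map_zero, map_zero]
    rfl
  exact LinearMap.congr_fun this c

theorem eq_zero_of_mem_chainsIn_empty {c : Simp T →₀ R} (h : c ∈ chainsIn R (∅ : Set T)) :
    c = 0 := by
  have : {s : Simp T | ∀ t, s.2 t ∈ (∅ : Set T)} = ∅ :=
    Set.eq_empty_of_forall_notMem fun s hs => hs (stdSimplex.vertex 0)
  rw [chainsIn, this, supported_empty] at h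
  exact h

end SingularChain

namespace SingularChain

open Finsupp

variable {R : Type v} [CommRing R] {T J : Type*} [TopologicalSpace T] [TopologicalSpace J]

/-! #### Stretching the unit interval -/

/-- The homotopy `t ↦ t + τ (2 t - 1)`, cut off at `0` and `1`, which stretches the middle third of
the unit interval to the whole interval. -/
noncomputable def stretch (t τ : unitInterval) : unitInterval :=
  Set.projIcc 0 1 zero_le_one ((t : ℝ) + τ * (2 * t - 1))

theorem continuous_stretch : Continuous fun p : unitInterval × unitInterval => stretch p.1 p.2 := by
  refine continuous_projIcc.comp ?_
  fun_prop

@[simp] theorem stretch_zero_right (t : unitInterval) : stretch t 0 = t := by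
  simp [stretch]

@[simp] theorem stretch_zero_left (τ : unitInterval) : stretch 0 τ = 0 := by
  refine Set.projIcc_of_le_left _ ?_
  have := τ.2.1
  simp [this]

@[simp] theorem stretch_one_left (τ : unitInterval) : stretch 1 τ = 1 := by
  refine Set.projIcc_of_right_le _ ?_
  have := τ.2.1
  simp only [Set.Icc.coe_one]
  linarith

theorem stretch_one_eq_zero {t : unitInterval} (h : (t : ℝ) ≤ 1 / 3) : stretch t 1 = 0 := by
  refine Set.projIcc_of_le_left _ ?_
  simp only [Set.Icc.coe_one]
  linarith

theorem stretch_one_eq_one {t : unitInterval} (h : 2 / 3 ≤ (t : ℝ)) : stretch t 1 = 1 := by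
  refine Set.projIcc_of_right_le _ ?_
  simp only [Set.Icc.coe_one]
  linarith

/-- Coordinatewise stretching of cubes. -/
noncomputable def stretchCube (J : Type*) [TopologicalSpace J] (n : ℕ) :
    C((J × (Fin n → unitInterval)) × unitInterval, J × (Fin n → unitInterval)) where
  toFun x := (x.1.1, fun i => stretch (x.1.2 i) x.2)
  continuous_toFun := by
    refine (continuous_fst.comp continuous_fst).prodMk (continuous_pi fun i => ?_)
    exact continuous_stretch.comp (f := fun x : (J × (Fin n → unitInterval)) × unitInterval =>
      (x.1.2 i, x.2)) (((continuous_apply i).comp (continuous_snd.comp continuous_fst)).prodMk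
        continuous_snd)

/-- The contraction of cubes to the vertex `0`, first along the coordinate `0` and then along the
other coordinates. -/
noncomputable def contractCube (J : Type*) [TopologicalSpace J] (n : ℕ) :
    C((J × (Fin n → unitInterval)) × unitInterval, J × (Fin n → unitInterval)) where
  toFun x := (x.1.1, fun i =>
    Set.projIcc 0 1 zero_le_one ((if (i : ℕ) = 0 then 1 else 2) - 2 * (x.2 : ℝ)) * x.1.2 i)
  continuous_toFun := by
    refine (continuous_fst.comp continuous_fst).prodMk (continuous_pi fun i => ?_)
    refine (continuous_projIcc.comp ?_).mul
      ((continuous_apply i).comp (continuous_snd.comp continuous_fst))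
    exact continuous_const.sub
      (continuous_const.mul (continuous_subtype_val.comp continuous_snd))

theorem contractCube_zero {n : ℕ} (x : J × (Fin n → unitInterval)) :
    contractCube J n (x, 0) = x := by
  refine Prod.ext rfl (funext fun i => ?_)
  have : Set.projIcc (0 : ℝ) 1 zero_le_one
      ((if (i : ℕ) = 0 then 1 else 2) - 2 * ((0 : unitInterval) : ℝ)) = 1 := by
    refine Set.projIcc_of_right_le _ ?_
    split_ifs <;> norm_num
  change Set.projIcc (0 : ℝ) 1 zero_le_one _ * x.2 i = x.2 i
  rw [this, one_mul]

theorem contractCube_one {n : ℕ} (x : J × (Fin n → unitInterval)) :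
    contractCube J n (x, 1) = (x.1, 0) := by
  refine Prod.ext rfl (funext fun i => ?_)
  have : Set.projIcc (0 : ℝ) 1 zero_le_one
      ((if (i : ℕ) = 0 then 1 else 2) - 2 * ((1 : unitInterval) : ℝ)) = 0 := by
    refine Set.projIcc_of_le_left _ ?_
    split_ifs <;> norm_num
  change Set.projIcc (0 : ℝ) 1 zero_le_one _ * x.2 i = 0
  rw [this, zero_mul]

/-! #### The homology of cubes relative to their boundary -/

/-- The boundary of a family of cubes. -/
def cubeBoundary (J : Type*) (n : ℕ) : Set (J × (Fin n → unitInterval)) :=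
  {x | ∃ i, x.2 i = 0 ∨ x.2 i = 1}

/-- The boundary of a family of cubes without the open facet on which the first coordinate is
`1`. -/
def cubeBox (J : Type*) (n : ℕ) : Set (J × (Fin (n + 1) → unitInterval)) :=
  {x | x.2 0 = 0 ∨ ∃ i : Fin n, x.2 i.succ = 0 ∨ x.2 i.succ = 1}

theorem cubeBox_subset (J : Type*) (n : ℕ) : cubeBox J n ⊆ cubeBoundary J (n + 1) := by
  rintro x (h | ⟨i, h⟩)
  · exact ⟨0, Or.inl h⟩
  · exact ⟨i.succ, h⟩

/-- A member of a family of cubes. -/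
def cubeAt (J : Type*) [TopologicalSpace J] (n : ℕ) (j : J) :
    C(Fin n → unitInterval, J × (Fin n → unitInterval)) :=
  (ContinuousMap.const _ j).prodMk (ContinuousMap.id _)

variable (R J) in
/-- The linear combinations of triangulated cubes in a family of cubes. -/
noncomputable def cubeChains (n : ℕ) : (J →₀ R) →ₗ[R] (Simp (J × (Fin n → unitInterval)) →₀ R) :=
  linearCombination R fun j => cubeChain R (cubeAt J n j)

@[simp] theorem cubeChains_single (n : ℕ) (j : J) :
    cubeChains R J n (single j 1) = cubeChain R (cubeAt J n j) := by
  simp [cubeChains]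

theorem bdry_cubeChains_mem (n : ℕ) (c : J →₀ R) :
    bdry R (cubeChains R J n c) ∈ chainsIn R (cubeBoundary J n) := by
  rw [← LinearMap.comp_apply]
  refine Finsupp.map_supported_mem (s := Set.univ) (fun j _ => ?_) (by simp)
  rw [LinearMap.comp_apply, cubeChains_single]
  cases n with
  | zero =>
    simp [cubeChain, bdrySimp]
  | succ n =>
    rw [bdry_cubeChain]
    refine Submodule.sum_mem _ fun a _ => Submodule.smul_mem _ _ (Submodule.sub_mem _ ?_ ?_)
    · exact cubeChain_mem fun t => ⟨a, Or.inl (cubeFace_apply_same a 0 t)⟩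
    · exact cubeChain_mem fun t => ⟨a, Or.inr (cubeFace_apply_same a 1 t)⟩

/-- The inclusion of the facets on which the first coordinate is `1`. -/
def topFacet (J : Type*) [TopologicalSpace J] (n : ℕ) :
    C(J × (Fin n → unitInterval), J × (Fin (n + 1) → unitInterval)) :=
  (ContinuousMap.id J).prodMap (cubeFace 0 1)

theorem topFacet_snd_zero {n : ℕ} (x : J × (Fin n → unitInterval)) :
    (topFacet J n x).2 0 = 1 :=
  cubeFace_apply_same 0 1 x.2

theorem topFacet_snd_succ {n : ℕ} (x : J × (Fin n → unitInterval)) (i : Fin n) :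
    (topFacet J n x).2 i.succ = x.2 i := by
  have := cubeFace_apply_succAbove 0 1 x.2 i
  rwa [Fin.zero_succAbove] at this

theorem topFacet_preimage (n : ℕ) : topFacet J n ⁻¹' cubeBox J n = cubeBoundary J n := by
  ext x
  simp only [cubeBox, Set.mem_preimage, Set.mem_ofPred_eq, topFacet_snd_zero, topFacet_snd_succ,
    one_ne_zero, false_or]
  rfl

/-- The facet with first coordinate 1 is the only one outside the box, and its sign is `-(-1)^1 =
1`. -/
theorem bdry_cubeChains_sub_mem (n : ℕ) (c : J →₀ R) :
    bdry R (cubeChains R J (n + 1) c) - map R (topFacet J n) (cubeChains R J n c) ∈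
      chainsIn R (cubeBox J n) := by
  have : bdry R (cubeChains R J (n + 1) c) - map R (topFacet J n) (cubeChains R J n c) =
      (bdry R ∘ₗ cubeChains R J (n + 1) - map R (topFacet J n) ∘ₗ cubeChains R J n) c := rfl
  rw [this]
  refine Finsupp.map_supported_mem (s := Set.univ) (fun j _ => ?_) (by simp)
  have h1 : (cubeAt J (n + 1) j).comp (cubeFace 0 1) = (topFacet J n).comp (cubeAt J n j) := rfl
  have h2 : ∀ x y z : Simp (J × (Fin (n + 1) → unitInterval)) →₀ R,
      -(x - y) + z - y = z - x := fun x y z => by abel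
  simp only [LinearMap.sub_apply, LinearMap.comp_apply, cubeChains_single, bdry_cubeChain,
    map_cubeChain]
  rw [Fin.sum_univ_succ, ← h1]
  simp only [Fin.val_zero, zero_add, pow_one, neg_smul, one_smul]
  rw [h2]
  refine Submodule.sub_mem _ (Submodule.sum_mem _ fun a _ => Submodule.smul_mem _ _
    (Submodule.sub_mem _ ?_ ?_)) ?_
  · exact cubeChain_mem fun t => Or.inr ⟨a, Or.inl (cubeFace_apply_same a.succ 0 t)⟩
  · exact cubeChain_mem fun t => Or.inr ⟨a, Or.inr (cubeFace_apply_same a.succ 1 t)⟩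
  · exact cubeChain_mem fun t => Or.inl (cubeFace_apply_same 0 0 t)

theorem acyclic_cube [DiscreteTopology J] {n : ℕ} {A : Set (J × (Fin n → unitInterval))}
    (hA : ∀ t ∈ A, ∀ τ, contractCube J n (t, τ) ∈ A) (h0 : ∀ j : J, (j, 0) ∈ A)
    {z : Simp (J × (Fin n → unitInterval)) →₀ R} (hz : z ∈ chainsIn R A) {c : J →₀ R}
    (h : bdry R z = points R (fun j => (j, 0)) c) :
    c = 0 ∧ ∃ c', ∃ u ∈ chainsIn R A, z - points R (fun j => (j, 0)) c' = bdry R u :=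
  acyclic_of_contraction ((ContinuousMap.id J).prodMk (ContinuousMap.const _ 0))
    ContinuousMap.fst contractCube_zero contractCube_one hA h0 (fun _ => rfl) hz h

/-- This is why the contraction has two stages: while coordinate 0 shrinks the other coordinates
rest, so side facets are preserved; afterwards coordinate 0 vanishes and the point stays on the
bottom facet. -/
theorem contractCube_mem_cubeBox {n : ℕ} {x : J × (Fin (n + 1) → unitInterval)}
    (hx : x ∈ cubeBox J n) (τ : unitInterval) : contractCube J (n + 1) (x, τ) ∈ cubeBox J n := by
  have hx' : x.2 0 = 0 ∨ ∃ i : Fin n, x.2 i.succ = 0 ∨ x.2 i.succ = 1 := hx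
  rcases le_total (τ : ℝ) (1 / 2) with hτ | hτ
  · rcases hx' with h | ⟨i, h⟩
    · exact Or.inl (by simp [contractCube, h])
    · refine Or.inr ⟨i, ?_⟩
      have h1 : Set.projIcc (0 : ℝ) 1 zero_le_one (2 - 2 * (τ : ℝ)) = 1 :=
        Set.projIcc_of_right_le _ (by linarith)
      simpa [contractCube, h1] using h
  · refine Or.inl ?_
    have h1 : Set.projIcc (0 : ℝ) 1 zero_le_one (1 - 2 * (τ : ℝ)) = 0 :=
      Set.projIcc_of_le_left _ (by linarith)
    simp [contractCube, h1]

/-- Excision for the boundary of a family of cubes and its top facets. -/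
theorem excision_topFacet {n : ℕ} {z : Simp (J × (Fin (n + 1) → unitInterval)) →₀ R}
    {b : Simp (J × (Fin n → unitInterval)) →₀ R} (hz : z ∈ chainsIn R (cubeBoundary J (n + 1)))
    (hb : bdry R b ∈ chainsIn R (cubeBoundary J n))
    (hzb : bdry R z - map R (topFacet J n) b ∈ chainsIn R (cubeBox J n)) :
    ∃ w, b - bdry R w ∈ chainsIn R (cubeBoundary J n) ∧
      ∃ u ∈ chainsIn R (cubeBoundary J (n + 1)),
        z - map R (topFacet J n) w - bdry R u ∈ chainsIn R (cubeBox J n) := by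
  have hcoord : ∀ i : Fin (n + 1), Continuous fun x : J × (Fin (n + 1) → unitInterval) =>
      (x.2 i : ℝ) := fun i =>
    continuous_subtype_val.comp ((continuous_apply i).comp continuous_snd)
  -- Within the boundary, `U` is a neighbourhood of the box that stretching carries into the box,
  -- and `V` is the interior of the top facet, where forgetting coordinate 0 inverts `topFacet`.
  let U : Set (J × (Fin (n + 1) → unitInterval)) := {x | (x.2 0 : ℝ) < 1} ∪
    ⋃ i : Fin n, ({x | (x.2 i.succ : ℝ) < 1 / 3} ∪ {x | 2 / 3 < (x.2 i.succ : ℝ)})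
  let V : Set (J × (Fin (n + 1) → unitInterval)) := {x | 0 < (x.2 0 : ℝ)} ∩
    ⋂ i : Fin n, ({x | 0 < (x.2 i.succ : ℝ)} ∩ {x | (x.2 i.succ : ℝ) < 1})
  have hU : IsOpen U := (isOpen_lt (hcoord 0) continuous_const).union (isOpen_iUnion fun i =>
    (isOpen_lt (hcoord i.succ) continuous_const).union (isOpen_lt continuous_const (hcoord i.succ)))
  have hV : IsOpen V := (isOpen_lt continuous_const (hcoord 0)).inter (isOpen_iInter_of_finite
    fun i => (isOpen_lt continuous_const (hcoord i.succ)).inter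
      (isOpen_lt (hcoord i.succ) continuous_const))
  have hstretch : ∀ (t τ : unitInterval), (t = 0 ∨ t = 1) → stretch t τ = 0 ∨ stretch t τ = 1 := by
    rintro t τ (rfl | rfl) <;> simp
  have hVW : ∀ x ∈ V ∩ cubeBoundary J (n + 1), x.2 0 = 1 := by
    rintro x ⟨⟨h0, h1⟩, i, hi⟩
    have h0' : (0 : ℝ) < x.2 0 := h0
    have h1' : ∀ i : Fin n, (0 : ℝ) < x.2 i.succ ∧ (x.2 i.succ : ℝ) < 1 :=
      fun i => Set.mem_iInter.mp h1 i
    induction i using Fin.cases with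
    | zero =>
      rcases hi with hi | hi
      · rw [hi] at h0'
        simp at h0'
      · exact hi
    | succ i =>
      have := h1' i
      rcases hi with hi | hi <;> rw [hi] at this <;> simp at this
  rw [← topFacet_preimage] at hb ⊢
  refine excision (U := U) (V := V) (F := stretchCube J (n + 1)) (F' := stretchCube J n)
    (j := fun x => (x.1, Fin.tail x.2)) hU hV ?_ (fun t => by simp [stretchCube])
    (fun t => by simp [stretchCube]) ?_ ?_ ?_ ?_ ?_ ?_ ?_ ?_ hz hb hzb
  · intro x _
    by_contra hx
    simp only [Set.mem_union, not_or] at hx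
    obtain ⟨hxU, hxV⟩ := hx
    refine hxV ?_
    have h0 : ¬ (x.2 0 : ℝ) < 1 := fun h => hxU (Or.inl h)
    refine ⟨show (0 : ℝ) < x.2 0 by linarith, Set.mem_iInter.mpr fun i => ?_⟩
    have h1 : ¬ ((x.2 i.succ : ℝ) < 1 / 3) := fun h =>
      hxU (Or.inr (Set.mem_iUnion.mpr ⟨i, Or.inl h⟩))
    have h2 : ¬ (2 / 3 < (x.2 i.succ : ℝ)) := fun h =>
      hxU (Or.inr (Set.mem_iUnion.mpr ⟨i, Or.inr h⟩))
    exact ⟨show (0 : ℝ) < x.2 i.succ by linarith, show (x.2 i.succ : ℝ) < 1 by linarith⟩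
  · rintro x ⟨i, hi⟩ τ
    exact ⟨i, hstretch _ _ hi⟩
  · rintro x (h | ⟨i, hi⟩) τ
    · exact Or.inl (by simp [stretchCube, h])
    · exact Or.inr ⟨i, hstretch _ _ hi⟩
  · intro d τ
    refine Prod.ext rfl (funext fun i => ?_)
    induction i using Fin.cases with
    | zero =>
      rw [topFacet_snd_zero]
      change _ = stretch ((topFacet J n d).2 0) τ
      rw [topFacet_snd_zero, stretch_one_left]
    | succ i =>
      rw [topFacet_snd_succ]
      change _ = stretch ((topFacet J n d).2 i.succ) τ
      rw [topFacet_snd_succ]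
      rfl
  · exact fun d => ⟨0, Or.inr (topFacet_snd_zero d)⟩
  · rintro x ⟨hxU, i, hi⟩
    by_cases hx : x ∈ cubeBox J n
    · rcases hx with h | ⟨i, hi⟩
      · exact Or.inl (by simp [stretchCube, h])
      · exact Or.inr ⟨i, hstretch _ _ hi⟩
    -- A boundary point outside the box lies on the top facet, so it belongs to `U` because of a
    -- side coordinate outside the middle third, which stretching sends to an endpoint.
    have h0 : x.2 0 = 1 := by
      induction i using Fin.cases with
      | zero => exact hi.resolve_left fun h => hx (Or.inl h)
      | succ i => exact absurd (Or.inr ⟨i, hi⟩) hx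
    rcases hxU with h | h
    · have h : (x.2 0 : ℝ) < 1 := h
      rw [h0] at h
      simp at h
    · obtain ⟨i, h | h⟩ := Set.mem_iUnion.mp h
      · exact Or.inr ⟨i, Or.inl (stretch_one_eq_zero (le_of_lt h))⟩
      · exact Or.inr ⟨i, Or.inr (stretch_one_eq_one (le_of_lt h))⟩
  · refine Continuous.continuousOn ?_
    exact continuous_fst.prodMk (continuous_pi fun i => (continuous_apply i.succ).comp continuous_snd)
  · intro x hx
    have h0 := hVW x hx
    refine Prod.ext rfl (funext fun i => ?_)
    induction i using Fin.cases with
    | zero => rw [topFacet_snd_zero, h0]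
    | succ i => exact topFacet_snd_succ _ i
  · intro d _
    exact Prod.ext rfl (funext fun i => topFacet_snd_succ d i)

theorem cubeChains_zero (c : J →₀ R) :
    cubeChains R J 0 c = points R (fun j => (j, 0)) c := by
  have : cubeChains R J 0 = points R (fun j => (j, 0)) := by
    refine Finsupp.lhom_ext_single fun j => ?_
    rw [cubeChains_single, points_single, cubeChain]
    have h : ∀ σ : Equiv.Perm (Fin 0), σ = 1 := fun σ => Subsingleton.elim _ _
    have h2 : (cubeAt J 0 j).comp (cubeSimplex 1) = ContinuousMap.const _ (j, 0) :=
      ContinuousMap.ext fun t => Prod.ext rfl (Subsingleton.elim _ _)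
    simp [h2]
  exact LinearMap.congr_fun this c

/-- The homology of a family of cubes relative to the boundary is free on the triangulated cubes. -/
theorem cube_homology [DiscreteTopology J] (n : ℕ) {z : Simp (J × (Fin n → unitInterval)) →₀ R}
    {c : J →₀ R} (h : bdry R z - cubeChains R J n c ∈ chainsIn R (cubeBoundary J n)) :
    c = 0 ∧ ∃ c' u, z - cubeChains R J n c' - bdry R u ∈ chainsIn R (cubeBoundary J n) := by
  induction n generalizing c with
  | zero =>
    have hempty : cubeBoundary J 0 = ∅ :=
      Set.eq_empty_of_forall_notMem fun x ⟨i, _⟩ => i.elim0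
    rw [hempty] at h ⊢
    have h1 := eq_zero_of_mem_chainsIn_empty h
    rw [cubeChains_zero] at h1
    obtain ⟨hc, c', u, -, hu⟩ := acyclic_cube (A := Set.univ) (fun _ _ _ => trivial)
      (fun _ => trivial) (chainsIn_univ R z) (sub_eq_zero.mp h1)
    refine ⟨hc, c', u, ?_⟩
    rw [cubeChains_zero, hu, sub_self]
    exact Submodule.zero_mem _
  | succ n ih =>
    set p := topFacet J n
    have htop := fun c => bdry_cubeChains_sub_mem (R := R) (J := J) n c
    have hbb := bdry_bdry (R := R) z
    -- Excision is applied to `∂z` minus the cubes of `c`. Since `∂∂z = 0`, its boundary is that of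
    -- the cubes with a minus sign, namely minus the top facets modulo the box.
    obtain ⟨w, hw, u, hu, hzu⟩ := excision_topFacet (b := -cubeChains R J n c) h
      (by rw [map_neg]; exact Submodule.neg_mem _ (bdry_cubeChains_mem n c))
      (by
        rw [map_sub, hbb, zero_sub, map_neg, sub_neg_eq_add, neg_add_eq_sub, ← neg_sub]
        exact Submodule.neg_mem _ (htop c))
    obtain ⟨hc, c', u', hu'⟩ := ih (z := w) (c := -c) (by
      rw [map_neg, ← neg_sub]
      exact Submodule.neg_mem _ hw)
    have hc0 : c = 0 := neg_eq_zero.mp hc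
    refine ⟨hc0, ?_⟩
    rw [hc0, map_zero, sub_zero] at hzu
    have hpB : ∀ {e : Simp (J × (Fin n → unitInterval)) →₀ R},
        e ∈ chainsIn R (cubeBoundary J n) → map R p e ∈ chainsIn R (cubeBox J n) := by
      intro e he
      rw [← topFacet_preimage] at he
      exact map_mem R (fun t ht => ht) he
    have hpW : ∀ e : Simp (J × (Fin n → unitInterval)) →₀ R,
        map R p e ∈ chainsIn R (cubeBoundary J (n + 1)) := fun e =>
      map_mem R (A := Set.univ) (fun t _ => (⟨0, Or.inr (topFacet_snd_zero t)⟩ :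
        p t ∈ cubeBoundary J (n + 1))) (chainsIn_univ R e)
    -- Corrected by cubes and by chains in the boundary so that `∂y` lies in the box.
    -- Contractibility of the box makes `∂y` bound there up to points, and contractibility of the
    -- cube then disposes of `y`.
    set y := z - cubeChains R J (n + 1) c' - u - map R p u' with hy
    have hyA : bdry R y ∈ chainsIn R (cubeBox J n) := by
      have e1 := hpB hu'
      have e2 := htop c'
      have : bdry R y = (bdry R z - map R p w - bdry R u) +
          map R p (w - cubeChains R J n c' - bdry R u') -
          (bdry R (cubeChains R J (n + 1) c') - map R p (cubeChains R J n c')) := by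
        simp only [hy, map_sub, bdry_map]
        abel
      rw [this]
      exact Submodule.sub_mem _ (Submodule.add_mem _ hzu e1) e2
    obtain ⟨-, c₁, a, ha, hac⟩ := acyclic_cube (c := 0) (fun x hx τ => contractCube_mem_cubeBox hx τ)
      (fun j => Or.inl rfl) hyA (by rw [bdry_bdry, map_zero])
    obtain ⟨-, c₂, u₂, -, hu₂⟩ := acyclic_cube (A := Set.univ) (fun _ _ _ => trivial)
      (fun _ => trivial) (chainsIn_univ R (y - a)) (c := c₁) (by
        rw [map_sub, ← hac]
        abel)
    refine ⟨c', u₂, ?_⟩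
    have h0 : ∀ j : J, (j, 0) ∈ cubeBoundary J (n + 1) := fun j => ⟨0, Or.inl rfl⟩
    have : z - cubeChains R J (n + 1) c' - bdry R u₂ =
        u + map R p u' + a + points R (fun j => (j, 0)) c₂ := by
      rw [← hu₂, hy]
      abel
    rw [this]
    exact Submodule.add_mem _ (Submodule.add_mem _ (Submodule.add_mem _ hu (hpW u'))
      (chainsIn_mono R (cubeBox_subset J n) ha)) (points_mem h0 c₂)

end SingularChain

/-! ### The realization of a `□`-set -/

namespace BoxSet

open SingularChain

variable {X : BoxSet.{u}}

/-- The endpoint of the unit interval indexed by a Boolean. -/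
def endpoint (ε : Bool) : unitInterval := if ε then 1 else 0

@[simp] theorem endpoint_false : endpoint false = 0 := rfl

@[simp] theorem endpoint_true : endpoint true = 1 := rfl

theorem endpoint_injective : Function.Injective endpoint := by
  rintro (_ | _) (_ | _) <;> simp

theorem eq_endpoint_iff {t : unitInterval} : (∃ ε, t = endpoint ε) ↔ t = 0 ∨ t = 1 := by
  simp

theorem mk_eq_mk_face {n : ℕ} (x : X.cells (n + 1)) {t : Fin (n + 1) → unitInterval} {ε : Bool}
    {i : Fin (n + 1)} (h : t i = endpoint ε) :
    Quot.mk X.Glue ⟨⟨n + 1, x⟩, t⟩ = Quot.mk X.Glue ⟨⟨n, X.face ε i x⟩, i.removeNth t⟩ := by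
  have := Quot.sound (Glue.glue (X := X) ε i x (i.removeNth t))
  rw [this]
  congr 2
  exact ((congrArg (fun a => Fin.insertNth (α := fun _ => unitInterval) i a (i.removeNth t))
    h.symm).trans (Fin.insertNth_self_removeNth i t)).symm

/-! #### Normal forms -/

open Classical in
/-- The normal form of a point `t` of a cube `x`: the cube of smallest dimension which contains the
point, with the position of the point in its interior. -/
noncomputable def normalFormAux : ∀ {n : ℕ}, X.cells n → (Fin n → unitInterval) →
    Σ k : ℕ, X.cells k × (Fin k → unitInterval)
  | 0, x, t => ⟨0, x, t⟩
  | n + 1, x, t =>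
    if h : ∃ p : Bool × Fin (n + 1), t p.2 = endpoint p.1 then
      normalFormAux (X.face h.choose.1 h.choose.2 x) (h.choose.2.removeNth t)
    else ⟨n + 1, x, t⟩

theorem succAbove_succAbove_of_le {n : ℕ} {i j : Fin (n + 1)} (h : i ≤ j) (k : Fin n) :
    i.castSucc.succAbove (j.succAbove k) = j.succ.succAbove (i.succAbove k) := by
  have h' : (i : ℕ) ≤ j := h
  simp only [Fin.succAbove, Fin.lt_def]
  split_ifs <;> simp_all [Fin.ext_iff] <;> omega

/-- A confluence argument: two boundary coordinates can be removed in either order with the same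
result by `face_face`, so by induction the coordinate chosen in the definition does not matter. -/
theorem normalFormAux_face {n : ℕ} (x : X.cells (n + 1)) {t : Fin (n + 1) → unitInterval}
    {ε : Bool} {i : Fin (n + 1)} (h : t i = endpoint ε) :
    normalFormAux x t = normalFormAux (X.face ε i x) (i.removeNth t) := by
  induction n generalizing ε with
  | zero =>
    have hex : ∃ p : Bool × Fin 1, t p.2 = endpoint p.1 := ⟨(ε, i), h⟩
    have hi : hex.choose.2 = i := Subsingleton.elim _ _
    have hε : hex.choose.1 = ε := endpoint_injective (by rw [← hex.choose_spec, hi, h])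
    conv_lhs => rw [normalFormAux]
    rw [dif_pos hex, hi, hε]
  | succ n ih =>
    have key : ∀ {η θ : Bool} {a b : Fin (n + 2)}, a < b → t a = endpoint η → t b = endpoint θ →
        normalFormAux (X.face η a x) (a.removeNth t) =
          normalFormAux (X.face θ b x) (b.removeNth t) := by
      intro η θ a b hab ha hb
      obtain ⟨i, rfl⟩ : ∃ i : Fin (n + 1), a = i.castSucc :=
        ⟨a.castLT (by have := b.isLt; have : (a : ℕ) < b := hab; omega), rfl⟩
      obtain ⟨j, rfl⟩ : ∃ j : Fin (n + 1), b = j.succ :=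
        ⟨b.pred (Fin.ne_zero_of_lt hab), (Fin.succ_pred _ _).symm⟩
      have hij : i ≤ j := Fin.le_def.mpr (by
        have := Fin.lt_def.mp hab
        simp only [Fin.val_castSucc, Fin.val_succ] at this
        omega)
      have h1 : i.castSucc.succAbove j = j.succ :=
        Fin.succAbove_of_le_castSucc _ _ (Fin.castSucc_le_castSucc_iff.mpr hij)
      have h2 : j.succ.succAbove i = i.castSucc :=
        Fin.succAbove_of_castSucc_lt _ _ (by
          rw [Fin.lt_def]
          have : (i : ℕ) ≤ j := hij
          simp only [Fin.val_castSucc, Fin.val_succ]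
          omega)
      rw [ih (X.face η i.castSucc x) (i := j) (ε := θ) (by rw [Fin.removeNth, h1, hb]),
        ih (X.face θ j.succ x) (i := i) (ε := η) (by rw [Fin.removeNth, h2, ha]),
        X.face_face η θ i j hij x]
      congr 1
      funext k
      simp only [Fin.removeNth, succAbove_succAbove_of_le hij]
    have hex : ∃ p : Bool × Fin (n + 2), t p.2 = endpoint p.1 := ⟨(ε, i), h⟩
    rw [normalFormAux, dif_pos hex]
    rcases lt_trichotomy hex.choose.2 i with hlt | heq | hlt
    · exact key hlt hex.choose_spec h
    · have hε : hex.choose.1 = ε := endpoint_injective (by rw [← hex.choose_spec, heq, h])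
      rw [heq, hε]
    · exact (key hlt h hex.choose_spec).symm

theorem normalFormAux_of_interior {n : ℕ} (x : X.cells n) {t : Fin n → unitInterval}
    (h : ∀ i, t i ≠ 0 ∧ t i ≠ 1) : normalFormAux x t = ⟨n, x, t⟩ := by
  cases n with
  | zero => rfl
  | succ n =>
    rw [normalFormAux, dif_neg]
    rintro ⟨⟨ε, i⟩, hi⟩
    have := eq_endpoint_iff.mp ⟨ε, hi⟩
    have := h i
    tauto

/-- A point of a cube, and all points with the same boundary coordinates, can be found in a
face. -/
theorem exists_mk_eq {n : ℕ} (x : X.cells n) (t : Fin n → unitInterval) :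
    ∃ (k : ℕ) (y : X.cells k) (e : Fin k → Fin n), (∀ i, t (e i) ≠ 0 ∧ t (e i) ≠ 1) ∧
      ∀ s : Fin n → unitInterval, (∀ i, t i = 0 ∨ t i = 1 → s i = t i) →
        Quot.mk X.Glue ⟨⟨n, x⟩, s⟩ = Quot.mk X.Glue ⟨⟨k, y⟩, s ∘ e⟩ := by
  induction n with
  | zero => exact ⟨0, x, id, fun i => i.elim0, fun s _ => rfl⟩
  | succ n ih =>
    by_cases h : ∃ i, t i = 0 ∨ t i = 1
    · obtain ⟨i, hi⟩ := h
      obtain ⟨ε, hε⟩ := eq_endpoint_iff.mpr hi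
      obtain ⟨k, y, e, he, hs⟩ := ih (X.face ε i x) (i.removeNth t)
      refine ⟨k, y, fun j => i.succAbove (e j), he, fun s h => ?_⟩
      rw [mk_eq_mk_face x (ε := ε) (i := i) (by rw [h i hi, hε]),
        hs (i.removeNth s) fun j hj => h _ hj]
      rfl
    · push Not at h
      exact ⟨n + 1, x, id, h, fun s _ => rfl⟩

variable (X) in
/-- The normal form of a point of the realization. -/
noncomputable def normalForm : X.Realization → Σ k : ℕ, X.cells k × (Fin k → unitInterval) :=
  Quot.lift (fun p => normalFormAux p.1.2 p.2) (by
    rintro _ _ ⟨ε, i, x, t⟩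
    have h : Fin.insertNth (α := fun _ => unitInterval) i (if ε then 1 else 0) t i =
        endpoint ε := Fin.insertNth_apply_same _ _ _
    rw [normalFormAux_face x h, Fin.removeNth_insertNth])

theorem normalForm_mk_of_interior {n : ℕ} (x : X.cells n) {t : Fin n → unitInterval}
    (h : ∀ i, t i ≠ 0 ∧ t i ≠ 1) : X.normalForm (X.charMap x t) = ⟨n, x, t⟩ :=
  normalFormAux_of_interior x h

theorem exists_eq_charMap (p : X.Realization) :
    ∃ (k : ℕ) (y : X.cells k) (s : Fin k → unitInterval), (∀ i, s i ≠ 0 ∧ s i ≠ 1) ∧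
      p = X.charMap y s := by
  obtain ⟨⟨⟨n, x⟩, t⟩, rfl⟩ := Quot.exists_rep p
  obtain ⟨k, y, e, he, hs⟩ := exists_mk_eq x t
  exact ⟨k, y, t ∘ e, he, hs t fun _ _ => rfl⟩

/-! #### Counting coordinates -/

open Classical in
/-- The number of coordinates in a set. -/
noncomputable def countIn (P : Set unitInterval) {n : ℕ} (t : Fin n → unitInterval) : ℕ :=
  (Finset.univ.filter fun i => t i ∈ P).card

theorem countIn_removeNth {P : Set unitInterval} {n : ℕ} (t : Fin (n + 1) → unitInterval)
    {i : Fin (n + 1)} (h : t i ∉ P) : countIn P (i.removeNth t) = countIn P t := by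
  classical
  unfold countIn
  rw [Fin.univ_succAbove n i, Finset.filter_cons_of_neg (p := fun k => t k ∈ P) _ _ _ h, Finset.filter_map,
    Finset.card_map]
  rfl

theorem countIn_mono {P Q : Set unitInterval} {n : ℕ} {s t : Fin n → unitInterval}
    (h : ∀ i, s i ∈ P → t i ∈ Q) : countIn P s ≤ countIn Q t := by
  classical
  exact Finset.card_le_card fun i hi => by
    simp only [Finset.mem_filter, Finset.mem_univ, true_and] at hi ⊢
    exact h i hi

theorem le_countIn_iff {P : Set unitInterval} {n m : ℕ} {t : Fin n → unitInterval} :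
    m ≤ countIn P t ↔ ∃ s : Finset (Fin n), m ≤ s.card ∧ ∀ i ∈ s, t i ∈ P := by
  classical
  constructor
  · exact fun h => ⟨_, h, fun i hi => (Finset.mem_filter.mp hi).2⟩
  · rintro ⟨s, hs, h⟩
    exact hs.trans (Finset.card_le_card fun i hi => by simpa using h i hi)

theorem setOf_le_countIn (P : Set unitInterval) (n m : ℕ) :
    {t : Fin n → unitInterval | m ≤ countIn P t} =
      ⋃ s : {s : Finset (Fin n) // m ≤ s.card}, ⋂ i : Fin n, ⋂ _ : i ∈ s.1,
        (fun t : Fin n → unitInterval => t i) ⁻¹' P := by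
  ext t
  simp [le_countIn_iff]

theorem isOpen_le_countIn {P : Set unitInterval} (hP : IsOpen P) (n m : ℕ) :
    IsOpen {t : Fin n → unitInterval | m ≤ countIn P t} := by
  rw [setOf_le_countIn]
  exact isOpen_iUnion fun s => isOpen_iInter_of_finite fun i => isOpen_iInter_of_finite fun _ =>
    hP.preimage (continuous_apply i)

theorem isClosed_le_countIn {P : Set unitInterval} (hP : IsClosed P) (n m : ℕ) :
    IsClosed {t : Fin n → unitInterval | m ≤ countIn P t} := by
  rw [setOf_le_countIn]
  exact isClosed_iUnion_of_finite fun s => isClosed_iInter fun i => isClosed_iInter fun _ =>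
    hP.preimage (continuous_apply i)

/-- The interior of the unit interval. -/
def openInterval : Set unitInterval := {t | t ≠ 0 ∧ t ≠ 1}

/-- The middle third of the unit interval. -/
def middleThird : Set unitInterval := {t | 1 / 3 ≤ (t : ℝ) ∧ (t : ℝ) ≤ 2 / 3}

theorem isOpen_openInterval : IsOpen openInterval :=
  (isOpen_ne (x := (0 : unitInterval))).inter (isOpen_ne (x := (1 : unitInterval)))

theorem isClosed_middleThird : IsClosed middleThird :=
  (isClosed_le continuous_const continuous_subtype_val).inter
    (isClosed_le continuous_subtype_val continuous_const)

theorem middleThird_subset : middleThird ⊆ openInterval := by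
  rintro t ⟨h1, h2⟩
  constructor
  · rintro rfl
    norm_num at h1
  · rintro rfl
    norm_num at h2

theorem endpoint_notMem_openInterval (ε : Bool) : endpoint ε ∉ openInterval := by
  cases ε <;> simp [openInterval]

variable (X) in
/-- The number of coordinates of a point of the realization in a set which does not contain the
endpoints. -/
noncomputable def count {P : Set unitInterval} (hP : P ⊆ openInterval) : X.Realization → ℕ :=
  Quot.lift (fun p => countIn P p.2) (by
    rintro _ _ ⟨ε, i, x, t⟩
    have h : Fin.insertNth (α := fun _ => unitInterval) i (if ε then 1 else 0) t i =
        endpoint ε := Fin.insertNth_apply_same _ _ _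
    have h' := countIn_removeNth (P := P)
      (Fin.insertNth (α := fun _ => unitInterval) i (if ε then 1 else 0) t) (i := i)
      (by rw [h]; exact fun h => endpoint_notMem_openInterval ε (hP h))
    rw [Fin.removeNth_insertNth] at h'
    exact h')

variable (X) in
/-- The dimension of the open cell that contains a point. -/
noncomputable def rank : X.Realization → ℕ := X.count subset_rfl

@[simp] theorem rank_charMap {n : ℕ} (x : X.cells n) (t : Fin n → unitInterval) :
    X.rank (X.charMap x t) = countIn openInterval t := rfl

theorem countIn_eq_iff {P : Set unitInterval} {n : ℕ} {t : Fin n → unitInterval} :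
    countIn P t = n ↔ ∀ i, t i ∈ P := by
  classical
  have := Finset.card_filter_eq_iff (s := (Finset.univ : Finset (Fin n))) (p := fun i => t i ∈ P)
  simpa [countIn] using this

theorem countIn_le {P : Set unitInterval} {n : ℕ} (t : Fin n → unitInterval) :
    countIn P t ≤ n := by
  classical
  simpa [countIn] using Finset.card_filter_le (Finset.univ : Finset (Fin n)) (fun i => t i ∈ P)

theorem isOpen_realization_iff {S : Set X.Realization} :
    IsOpen S ↔ ∀ (n : ℕ) (x : X.cells n), IsOpen (X.charMap x ⁻¹' S) := by
  constructor
  · exact fun h n x => h.preimage (X.charMap x).continuous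
  · intro h
    refine (isQuotientMap_quot_mk (r := X.Glue)).isOpen_preimage.mp (isOpen_sigma_iff.mpr ?_)
    exact fun p => h p.1 p.2

/-- Rank counts coordinates in an open set and `count` of the middle third counts them in a closed
set. These opposite semicontinuities supply the two open sets of the cover in `skeleton_homology`.
-/
theorem isOpen_le_rank (m : ℕ) : IsOpen {p | m ≤ X.rank p} :=
  isOpen_realization_iff.mpr fun n _ => isOpen_le_countIn isOpen_openInterval n m

theorem isOpen_count_lt (m : ℕ) : IsOpen {p | X.count middleThird_subset p < m} := by
  refine isOpen_realization_iff.mpr fun n _ => ?_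
  have : {t : Fin n → unitInterval | countIn middleThird t < m} =
      {t : Fin n → unitInterval | m ≤ countIn middleThird t}ᶜ := by
    ext t
    simp
  have h : IsOpen {t : Fin n → unitInterval | countIn middleThird t < m} := by
    rw [this]
    exact (isClosed_le_countIn isClosed_middleThird n m).isOpen_compl
  exact h

theorem count_le_rank (p : X.Realization) : X.count middleThird_subset p ≤ X.rank p := by
  obtain ⟨⟨⟨n, x⟩, t⟩, rfl⟩ := Quot.exists_rep p
  exact countIn_mono fun i hi => middleThird_subset hi

/-! #### The open cells -/

instance (n : ℕ) : TopologicalSpace (X.cells n) := ⊥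

instance (n : ℕ) : DiscreteTopology (X.cells n) := ⟨rfl⟩

variable (X) in
/-- All characteristic maps of the cells of a given dimension. -/
def charMaps (n : ℕ) : C(X.cells n × (Fin n → unitInterval), X.Realization) where
  toFun p := X.charMap p.1 p.2
  continuous_toFun := continuous_prod_of_discrete_left.mpr fun x => (X.charMap x).continuous

theorem charMaps_comp_cubeAt {n : ℕ} (x : X.cells n) :
    (X.charMaps n).comp (cubeAt (X.cells n) n x) = X.charMap x := rfl

open Classical in
/-- The inverse of `charMaps` on the union of the open cells of dimension `n`. -/
noncomputable def cellCoord (n : ℕ) [Nonempty (X.cells n)] (p : X.Realization) :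
    X.cells n × (Fin n → unitInterval) :=
  if h : (X.normalForm p).1 = n then h ▸ (X.normalForm p).2 else (Classical.arbitrary _, 0)

theorem cellCoord_charMap {n : ℕ} [Nonempty (X.cells n)] (x : X.cells n)
    {t : Fin n → unitInterval} (h : ∀ i, t i ∈ openInterval) :
    cellCoord n (X.charMap x t) = (x, t) := by
  have h1 := normalForm_mk_of_interior x h
  have key : ∀ (q : Σ k : ℕ, X.cells k × (Fin k → unitInterval)) (hq : q = ⟨n, x, t⟩)
      (h : q.1 = n), h ▸ q.2 = (x, t) := by
    rintro q rfl h
    rfl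
  rw [cellCoord, dif_pos (by rw [h1])]
  exact key _ h1 _

theorem exists_charMap_of_rank_eq {n : ℕ} {p : X.Realization} (h : X.rank p = n) :
    ∃ (y : X.cells n) (s : Fin n → unitInterval), (∀ i, s i ∈ openInterval) ∧
      p = X.charMap y s := by
  obtain ⟨k, y, s, hs, rfl⟩ := exists_eq_charMap p
  rw [rank_charMap, countIn_eq_iff.mpr hs] at h
  subst h
  exact ⟨y, s, hs, rfl⟩

/-- Openness is tested in each cube near each point `t`. If the rank of `t` exceeds `n`, it does so
nearby. If it equals `n`, nearby points of rank `n` have the same boundary coordinates as `t`, hence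
lie in the same face, where the coordinates vary continuously. -/
theorem continuousOn_cellCoord (n : ℕ) [Nonempty (X.cells n)] :
    ContinuousOn (cellCoord (X := X) n) {p | X.rank p = n} := by
  rw [continuousOn_iff']
  intro O hO
  refine ⟨{p | n ≤ X.rank p ∧ (X.rank p = n → cellCoord n p ∈ O)}, ?_, ?_⟩
  swap
  · ext p
    simp only [Set.mem_inter_iff, Set.mem_preimage, Set.mem_ofPred_eq]
    constructor
    · rintro ⟨h1, h2⟩
      exact ⟨⟨h2.ge, fun _ => h1⟩, h2⟩
    · rintro ⟨⟨-, h1⟩, h2⟩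
      exact ⟨h1 h2, h2⟩
  refine isOpen_realization_iff.mpr fun m x => isOpen_iff_mem_nhds.mpr ?_
  rintro t ⟨ht1, ht2⟩
  rcases ht1.lt_or_eq with hlt | heq
  · filter_upwards [((isOpen_le_rank (X := X) (n + 1)).preimage
      (X.charMap x).continuous).mem_nhds hlt] with s hs
    have hs' : n + 1 ≤ X.rank (X.charMap x s) := hs
    exact ⟨by omega, fun h => by omega⟩
  obtain ⟨k, y, e, he, hmk⟩ := exists_mk_eq x t
  have hmk' : ∀ s : Fin m → unitInterval, (∀ i, t i = 0 ∨ t i = 1 → s i = t i) →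
      X.charMap x s = X.charMap y (s ∘ e) := hmk
  have ht := hmk' t fun _ _ => rfl
  obtain rfl : k = n := by
    rw [ht, rank_charMap, countIn_eq_iff.mpr he] at heq
    exact heq.symm
  have hte := ht2 heq.symm
  have hy : cellCoord k (X.charMap y (t ∘ e)) = (y, t ∘ e) := cellCoord_charMap y he
  rw [ht, hy] at hte
  have hcont : Continuous fun s : Fin m → unitInterval => (y, s ∘ e) :=
    continuous_const.prodMk (continuous_pi fun i => continuous_apply (e i))
  have h1 : ∀ᶠ s in nhds t, (y, s ∘ e) ∈ O := hcont.continuousAt.eventually (hO.mem_nhds hte)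
  have h2 : ∀ᶠ s in nhds t, ∀ i, (t i ∈ openInterval → s i ∈ openInterval) ∧
      (t i = 0 → s i ≠ 1) ∧ (t i = 1 → s i ≠ 0) := by
    rw [Filter.eventually_all]
    intro i
    have hi : Filter.Tendsto (fun s : Fin m → unitInterval => s i) (nhds t) (nhds (t i)) :=
      (continuous_apply i).continuousAt
    refine Filter.Eventually.and ?_ (Filter.Eventually.and ?_ ?_)
    · by_cases h : t i ∈ openInterval
      · filter_upwards [hi.eventually (isOpen_openInterval.mem_nhds h)] with s hs _ using hs
      · exact Filter.Eventually.of_forall fun s h' => absurd h' h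
    · by_cases h : t i = 0
      · filter_upwards [hi.eventually (isOpen_ne.mem_nhds (show t i ≠ 1 by simp [h]))]
          with s hs _ using hs
      · exact Filter.Eventually.of_forall fun s h' => absurd h' h
    · by_cases h : t i = 1
      · filter_upwards [hi.eventually (isOpen_ne.mem_nhds (show t i ≠ 0 by simp [h]))]
          with s hs _ using hs
      · exact Filter.Eventually.of_forall fun s h' => absurd h' h
  filter_upwards [h1, h2] with s hs1 hs2
  have hle : k ≤ X.rank (X.charMap x s) := by
    rw [heq]
    exact countIn_mono fun i => (hs2 i).1
  refine ⟨hle, fun hs => ?_⟩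
  -- The interior coordinates of `t` are interior for `s`, and both have equally many, so the two
  -- sets of indices are equal.
  have hst : ∀ i, s i ∈ openInterval → t i ∈ openInterval := by
    classical
    have h3 : (Finset.univ.filter fun i => t i ∈ openInterval) =
        Finset.univ.filter fun i => s i ∈ openInterval := by
      refine Finset.eq_of_subset_of_card_le (fun i hi => ?_) ?_
      · simp only [Finset.mem_filter, Finset.mem_univ, true_and] at hi ⊢
        exact (hs2 i).1 hi
      · have h4 := hs.trans heq
        rw [rank_charMap, rank_charMap, countIn, countIn] at h4
        convert h4.le
    intro i hi
    have h4 : i ∈ Finset.univ.filter fun i => s i ∈ openInterval := by simpa using hi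
    rw [← h3] at h4
    simpa using h4
  have hbd : ∀ i, t i = 0 ∨ t i = 1 → s i = t i := by
    intro i hi
    have hsi : ¬ (s i ≠ 0 ∧ s i ≠ 1) := fun h => by
      have := hst i h
      exact hi.elim this.1 this.2
    rcases hi with hi | hi
    · have := (hs2 i).2.1 hi
      rw [hi]
      tauto
    · have := (hs2 i).2.2 hi
      rw [hi]
      tauto
  have hint : ∀ i, (s ∘ e) i ∈ openInterval := fun i => (hs2 (e i)).1 (he i)
  rw [hmk' s hbd, cellCoord_charMap y hint]
  exact hs1

/-! #### Stretching the cells -/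

variable (X) in
/-- Coordinatewise stretching of the realization. -/
noncomputable def stretchRealization : C(X.Realization × unitInterval, X.Realization) where
  toFun p := Quot.lift (fun q : X.PreRealization =>
    X.charMap q.1.2 fun i => stretch (q.2 i) p.2) (by
      rintro _ _ ⟨ε, i, x, t⟩
      have h : Fin.insertNth (α := fun _ => unitInterval) i (if ε then 1 else 0) t i =
          endpoint ε := Fin.insertNth_apply_same _ _ _
      refine Eq.symm ((mk_eq_mk_face x (ε := ε) (i := i) ?_).trans ?_)
      · refine (congrArg (fun a => stretch a p.2) h).trans ?_
        cases ε <;> simp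
      · change X.charMap _ _ = X.charMap _ _
        congr 1
        funext k
        simp [Fin.removeNth]) p.1
  continuous_toFun := by
    -- The interval is locally compact, so the product of the quotient map with it is again a
    -- quotient map.
    refine isQuotientMap_quot_mk.continuous_lift_prod_left ?_
    rw [← (Homeomorph.sigmaProdDistrib).symm.comp_continuous_iff', continuous_sigma_iff]
    intro q
    change Continuous fun a : (Fin q.1 → unitInterval) × unitInterval =>
      X.charMap q.2 fun i => stretch (a.1 i) a.2
    refine (X.charMap q.2).continuous.comp (continuous_pi fun i => ?_)
    exact continuous_stretch.comp (f := fun x : (Fin q.1 → unitInterval) × unitInterval =>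
      (x.1 i, x.2)) (((continuous_apply i).comp continuous_fst).prodMk continuous_snd)

@[simp] theorem stretchRealization_charMap {n : ℕ} (x : X.cells n) (t : Fin n → unitInterval)
    (τ : unitInterval) : X.stretchRealization (X.charMap x t, τ) =
      X.charMap x fun i => stretch (t i) τ := rfl

theorem exists_charMap (p : X.Realization) :
    ∃ (n : ℕ) (x : X.cells n) (t : Fin n → unitInterval), p = X.charMap x t := by
  obtain ⟨n, x, t, -, h⟩ := exists_eq_charMap p
  exact ⟨n, x, t, h⟩

theorem stretchRealization_zero (p : X.Realization) : X.stretchRealization (p, 0) = p := by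
  obtain ⟨n, x, t, rfl⟩ := exists_charMap p
  simp

theorem rank_stretchRealization_le (p : X.Realization) (τ : unitInterval) :
    X.rank (X.stretchRealization (p, τ)) ≤ X.rank p := by
  obtain ⟨n, x, t, rfl⟩ := exists_charMap p
  rw [stretchRealization_charMap, rank_charMap, rank_charMap]
  refine countIn_mono fun i hi => ⟨fun h => hi.1 ?_, fun h => hi.2 ?_⟩
  · rw [h, stretch_zero_left]
  · rw [h, stretch_one_left]

theorem rank_stretchRealization_one_le (p : X.Realization) :
    X.rank (X.stretchRealization (p, 1)) ≤ X.count middleThird_subset p := by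
  obtain ⟨n, x, t, rfl⟩ := exists_charMap p
  refine countIn_mono fun i hi => ?_
  by_contra h
  have h' : ¬ (1 / 3 ≤ (t i : ℝ) ∧ (t i : ℝ) ≤ 2 / 3) := h
  rcases not_and_or.mp h' with h1 | h1
  · exact hi.1 (stretch_one_eq_zero (le_of_not_ge h1))
  · exact hi.2 (stretch_one_eq_one (le_of_not_ge h1))

end BoxSet

/-! ### Comparison of cubical and singular chains -/

namespace BoxSet

open SingularChain Finsupp

variable {X : BoxSet.{u}} {R : Type v} [CommRing R]

variable (X) in
/-- The cells of a `□`-set, of all dimensions. -/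
abbrev Cell := Σ n : ℕ, X.cells n

variable (R) in
/-- The boundary of a cell. -/
noncomputable def cellBdrySimp : X.Cell → (X.Cell →₀ R)
  | ⟨0, _⟩ => 0
  | ⟨n + 1, x⟩ => ∑ a : Fin (n + 1), (-1 : R) ^ (a + 1 : ℕ) •
      (single ⟨n, X.face false a x⟩ 1 - single ⟨n, X.face true a x⟩ 1)

variable (X R) in
/-- The boundary operator on cubical chains. -/
noncomputable def cellBdry : (X.Cell →₀ R) →ₗ[R] (X.Cell →₀ R) :=
  linearCombination R (cellBdrySimp R)

@[simp] theorem cellBdry_single (x : X.Cell) : X.cellBdry R (single x 1) = cellBdrySimp R x := by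
  simp [cellBdry]

variable (X R) in
/-- The triangulation of cubical chains. -/
noncomputable def triangulate : (X.Cell →₀ R) →ₗ[R] (Simp X.Realization →₀ R) :=
  linearCombination R fun x => cubeChain R (X.charMap x.2)

@[simp] theorem triangulate_single (x : X.Cell) :
    X.triangulate R (single x 1) = cubeChain R (X.charMap x.2) := by
  simp [triangulate]

theorem charMap_comp_cubeFace {n : ℕ} (x : X.cells (n + 1)) (ε : Bool) (a : Fin (n + 1)) :
    (X.charMap x).comp (cubeFace a (endpoint ε)) = X.charMap (X.face ε a x) := by
  refine ContinuousMap.ext fun t => ?_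
  refine (mk_eq_mk_face x (ε := ε) (i := a) (cubeFace_apply_same _ _ _)).trans ?_
  change X.charMap _ _ = X.charMap _ _
  congr 1
  funext k
  exact cubeFace_apply_succAbove _ _ _ _

theorem bdry_triangulate (c : X.Cell →₀ R) :
    bdry R (X.triangulate R c) = X.triangulate R (X.cellBdry R c) := by
  have : bdry R ∘ₗ X.triangulate R = X.triangulate R ∘ₗ X.cellBdry R := by
    refine Finsupp.lhom_ext_single fun x => ?_
    obtain ⟨_ | n, x⟩ := x
    · simp [cubeChain, bdrySimp, cellBdrySimp]
    · simp only [LinearMap.comp_apply, triangulate_single, cellBdry_single, cellBdrySimp, map_sum,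
        map_smul, map_sub, bdry_cubeChain]
      refine Finset.sum_congr rfl fun a _ => ?_
      rw [← charMap_comp_cubeFace, ← charMap_comp_cubeFace]
      rfl
  exact LinearMap.congr_fun this c

theorem triangulate_mem {n : ℕ} {c : X.Cell →₀ R} (hc : c ∈ supported R R {x : X.Cell | x.1 < n}) :
    X.triangulate R c ∈ chainsIn R {p | X.rank p < n} := by
  refine Finsupp.map_supported_mem (fun x hx => ?_) hc
  rw [triangulate_single]
  exact cubeChain_mem fun t => (countIn_le t).trans_lt hx

theorem cellBdry_mem {n : ℕ} {c : X.Cell →₀ R}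
    (hc : c ∈ supported R R {x : X.Cell | x.1 < n + 1}) :
    X.cellBdry R c ∈ supported R R {x : X.Cell | x.1 < n} := by
  refine Finsupp.map_supported_mem (fun x hx => ?_) hc
  rw [cellBdry_single]
  obtain ⟨_ | m, x⟩ := x
  · exact Submodule.zero_mem _
  · have hm : m < n := by simpa using hx
    exact Submodule.sum_mem _ fun a _ => Submodule.smul_mem _ _ (Submodule.sub_mem _
      (single_mem_supported R _ hm) (single_mem_supported R _ hm))

theorem map_charMaps_cubeChains (n : ℕ) (d : X.cells n →₀ R) :
    map R (X.charMaps n) (cubeChains R (X.cells n) n d) =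
      X.triangulate R (lmapDomain R R (Sigma.mk n) d) := by
  have : map R (X.charMaps n) ∘ₗ cubeChains R (X.cells n) n =
      X.triangulate R ∘ₗ lmapDomain R R (Sigma.mk n) := by
    refine Finsupp.lhom_ext_single fun x => ?_
    simp [map_cubeChain, charMaps_comp_cubeAt]
  exact LinearMap.congr_fun this d

/-! ### Induction over skeleta -/

/-- The homology of a skeleton relative to the preceding one is free on the triangulated cells. -/
theorem skeleton_homology (n : ℕ) {z : Simp X.Realization →₀ R} {d : X.cells n →₀ R}
    (hz : z ∈ chainsIn R {p | X.rank p < n + 1})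
    (h : bdry R z - X.triangulate R (lmapDomain R R (Sigma.mk n) d) ∈
      chainsIn R {p | X.rank p < n}) :
    d = 0 ∧ ∃ d' u, z - X.triangulate R (lmapDomain R R (Sigma.mk n) d') - bdry R u ∈
      chainsIn R {p | X.rank p < n} := by
  -- Without `n`-cells no point has rank `n` and the two skeleta coincide; `cellCoord` needs a
  -- default cell.
  rcases isEmpty_or_nonempty (X.cells n) with hempty | hne
  · refine ⟨Subsingleton.elim _ _, 0, 0, ?_⟩
    simp only [map_zero, sub_zero]
    refine chainsIn_mono R (fun p hp => ?_) hz
    have hp' : X.rank p < n + 1 := hp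
    refine lt_of_le_of_ne (Nat.lt_succ_iff.mp hp') fun h => ?_
    obtain ⟨y, -⟩ := exists_charMap_of_rank_eq h
    exact hempty.false y
  have hpre : X.charMaps n ⁻¹' {p | X.rank p < n} = cubeBoundary (X.cells n) n := by
    ext x
    change countIn openInterval x.2 < n ↔ ∃ i, x.2 i = 0 ∨ x.2 i = 1
    rw [lt_iff_le_and_ne, Ne, countIn_eq_iff]
    simp only [countIn_le, true_and, not_forall]
    refine exists_congr fun i => ?_
    change ¬ (x.2 i ≠ 0 ∧ x.2 i ≠ 1) ↔ _
    tauto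
  have hVW : ∀ p ∈ {p | n ≤ X.rank p} ∩ {p | X.rank p < n + 1}, X.rank p = n := by
    rintro p ⟨h1, h2⟩
    have h1' : n ≤ X.rank p := h1
    have h2' : X.rank p < n + 1 := h2
    omega
  -- After stretching only coordinates from the middle third are interior, so points with fewer than
  -- `n` of these move to rank below `n`. Inside the skeleton, `V` is the union of the open
  -- `n`-cells, where `cellCoord` inverts the characteristic maps.
  obtain ⟨w, hw, u, -, hu⟩ := excision (p := X.charMaps n) (A := {p | X.rank p < n})
    (W := {p | X.rank p < n + 1}) (U := {p | X.count middleThird_subset p < n})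
    (V := {p | n ≤ X.rank p}) (F := X.stretchRealization)
    (F' := stretchCube (X.cells n) n) (j := cellCoord n) (z := z)
    (b := cubeChains R (X.cells n) n d) (isOpen_count_lt n) (isOpen_le_rank n)
    (fun p _ => by
      rcases lt_or_ge (X.rank p) n with h | h
      · exact Or.inl ((count_le_rank p).trans_lt h)
      · exact Or.inr h)
    stretchRealization_zero (fun d => by simp [stretchCube])
    (fun p hp τ => (rank_stretchRealization_le p τ).trans_lt hp)
    (fun p hp τ => (rank_stretchRealization_le p τ).trans_lt hp) (fun _ _ => rfl)
    (fun d => Nat.lt_succ_of_le (countIn_le d.2))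
    (fun p hp => (rank_stretchRealization_one_le p).trans_lt hp.1)
    ((continuousOn_cellCoord n).mono hVW)
    (fun p hp => by
      obtain ⟨y, s, hs, rfl⟩ := exists_charMap_of_rank_eq (hVW p hp)
      rw [cellCoord_charMap y hs]
      rfl)
    (fun d hd => cellCoord_charMap d.1
      (countIn_eq_iff.mp (le_antisymm (countIn_le d.2) hd))) hz
    (by rw [hpre]; exact bdry_cubeChains_mem n d)
    (by rwa [map_charMaps_cubeChains])
  rw [hpre] at hw
  obtain ⟨hd, c', u', hu'⟩ := cube_homology n (z := w) (c := d) (by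
    rw [← neg_sub]
    exact Submodule.neg_mem _ hw)
  refine ⟨hd, c', u + map R (X.charMaps n) u', ?_⟩
  rw [← hpre] at hu'
  have h1 := map_mem R (f := X.charMaps n) (B := {p | X.rank p < n}) (fun t ht => ht) hu'
  have h2 : z - X.triangulate R (lmapDomain R R (Sigma.mk n) c') -
      bdry R (u + map R (X.charMaps n) u') = (z - map R (X.charMaps n) w - bdry R u) +
        map R (X.charMaps n) (w - cubeChains R (X.cells n) n c' - bdry R u') := by
    simp only [map_sub, map_add, map_charMaps_cubeChains, bdry_map]
    abel
  rw [h2]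
  exact Submodule.add_mem _ hu h1

/-- The conclusion is exactness of the mapping cone. In the inductive step the top part `d` of `c`
bounds modulo the lower skeleton, hence vanishes; subtracting triangulated top cells and a boundary
then moves `z` into the lower skeleton. -/
theorem exists_of_bdry_eq_triangulate_of_mem (n : ℕ) {z : Simp X.Realization →₀ R}
    {c : X.Cell →₀ R} (hz : z ∈ chainsIn R {p | X.rank p < n})
    (hc : c ∈ supported R R {x : X.Cell | x.1 < n}) (h : bdry R z = X.triangulate R c) :
    ∃ c' u, X.cellBdry R c' = c ∧ z - X.triangulate R c' = bdry R u := by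
  classical
  induction n generalizing z c with
  | zero =>
    have h1 : {p | X.rank p < 0} = ∅ := Set.eq_empty_of_forall_notMem fun p hp => by
      simp at hp
    have h2 : {x : X.Cell | x.1 < 0} = ∅ := Set.eq_empty_of_forall_notMem fun p hp => by
      simp at hp
    rw [h1] at hz
    rw [h2, supported_empty] at hc
    have hz0 := eq_zero_of_mem_chainsIn_empty hz
    have hc0 : c = 0 := hc
    exact ⟨0, 0, by simp [hc0], by simp [hz0]⟩
  | succ n ih =>
    obtain ⟨d, c₁, hc₁, rfl⟩ : ∃ (d : X.cells n →₀ R) (c₁ : X.Cell →₀ R),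
        c₁ ∈ supported R R {x : X.Cell | x.1 < n} ∧ lmapDomain R R (Sigma.mk n) d + c₁ = c := by
      have hset : {x : X.Cell | x.1 < n + 1} = Set.range (Sigma.mk n) ∪ {x : X.Cell | x.1 < n} := by
        ext ⟨m, x⟩
        simp only [Set.mem_ofPred_eq, Set.mem_union, Set.mem_range, Sigma.mk.injEq]
        constructor
        · intro h
          rcases Nat.lt_succ_iff_lt_or_eq.mp h with h | rfl
          · exact Or.inr h
          · exact Or.inl ⟨x, rfl, HEq.rfl⟩
        · rintro (⟨_, rfl, _⟩ | h) <;> omega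
      rw [hset, supported_union] at hc
      obtain ⟨a, ha, b, hb, hab⟩ := Submodule.mem_sup.mp hc
      rw [← Set.image_univ, ← lmapDomain_supported, supported_univ] at ha
      obtain ⟨d, -, rfl⟩ := ha
      exact ⟨d, b, hb, hab⟩
    rw [map_add] at h
    obtain ⟨hd, d', u, hu⟩ := skeleton_homology n (d := d) hz (by
      rw [h, add_sub_cancel_left]
      exact triangulate_mem hc₁)
    set e := lmapDomain R R (Sigma.mk n) d' with he
    have hemem : e ∈ supported R R {x : X.Cell | x.1 < n + 1} := by
      have : e ∈ (supported R R (Set.univ : Set (X.cells n))).map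
          (lmapDomain R R (Sigma.mk n : X.cells n → X.Cell)) := by
        rw [supported_univ]
        exact ⟨d', trivial, rfl⟩
      rw [lmapDomain_supported] at this
      refine supported_mono ?_ this
      rintro _ ⟨x, -, rfl⟩
      exact Nat.lt_succ_self n
    obtain ⟨c', u', hc', hu'⟩ := ih hu (Submodule.sub_mem _ hc₁ (cellBdry_mem hemem)) (by
      rw [map_sub, map_sub, bdry_bdry, sub_zero, h, hd, map_sub, bdry_triangulate]
      simp)
    refine ⟨e + c', u + u', ?_, ?_⟩
    · rw [map_add, hc', hd, map_zero, zero_add]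
      abel
    · rw [map_add, map_add, ← hu']
      abel

/-- Every chain of the realization can be stretched into a skeleton. -/
theorem exists_stretch_mem (z : Simp X.Realization →₀ R) :
    ∃ N, ∀ n, N ≤ n → map R (homotopyEnd X.stretchRealization 1) z ∈
      chainsIn R {p | X.rank p < n} := by
  have key : ∀ s : Simp X.Realization, ∃ N, ∀ t, X.count middleThird_subset (s.2 t) < N := by
    intro s
    have hcomp : IsCompact (Set.range s.2) := isCompact_range s.2.continuous
    -- The image of a simplex is compact, and the open sets with a bounded number of middle-third
    -- coordinates increase to the whole space.
    obtain ⟨N, hN⟩ := hcomp.elim_directed_cover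
      (fun N => {p | X.count middleThird_subset p < N}) isOpen_count_lt
      (fun p _ => Set.mem_iUnion.mpr ⟨_, Nat.lt_succ_self (X.count middleThird_subset p)⟩)
      (directed_of_isDirected_le fun a b hab p hp => lt_of_lt_of_le hp hab)
    exact ⟨N, fun t => hN ⟨t, rfl⟩⟩
  induction z using Finsupp.induction_linear with
  | zero => exact ⟨0, fun n _ => by simp⟩
  | add x y hx hy =>
    obtain ⟨N, hN⟩ := hx
    obtain ⟨N', hN'⟩ := hy
    refine ⟨max N N', fun n hn => ?_⟩
    rw [map_add]
    exact Submodule.add_mem _ (hN n (le_of_max_le_left hn)) (hN' n (le_of_max_le_right hn))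
  | single s r =>
    obtain ⟨N, hN⟩ := key s
    refine ⟨N, fun n hn => ?_⟩
    rw [map_single]
    exact single_mem_supported R _ fun t =>
      ((rank_stretchRealization_one_le _).trans_lt (hN t)).trans_le hn

/-- The triangulation of cubical chains is a quasi-isomorphism, in elementwise form. -/
theorem exists_of_bdry_eq_triangulate {z : Simp X.Realization →₀ R} {c : X.Cell →₀ R}
    (h : bdry R z = X.triangulate R c) :
    ∃ c' u, X.cellBdry R c' = c ∧ z - X.triangulate R c' = bdry R u := by
  obtain ⟨N, hN⟩ := exists_stretch_mem z
  obtain ⟨M, hM⟩ : ∃ M, ∀ n, M ≤ n → c ∈ supported R R {x : X.Cell | x.1 < n} := by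
    refine ⟨c.support.sup Sigma.fst + 1, fun n hn => ?_⟩
    rw [mem_supported]
    intro x hx
    have := Finset.le_sup (f := Sigma.fst) hx
    change x.1 < n
    omega
  set n := max N M
  set P := prism R X.stretchRealization
  have h0 : homotopyEnd X.stretchRealization 0 = ContinuousMap.id _ :=
    ContinuousMap.ext stretchRealization_zero
  have hcM := hM n (le_max_right _ _)
  have e1 := bdry_prism (R := R) X.stretchRealization z
  have e2 := bdry_prism (R := R) X.stretchRealization (X.triangulate R c)
  rw [h0, map_id] at e1 e2
  rw [← h, bdry_bdry, map_zero, add_zero, h, ← h, ← bdry_map] at e2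
  -- Stretching moves `z` into a skeleton but also changes its boundary. Subtracting the prism over
  -- that boundary restores it, and the prism stays in the skeleton because stretching never raises
  -- the rank.
  obtain ⟨c', u, hc', hu⟩ := exists_of_bdry_eq_triangulate_of_mem n
    (z := map R (homotopyEnd X.stretchRealization 1) z - P (X.triangulate R c)) (c := c)
    (Submodule.sub_mem _ (hN n (le_max_left _ _)) (prism_mem
      (fun p hp τ => (rank_stretchRealization_le p τ).trans_lt hp) (triangulate_mem hcM))) hcM (by
      rw [map_sub, ← h, e2]
      abel)
  refine ⟨c', u - P z, hc', ?_⟩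
  rw [map_sub, ← hu, eq_sub_iff_add_eq.mpr e1, h]
  abel

end BoxSet

/-! ### Homotopy inverses -/

section Graded

open Finsupp

variable {R : Type v} [CommRing R]

/-- An exact sequence of projective modules that is bounded on the right is contractible. -/
theorem exists_contraction {M : ℕ → Type*} [∀ n, AddCommGroup (M n)] [∀ n, Module R (M n)]
    [∀ n, Module.Projective R (M n)] (d : ∀ n, M (n + 1) →ₗ[R] M n)
    (hd : ∀ n x, d n (d (n + 1) x) = 0) (h0 : Function.Surjective (d 0))
    (hex : ∀ n x, d n x = 0 → ∃ y, d (n + 1) y = x) :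
    ∃ s : ∀ n, M n →ₗ[R] M (n + 1), (∀ x, d 0 (s 0 x) = x) ∧
      ∀ n x, d (n + 1) (s (n + 1) x) + s n (d n x) = x := by
  -- The invariant `d s d = d` says that `id - s d` takes values in the kernel of `d`, which is the
  -- image of the next differential; projectivity provides the lift.
  have hstep : ∀ n (s : M n →ₗ[R] M (n + 1)), d n ∘ₗ s ∘ₗ d n = d n →
      ∃ s' : M (n + 1) →ₗ[R] M (n + 2), d (n + 1) ∘ₗ s' = LinearMap.id - s ∘ₗ d n := by
    intro n s hs
    have hmem : ∀ x, (LinearMap.id - s ∘ₗ d n : M (n + 1) →ₗ[R] M (n + 1)) x ∈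
        LinearMap.ker (d n) := fun x => by
      have := LinearMap.congr_fun hs x
      simpa [sub_eq_zero] using this.symm
    have hmem' : ∀ x, d (n + 1) x ∈ LinearMap.ker (d n) := hd n
    obtain ⟨s', hs'⟩ := Module.projective_lifting_property
      ((d (n + 1)).codRestrict (LinearMap.ker (d n)) hmem')
      ((LinearMap.id - s ∘ₗ d n : M (n + 1) →ₗ[R] M (n + 1)).codRestrict
        (LinearMap.ker (d n)) hmem) (fun y => by
          obtain ⟨x, hx⟩ := hex n y.1 y.2
          exact ⟨x, Subtype.ext hx⟩)
    exact ⟨s', LinearMap.ext fun x => congrArg Subtype.val (LinearMap.congr_fun hs' x)⟩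
  have hstep' : ∀ n (s : M n →ₗ[R] M (n + 1)), d n ∘ₗ s ∘ₗ d n = d n →
      ∃ s' : M (n + 1) →ₗ[R] M (n + 2), d (n + 1) ∘ₗ s' = LinearMap.id - s ∘ₗ d n ∧
        d (n + 1) ∘ₗ s' ∘ₗ d (n + 1) = d (n + 1) := by
    intro n s hs
    obtain ⟨s', hs'⟩ := hstep n s hs
    refine ⟨s', hs', LinearMap.ext fun x => ?_⟩
    have := LinearMap.congr_fun hs' (d (n + 1) x)
    simpa [hd] using this
  obtain ⟨s₀, hs₀⟩ := Module.projective_lifting_property (d 0) LinearMap.id h0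
  choose! next hnext using hstep'
  let s : ∀ n, {s : M n →ₗ[R] M (n + 1) // d n ∘ₗ s ∘ₗ d n = d n} := fun n =>
    Nat.rec ⟨s₀, by rw [← LinearMap.comp_assoc, hs₀, LinearMap.id_comp]⟩
      (fun n s => ⟨next n s.1, (hnext n s.1 s.2).2⟩) n
  refine ⟨fun n => (s n).1, fun x => LinearMap.congr_fun hs₀ x, fun n x => ?_⟩
  have h1 := LinearMap.congr_fun (hnext n (s n).1 (s n).2).1 x
  change d (n + 1) (next n (s n).1 x) + _ = x
  have h2 : d (n + 1) (next n (s n).1 x) = x - (s n).1 (d n x) := h1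
  rw [h2, sub_add_cancel]

variable {B : ℕ → Type*}

variable (R B) in
/-- The inclusion of the chains of degree `n` into all chains. -/
noncomputable def inclDegree (n : ℕ) : (B n →₀ R) →ₗ[R] ((Σ n, B n) →₀ R) :=
  lmapDomain R R (Sigma.mk n)

variable (R B) in
/-- The component of degree `n` of a chain. -/
noncomputable def compDegree (n : ℕ) : ((Σ n, B n) →₀ R) →ₗ[R] (B n →₀ R) :=
  lcomapDomain (Sigma.mk n) sigma_mk_injective

@[simp] theorem inclDegree_single (n : ℕ) (b : B n) (r : R) :
    inclDegree R B n (single b r) = single ⟨n, b⟩ r := by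
  simp [inclDegree]

@[simp] theorem compDegree_inclDegree (n : ℕ) (c : B n →₀ R) :
    compDegree R B n (inclDegree R B n c) = c :=
  comapDomain_mapDomain _ sigma_mk_injective c

theorem compDegree_inclDegree_of_ne {n m : ℕ} (h : n ≠ m) (c : B m →₀ R) :
    compDegree R B n (inclDegree R B m c) = 0 := by
  classical
  have : compDegree R B n ∘ₗ inclDegree R B m = 0 := by
    refine Finsupp.lhom_ext_single fun b => Finsupp.ext fun a => ?_
    have hne : (⟨m, b⟩ : Σ n, B n) ≠ ⟨n, a⟩ := fun h' => h (congrArg Sigma.fst h').symm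
    simp only [LinearMap.comp_apply, inclDegree_single, LinearMap.zero_apply, Finsupp.coe_zero,
      Pi.zero_apply]
    exact single_eq_of_ne hne.symm
  exact LinearMap.congr_fun this c

/-- The components of an operator of degree `-1`. -/
theorem compDegree_comm {B' : ℕ → Type*} {k : ℕ} {D : ((Σ n, B n) →₀ R) →ₗ[R] ((Σ n, B' n) →₀ R)}
    {d : ∀ n, (B (n + k) →₀ R) →ₗ[R] (B' n →₀ R)}
    (h0 : ∀ m < k, ∀ c, D (inclDegree R B m c) = 0)
    (h : ∀ n c, D (inclDegree R B (n + k) c) = inclDegree R B' n (d n c))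
    (n : ℕ) (c : (Σ n, B n) →₀ R) :
    compDegree R B' n (D c) = d n (compDegree R B (n + k) c) := by
  have : compDegree R B' n ∘ₗ D = d n ∘ₗ compDegree R B (n + k) := by
    refine Finsupp.lhom_ext_single fun b => ?_
    obtain ⟨m, b⟩ := b
    rw [← inclDegree_single, LinearMap.comp_apply, LinearMap.comp_apply]
    rcases lt_or_ge m k with hm | hm
    · rw [h0 m hm, compDegree_inclDegree_of_ne (by omega), map_zero, map_zero]
    · obtain ⟨m, rfl⟩ := Nat.exists_eq_add_of_le' hm
      rw [h]
      rcases eq_or_ne n m with rfl | hne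
      · rw [compDegree_inclDegree, compDegree_inclDegree]
      · rw [compDegree_inclDegree_of_ne hne, compDegree_inclDegree_of_ne (by omega), map_zero]
  exact LinearMap.congr_fun this c

/-- The map on functions dual to a map between free modules. -/
noncomputable def dualMap {A B : Type*} (f : (A →₀ R) →ₗ[R] (B →₀ R)) : (B → R) →ₗ[R] (A → R) where
  toFun g a := linearCombination R g (f (single a 1))
  map_add' g g' := by
    funext a
    simp [linearCombination_apply, Finsupp.sum, mul_add, Finset.sum_add_distrib]
  map_smul' r g := by
    funext a
    simp only [linearCombination_apply, Finsupp.sum, Pi.smul_apply, smul_eq_mul, Finset.mul_sum,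
      RingHom.id_apply]
    exact Finset.sum_congr rfl fun i _ => by ring

theorem linearCombination_dualMap {A B : Type*} (f : (A →₀ R) →ₗ[R] (B →₀ R)) (g : B → R)
    (c : A →₀ R) : linearCombination R (dualMap f g) c = linearCombination R g (f c) := by
  have : linearCombination R (dualMap f g) = linearCombination R g ∘ₗ f :=
    Finsupp.lhom_ext_single fun a => by simp [dualMap]
  exact LinearMap.congr_fun this c

theorem dualMap_comp {A B C : Type*} (f : (A →₀ R) →ₗ[R] (B →₀ R))
    (f' : (B →₀ R) →ₗ[R] (C →₀ R)) (g : C → R) :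
    dualMap f (dualMap f' g) = dualMap (f' ∘ₗ f) g := by
  funext a
  exact linearCombination_dualMap f' g _

theorem dualMap_add {A B : Type*} (f f' : (A →₀ R) →ₗ[R] (B →₀ R)) (g : B → R) :
    dualMap (f + f') g = dualMap f g + dualMap f' g := by
  funext a
  simp [dualMap]

theorem dualMap_id {A : Type*} (g : A → R) : dualMap LinearMap.id g = g := by
  funext a
  simp [dualMap]

end Graded

/-! ### Chains degree by degree -/

namespace BoxSet

open SingularChain Finsupp

variable (X : BoxSet.{u}) (R : Type v) [CommRing R]

/-- The boundary of singular chains in a given degree. -/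
noncomputable def _root_.SingularChain.simpBdry (T : Type*) [TopologicalSpace T] (n : ℕ) :
    (C(TopSimplex (n + 1), T) →₀ R) →ₗ[R] (C(TopSimplex n, T) →₀ R) :=
  linearCombination R fun s => ∑ i : Fin (n + 2), (-1 : R) ^ (i : ℕ) • single (s.comp (SingularChain.face i)) 1

/-- The boundary of cubical chains in a given degree. -/
noncomputable def chainBdry (n : ℕ) : (X.cells (n + 1) →₀ R) →ₗ[R] (X.cells n →₀ R) :=
  linearCombination R fun x => ∑ a : Fin (n + 1), (-1 : R) ^ (a + 1 : ℕ) •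
    (single (X.face false a x) 1 - single (X.face true a x) 1)

/-- The triangulation of cubical chains in a given degree. -/
noncomputable def triangulateDegree (n : ℕ) :
    (X.cells n →₀ R) →ₗ[R] (C(TopSimplex n, X.Realization) →₀ R) :=
  linearCombination R fun x => ∑ σ : Equiv.Perm (Fin n), ((Equiv.Perm.sign σ : ℤ) : R) •
    single ((X.charMap x).comp (cubeSimplex σ)) 1

section

variable {X R}

theorem bdry_inclDegree {T : Type*} [TopologicalSpace T] (n : ℕ)
    (c : C(TopSimplex (n + 1), T) →₀ R) :
    bdry R (inclDegree R (fun k => C(TopSimplex k, T)) (n + 1) c) =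
      inclDegree R (fun k => C(TopSimplex k, T)) n (simpBdry R T n c) := by
  have : bdry R ∘ₗ inclDegree R (fun k => C(TopSimplex k, T)) (n + 1) =
      inclDegree R (fun k => C(TopSimplex k, T)) n ∘ₗ simpBdry R T n :=
    Finsupp.lhom_ext_single fun s => by simp [bdrySimp, simpBdry]
  exact LinearMap.congr_fun this c

theorem bdry_inclDegree_zero {T : Type*} [TopologicalSpace T] (c : C(TopSimplex 0, T) →₀ R) :
    bdry R (inclDegree R (fun k => C(TopSimplex k, T)) 0 c) = 0 := by
  have : bdry R ∘ₗ inclDegree R (fun k => C(TopSimplex k, T)) 0 = 0 :=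
    Finsupp.lhom_ext_single fun s => by simp [bdrySimp]
  exact LinearMap.congr_fun this c

theorem cellBdry_inclDegree (n : ℕ) (c : X.cells (n + 1) →₀ R) :
    X.cellBdry R (inclDegree R X.cells (n + 1) c) = inclDegree R X.cells n (X.chainBdry R n c) := by
  have : X.cellBdry R ∘ₗ inclDegree R X.cells (n + 1) = inclDegree R X.cells n ∘ₗ X.chainBdry R n :=
    Finsupp.lhom_ext_single fun s => by simp [cellBdrySimp, chainBdry]
  exact LinearMap.congr_fun this c

theorem cellBdry_inclDegree_zero (c : X.cells 0 →₀ R) :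
    X.cellBdry R (inclDegree R X.cells 0 c) = 0 := by
  have : X.cellBdry R ∘ₗ inclDegree R X.cells 0 = 0 :=
    Finsupp.lhom_ext_single fun s => by simp [cellBdrySimp]
  exact LinearMap.congr_fun this c

theorem triangulate_inclDegree (n : ℕ) (c : X.cells n →₀ R) :
    X.triangulate R (inclDegree R X.cells n c) =
      inclDegree R (fun k => C(TopSimplex k, X.Realization)) n (X.triangulateDegree R n c) := by
  have : X.triangulate R ∘ₗ inclDegree R X.cells n =
      inclDegree R (fun k => C(TopSimplex k, X.Realization)) n ∘ₗ X.triangulateDegree R n :=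
    Finsupp.lhom_ext_single fun s => by simp [cubeChain, triangulateDegree]
  exact LinearMap.congr_fun this c

theorem inclDegree_injective {B : ℕ → Type*} (n : ℕ) : Function.Injective (inclDegree R B n) :=
  Function.LeftInverse.injective (compDegree_inclDegree n)

theorem simpBdry_triangulateDegree (n : ℕ) (c : X.cells (n + 1) →₀ R) :
    simpBdry R X.Realization n (X.triangulateDegree R (n + 1) c) =
      X.triangulateDegree R n (X.chainBdry R n c) := by
  apply inclDegree_injective (R := R) (B := fun k => C(TopSimplex k, X.Realization)) n
  rw [← bdry_inclDegree, ← triangulate_inclDegree, bdry_triangulate, cellBdry_inclDegree,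
    triangulate_inclDegree]

theorem simpBdry_simpBdry {T : Type*} [TopologicalSpace T] (n : ℕ)
    (c : C(TopSimplex (n + 2), T) →₀ R) : simpBdry R T n (simpBdry R T (n + 1) c) = 0 := by
  apply inclDegree_injective (R := R) (B := fun k => C(TopSimplex k, T)) n
  rw [← bdry_inclDegree, ← bdry_inclDegree, bdry_bdry, map_zero]

theorem dualMap_chainBdry (n : ℕ) (f : X.cells n → R) :
    dualMap (X.chainBdry R n) f = X.coboundary R n f := by
  funext x
  simp [dualMap, chainBdry, coboundary]

/-- Coefficients are detected by indicator cochains, so this is dual to `coboundary_coboundary`. -/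
theorem chainBdry_chainBdry (n : ℕ) (c : X.cells (n + 2) →₀ R) :
    X.chainBdry R n (X.chainBdry R (n + 1) c) = 0 := by
  classical
  have : X.chainBdry R n ∘ₗ X.chainBdry R (n + 1) = 0 := by
    refine Finsupp.lhom_ext_single fun x => Finsupp.ext fun y => ?_
    have h1 : ∀ c : X.cells n →₀ R, c y = linearCombination R (fun z => if z = y then 1 else 0) c := by
      intro c
      simp only [linearCombination_apply, Finsupp.sum, smul_eq_mul, mul_ite, mul_one, mul_zero,
        Finset.sum_ite_eq', mem_support_iff]
      split_ifs with h
      · rfl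
      · exact not_not.mp h
    have h2 := congrFun (X.coboundary_coboundary R n (fun z => if z = y then 1 else 0)) x
    rw [← dualMap_chainBdry, ← dualMap_chainBdry, dualMap_comp] at h2
    rw [h1]
    exact h2
  exact LinearMap.congr_fun this c

/-- The solutions found among inhomogeneous chains are cut down to the right degrees, which is
harmless as all operators are homogeneous. -/
theorem exists_of_simpBdry_eq (n : ℕ) {z : C(TopSimplex (n + 1), X.Realization) →₀ R}
    {c : X.cells n →₀ R} (h : simpBdry R X.Realization n z = X.triangulateDegree R n c) :
    ∃ c' u, X.chainBdry R n c' = c ∧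
      z - X.triangulateDegree R (n + 1) c' = simpBdry R X.Realization (n + 1) u := by
  obtain ⟨c', u, hc', hu⟩ := exists_of_bdry_eq_triangulate
    (z := inclDegree R (fun k => C(TopSimplex k, X.Realization)) (n + 1) z)
    (c := inclDegree R X.cells n c) (by rw [bdry_inclDegree, triangulate_inclDegree, h])
  have e1 := fun n c => compDegree_comm (k := 1) (D := X.cellBdry R) (d := X.chainBdry R)
    (fun m hm c => by
      obtain rfl : m = 0 := by omega
      exact cellBdry_inclDegree_zero c) cellBdry_inclDegree n c
  have e2 := fun n c => compDegree_comm (k := 1) (B := fun k => C(TopSimplex k, X.Realization))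
    (B' := fun k => C(TopSimplex k, X.Realization)) (D := bdry R)
    (d := simpBdry R X.Realization)
    (fun m hm c => by
      obtain rfl : m = 0 := by omega
      exact bdry_inclDegree_zero c) bdry_inclDegree n c
  have e3 := fun n c => compDegree_comm (k := 0) (D := X.triangulate R)
    (B' := fun k => C(TopSimplex k, X.Realization)) (d := X.triangulateDegree R)
    (fun m hm c => absurd hm (Nat.not_lt_zero m)) triangulate_inclDegree n c
  refine ⟨compDegree R X.cells (n + 1) c',
    compDegree R (fun k => C(TopSimplex k, X.Realization)) (n + 2) u, ?_, ?_⟩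
  · rw [← e1, hc', compDegree_inclDegree]
  · have := congrArg (compDegree R (fun k => C(TopSimplex k, X.Realization)) (n + 1)) hu
    rw [map_sub, compDegree_inclDegree, e2, e3] at this
    exact this

theorem exists_of_degree_zero (z : C(TopSimplex 0, X.Realization) →₀ R) :
    ∃ c' u, z - X.triangulateDegree R 0 c' = simpBdry R X.Realization 0 u := by
  obtain ⟨c', u, -, hu⟩ := exists_of_bdry_eq_triangulate (X := X) (c := 0)
    (z := inclDegree R (fun k => C(TopSimplex k, X.Realization)) 0 z)
    (by rw [bdry_inclDegree_zero, map_zero])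
  have e2 := fun n c => compDegree_comm (k := 1) (B := fun k => C(TopSimplex k, X.Realization))
    (B' := fun k => C(TopSimplex k, X.Realization)) (D := bdry R)
    (d := simpBdry R X.Realization)
    (fun m hm c => by
      obtain rfl : m = 0 := by omega
      exact bdry_inclDegree_zero c) bdry_inclDegree n c
  have e3 := fun n c => compDegree_comm (k := 0) (D := X.triangulate R)
    (B' := fun k => C(TopSimplex k, X.Realization)) (d := X.triangulateDegree R)
    (fun m hm c => absurd hm (Nat.not_lt_zero m)) triangulate_inclDegree n c
  refine ⟨compDegree R X.cells 0 c',
    compDegree R (fun k => C(TopSimplex k, X.Realization)) 1 u, ?_⟩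
  have := congrArg (compDegree R (fun k => C(TopSimplex k, X.Realization)) 0) hu
  rw [map_sub, compDegree_inclDegree, e2, e3] at this
  exact this

end

/-! ### The mapping cone of the triangulation -/

/-- The cells of dimension `n - 1`. -/
abbrev PrevCells : ℕ → Type u
  | 0 => PEmpty
  | n + 1 => X.cells n

/-- The boundary operator in degree `n - 1`. -/
noncomputable def prevBdry : ∀ n, (X.PrevCells (n + 1) →₀ R) →ₗ[R] (X.PrevCells n →₀ R)
  | 0 => 0
  | n + 1 => X.chainBdry R n

/-- The differential of the mapping cone of the triangulation map. -/
noncomputable def coneBdry (n : ℕ) :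
    (X.PrevCells (n + 1) →₀ R) × (C(TopSimplex (n + 1), X.Realization) →₀ R) →ₗ[R]
      (X.PrevCells n →₀ R) × (C(TopSimplex n, X.Realization) →₀ R) :=
  LinearMap.prod (-(X.prevBdry R n ∘ₗ LinearMap.fst R _ _))
    ((X.triangulateDegree R n).coprod (simpBdry R X.Realization n))

theorem coneBdry_apply (n : ℕ)
    (x : (X.PrevCells (n + 1) →₀ R) × (C(TopSimplex (n + 1), X.Realization) →₀ R)) :
    X.coneBdry R n x = (-X.prevBdry R n x.1,
      X.triangulateDegree R n x.1 + simpBdry R X.Realization n x.2) := rfl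

/-- Triangulation of cubical chains is a chain homotopy equivalence. -/
theorem exists_homotopy_inverse :
    ∃ (β : ∀ n, (C(TopSimplex n, X.Realization) →₀ R) →ₗ[R] (X.cells n →₀ R))
      (α : ∀ n, (X.cells n →₀ R) →ₗ[R] (X.cells (n + 1) →₀ R))
      (δ : ∀ n, (C(TopSimplex n, X.Realization) →₀ R) →ₗ[R]
        (C(TopSimplex (n + 1), X.Realization) →₀ R)),
      (∀ n z, X.chainBdry R n (β (n + 1) z) = β n (simpBdry R X.Realization n z)) ∧
      (∀ c, β 0 (X.triangulateDegree R 0 c) = c + X.chainBdry R 0 (α 0 c)) ∧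
      (∀ n c, β (n + 1) (X.triangulateDegree R (n + 1) c) =
        c + X.chainBdry R (n + 1) (α (n + 1) c) + α n (X.chainBdry R n c)) ∧
      (∀ z, z = X.triangulateDegree R 0 (β 0 z) + simpBdry R X.Realization 0 (δ 0 z)) ∧
      (∀ n z, z = X.triangulateDegree R (n + 1) (β (n + 1) z) +
        simpBdry R X.Realization (n + 1) (δ (n + 1) z) + δ n (simpBdry R X.Realization n z)) := by
  obtain ⟨s, hs0, hs⟩ := exists_contraction
    (M := fun n => (X.PrevCells n →₀ R) × (C(TopSimplex n, X.Realization) →₀ R)) (X.coneBdry R)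
    (by
      rintro (_ | n) ⟨c, z⟩
      · rw [coneBdry_apply, coneBdry_apply]
        refine Prod.ext (by simp [prevBdry]) ?_
        change X.triangulateDegree R 0 (-X.chainBdry R 0 c) + simpBdry R X.Realization 0
          (X.triangulateDegree R 1 c + simpBdry R X.Realization 1 z) = 0
        rw [map_add, simpBdry_triangulateDegree, simpBdry_simpBdry, map_neg]
        simp
      · rw [coneBdry_apply, coneBdry_apply]
        refine Prod.ext ?_ ?_
        · change -X.chainBdry R n (-X.chainBdry R (n + 1) c) = 0
          rw [map_neg, chainBdry_chainBdry, neg_zero, neg_zero]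
        · change X.triangulateDegree R (n + 1) (-X.chainBdry R (n + 1) c) +
            simpBdry R X.Realization (n + 1)
              (X.triangulateDegree R (n + 2) c + simpBdry R X.Realization (n + 2) z) = 0
          rw [map_add, simpBdry_triangulateDegree, simpBdry_simpBdry, map_neg]
          simp)
    (by
      rintro ⟨c, z⟩
      obtain ⟨c', u, h⟩ := exists_of_degree_zero z
      refine ⟨(c', u), Prod.ext (Subsingleton.elim (α := PEmpty →₀ R) _ _) ?_⟩
      change X.triangulateDegree R 0 c' + simpBdry R X.Realization 0 u = z
      rw [← h]
      abel)
    -- Exactness of the cone is `exists_of_simpBdry_eq` with `-c`, the sign coming from the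
    -- differential of the cone.
    (by
      rintro n ⟨c, z⟩ hcz
      have h2 : X.triangulateDegree R n c + simpBdry R X.Realization n z = 0 :=
        congrArg Prod.snd hcz
      obtain ⟨c', u, hc', hu⟩ := exists_of_simpBdry_eq n (z := z) (c := -c) (by
        rw [map_neg]
        exact eq_neg_of_add_eq_zero_right h2)
      refine ⟨(c', u), Prod.ext ?_ ?_⟩
      · change -X.chainBdry R n c' = c
        rw [hc', neg_neg]
      · change X.triangulateDegree R (n + 1) c' + simpBdry R X.Realization (n + 1) u = z
        rw [← hu]
        abel)
  -- The entries of the contraction: from simplices to cells it gives the inverse, the diagonal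
  -- entries give the homotopies. The `n`-cells sit in degree `n + 1` of the cone, hence `s (n + 1)`
  -- in the second entry.
  refine ⟨fun n => LinearMap.fst R _ _ ∘ₗ s n ∘ₗ LinearMap.inr R _ _,
    fun n => LinearMap.fst R _ _ ∘ₗ s (n + 1) ∘ₗ LinearMap.inl R _ _,
    fun n => LinearMap.snd R _ _ ∘ₗ s n ∘ₗ LinearMap.inr R _ _, ?_, ?_, ?_, ?_, ?_⟩
  · intro n z
    have h := congrArg Prod.fst (hs n (0, z))
    rw [coneBdry_apply, coneBdry_apply] at h
    simp only [map_zero, neg_zero, zero_add, Prod.fst_add] at h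
    exact (neg_add_eq_zero.mp h)
  · intro c
    have h := congrArg Prod.fst (hs 0 (c, 0))
    rw [coneBdry_apply, coneBdry_apply] at h
    simp only [map_zero, add_zero, Prod.fst_add] at h
    have h0 : -X.prevBdry R 0 c = 0 := Subsingleton.elim (α := PEmpty →₀ R) _ _
    rw [h0, neg_add_eq_iff_eq_add] at h
    exact h.trans (add_comm _ _)
  · intro n c
    have h := congrArg Prod.fst (hs (n + 1) (c, 0))
    rw [coneBdry_apply, coneBdry_apply] at h
    have h1 : ∀ (a : X.PrevCells (n + 1) →₀ R) (b : C(TopSimplex (n + 1), X.Realization) →₀ R),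
        s (n + 1) (-a, b) = -s (n + 1) (a, 0) + s (n + 1) (0, b) := by
      intro a b
      rw [← map_neg, ← map_add]
      simp
    simp only [map_zero, add_zero, Prod.fst_add, h1, Prod.fst_neg] at h
    rw [neg_add_eq_iff_eq_add, neg_add_eq_iff_eq_add] at h
    exact h.trans ((add_comm _ _).trans (congrArg (· + _) (add_comm _ _)))
  · intro z
    have h := congrArg Prod.snd (hs0 (0, z))
    exact h.symm
  · intro n z
    have h := congrArg Prod.snd (hs n (0, z))
    rw [coneBdry_apply, coneBdry_apply] at h
    simp only [map_zero, neg_zero, zero_add, Prod.snd_add] at h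
    exact h.symm

end BoxSet

/-! ### The homotopy equivalence of cochain complexes -/

open Limits in
/-- A homotopy between maps of cochain complexes in degrees `≥ 0`, given in each degree. -/
noncomputable def CochainComplex.homotopyOfSucc {V : Type*} [Category V] [Preadditive V]
    {K L : CochainComplex V ℕ} {f g : K ⟶ L} (h : ∀ n, K.X (n + 1) ⟶ L.X n)
    (h0 : f.f 0 = K.d 0 1 ≫ h 0 + g.f 0)
    (hs : ∀ n, f.f (n + 1) = K.d (n + 1) (n + 2) ≫ h (n + 1) + h n ≫ L.d n (n + 1) + g.f (n + 1)) :
    Homotopy f g where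
  hom i j := if H : i = j + 1 then eqToHom (by rw [H]) ≫ h j else 0
  zero i j hij := dif_neg fun H => hij H.symm
  comm i := by
    obtain _ | n := i
    · rw [Homotopy.prevD_zero_cochainComplex, Homotopy.dNext_cochainComplex, h0]
      simp
    · rw [Homotopy.prevD_succ_cochainComplex, Homotopy.dNext_cochainComplex, hs]
      simp

section

open SingularChain Finsupp

variable (R : Type v) [CommRing R] (T : Type u) [TopologicalSpace T]

/-- Singular cochains as functions on continuous maps. -/
noncomputable def singularCochainEquiv (n : ℕ) :
    ((TopCat.toSSet.obj (TopCat.of T)).obj (op (SimplexCategory.mk n)) → R) ≃ₗ[R]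
      (C(TopSimplex n, T) → R) :=
  LinearEquiv.funCongrLeft R R
    (TopCat.toSSetObjEquiv (TopCat.of T) (op (SimplexCategory.mk n))).symm

variable {T} in
/-- The coboundary of cochains on a simplicial set. -/
def _root_.SSet.coboundary (Y : SSet.{u}) (n : ℕ) :
    (Y.obj (op (SimplexCategory.mk n)) → R) →ₗ[R] (Y.obj (op (SimplexCategory.mk (n + 1))) → R) :=
  ∑ i : Fin (n + 2), (-1 : R) ^ (i : ℕ) • LinearMap.funLeft R R (Y.map (SimplexCategory.δ i).op)

theorem singularCochainComplex_d (T : TopCat.{u}) (n : ℕ) :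
    (singularCochainComplex R T).d n (n + 1) =
      ModuleCat.ofHom ((TopCat.toSSet.obj T).coboundary R n) := by
  refine (CochainComplex.of_d (fun n => ModuleCat.of R ((TopCat.toSSet.obj T).obj
    (op (SimplexCategory.mk n)) → R)) (AlgebraicTopology.AlternatingCofaceMapComplex.objD
      ((TopCat.toSSet.obj T).cosimplicialCochains R)) n).trans (ModuleCat.hom_ext ?_)
  refine (ModuleCat.hom_sum (R := R) _ _).trans ?_
  refine Finset.sum_congr rfl fun i _ => ?_
  rw [ModuleCat.hom_zsmul]
  refine LinearMap.ext fun (c : (TopCat.toSSet.obj T).obj (op (SimplexCategory.mk n)) → R) =>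
    funext fun y => ?_
  change (-1 : ℤ) ^ (i : ℕ) • c ((TopCat.toSSet.obj T).map (SimplexCategory.δ i).op y) =
    (-1 : R) ^ (i : ℕ) • c ((TopCat.toSSet.obj T).map (SimplexCategory.δ i).op y)
  rw [zsmul_eq_mul]
  push_cast
  rfl

theorem singularCochainEquiv_coboundary (n : ℕ)
    (c : (TopCat.toSSet.obj (TopCat.of T)).obj (op (SimplexCategory.mk n)) → R) :
    singularCochainEquiv R T (n + 1) ((TopCat.toSSet.obj (TopCat.of T)).coboundary R n c) =
      dualMap (simpBdry R T n) (singularCochainEquiv R T n c) := by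
  funext s
  simp only [dualMap, simpBdry, LinearMap.coe_mk, AddHom.coe_mk, linearCombination_single,
    one_smul, map_sum, map_smul, smul_eq_mul, one_mul]
  exact (congrFun (LinearMap.sum_apply _ _ _) _).trans (Finset.sum_apply _ _ _)

end

namespace BoxSet

open SingularChain Finsupp

variable (X : BoxSet.{u}) (R : Type v) [CommRing R]

theorem cochainComplex_d (n : ℕ) :
    (X.cochainComplex R).d n (n + 1) = ModuleCat.ofHom (X.coboundary R n) :=
  CochainComplex.of_d (fun n => ModuleCat.of R (X.cells n → R))
    (fun n => ModuleCat.ofHom (X.coboundary R n)) n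

/-- Restriction of singular cochains to the triangulated cubes. -/
noncomputable def restriction :
    singularCochainComplex R (TopCat.of X.Realization) ⟶ X.cochainComplex R :=
  CochainComplex.ofHom (fun n => ModuleCat.ofHom
    (dualMap (X.triangulateDegree R n) ∘ₗ (singularCochainEquiv R X.Realization n).toLinearMap))
    fun n => by
      rw [cochainComplex_d, singularCochainComplex_d]
      refine ModuleCat.hom_ext (LinearMap.ext fun
        (c : (TopCat.toSSet.obj (TopCat.of X.Realization)).obj (op (SimplexCategory.mk n)) → R) => ?_)
      change X.coboundary R n (dualMap (X.triangulateDegree R n)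
          (singularCochainEquiv R X.Realization n c)) =
        dualMap (X.triangulateDegree R (n + 1)) (singularCochainEquiv R X.Realization (n + 1)
          ((TopCat.toSSet.obj (TopCat.of X.Realization)).coboundary R n c))
      rw [singularCochainEquiv_coboundary, dualMap_comp, ← dualMap_chainBdry, dualMap_comp]
      congr 1
      exact congrArg dualMap (LinearMap.ext fun z => (simpBdry_triangulateDegree n z).symm)

theorem restriction_apply (n : ℕ)
    (c : (TopCat.toSSet.obj (TopCat.of X.Realization)).obj (op (SimplexCategory.mk n)) → R)
    (x : X.cells n) : ((X.restriction R).f n).hom c x =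
      ∑ σ : Equiv.Perm (Fin n), ((Equiv.Perm.sign σ : ℤ) : R) * c (X.simplex σ x) := by
  change dualMap (X.triangulateDegree R n) (singularCochainEquiv R X.Realization n c) x = _
  simp only [dualMap, triangulateDegree, LinearMap.coe_mk, AddHom.coe_mk,
    linearCombination_single, one_smul, map_sum, map_smul, smul_eq_mul, one_mul]
  rfl

theorem exists_homotopyEquiv :
    ∃ e : HomotopyEquiv (singularCochainComplex R (TopCat.of X.Realization)) (X.cochainComplex R),
      e.hom = X.restriction R := by
  obtain ⟨β, α, δ, hβ, hα0, hα, hδ0, hδ⟩ := X.exists_homotopy_inverse R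
  let Y := TopCat.toSSet.obj (TopCat.of X.Realization)
  let E := singularCochainEquiv R X.Realization
  have hE : ∀ n c, E (n + 1) (Y.coboundary R n c) = dualMap (simpBdry R X.Realization n) (E n c) :=
    singularCochainEquiv_coboundary R X.Realization
  let inv : X.cochainComplex R ⟶ singularCochainComplex R (TopCat.of X.Realization) :=
    CochainComplex.ofHom (fun n => ModuleCat.ofHom ((E n).symm.toLinearMap ∘ₗ dualMap (β n)))
      fun n => by
        rw [cochainComplex_d, singularCochainComplex_d]
        refine ModuleCat.hom_ext (LinearMap.ext fun (c : X.cells n → R) =>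
          (E (n + 1)).injective ?_)
        change E (n + 1) (Y.coboundary R n
          ((E n).symm (dualMap (β n) c))) = E (n + 1) ((E (n + 1)).symm
            (dualMap (β (n + 1)) (X.coboundary R n c)))
        rw [hE, LinearEquiv.apply_symm_apply, LinearEquiv.apply_symm_apply,
          dualMap_comp, ← dualMap_chainBdry, dualMap_comp]
        congr 1
        exact congrArg dualMap (LinearMap.ext fun z => (hβ n z).symm)
  -- The relation for `δ` writes the identity as triangulation after `β` plus homotopy terms,
  -- whereas a `Homotopy` from the composite to the identity isolates the composite; hence the minus
  -- sign. The relation for `α` already has the required form.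
  refine ⟨⟨X.restriction R, inv, CochainComplex.homotopyOfSucc (fun n => ModuleCat.ofHom
    (-((E n).symm.toLinearMap ∘ₗ dualMap (δ n) ∘ₗ (E (n + 1)).toLinearMap))) ?_ ?_,
    CochainComplex.homotopyOfSucc (fun n => ModuleCat.ofHom (dualMap (α n))) ?_ ?_⟩, rfl⟩
  · rw [singularCochainComplex_d]
    refine ModuleCat.hom_ext (LinearMap.ext fun
      (c : Y.obj (op (SimplexCategory.mk 0)) → R) => (E 0).injective ?_)
    obtain ⟨c : C(TopSimplex _, X.Realization) → R, rfl⟩ := (E 0).symm.surjective c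
    change E 0 ((E 0).symm (dualMap (β 0) (dualMap (X.triangulateDegree R 0)
      (E 0 ((E 0).symm c))))) = E 0 (-((E 0).symm (dualMap (δ 0) (E 1
        (Y.coboundary R 0 ((E 0).symm c)))))
          + (E 0).symm c)
    rw [hE, map_add, map_neg]
    simp only [LinearEquiv.apply_symm_apply]
    rw [eq_neg_add_iff_add_eq, dualMap_comp, dualMap_comp, ← dualMap_add]
    refine (congrArg (fun f => dualMap f c) ?_).trans (dualMap_id c)
    exact LinearMap.ext fun z => (add_comm _ _).trans (hδ0 z).symm
  · intro n
    rw [singularCochainComplex_d, singularCochainComplex_d]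
    refine ModuleCat.hom_ext (LinearMap.ext fun
      (c : Y.obj (op (SimplexCategory.mk (n + 1))) → R) => (E (n + 1)).injective ?_)
    obtain ⟨c : C(TopSimplex _, X.Realization) → R, rfl⟩ := (E (n + 1)).symm.surjective c
    change E (n + 1) ((E (n + 1)).symm (dualMap (β (n + 1)) (dualMap (X.triangulateDegree R (n + 1))
      (E (n + 1) ((E (n + 1)).symm c))))) = E (n + 1) (-((E (n + 1)).symm (dualMap (δ (n + 1))
        (E (n + 2) (Y.coboundary R (n + 1)
          ((E (n + 1)).symm c))))) + Y.coboundary R n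
            (-((E n).symm (dualMap (δ n) (E (n + 1) ((E (n + 1)).symm c))))) + (E (n + 1)).symm c)
    rw [map_add, map_add, hE, hE, map_neg, map_neg,
      map_neg]
    simp only [LinearEquiv.apply_symm_apply]
    rw [← neg_add, eq_neg_add_iff_add_eq, dualMap_comp, dualMap_comp, dualMap_comp,
      ← dualMap_add, ← dualMap_add]
    refine (congrArg (fun f => dualMap f c) ?_).trans (dualMap_id c)
    refine LinearMap.ext fun z => Eq.trans ?_ (hδ n z).symm
    exact (add_comm _ _).trans (add_assoc _ _ _).symm
  · rw [cochainComplex_d]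
    refine ModuleCat.hom_ext (LinearMap.ext fun (c : X.cells 0 → R) => ?_)
    change dualMap (X.triangulateDegree R 0) (E 0 ((E 0).symm (dualMap (β 0) c))) =
      dualMap (α 0) (X.coboundary R 0 c) + c
    rw [LinearEquiv.apply_symm_apply, dualMap_comp, ← dualMap_chainBdry, dualMap_comp]
    nth_rw 3 [← dualMap_id c]
    rw [← dualMap_add]
    refine congrArg (dualMap · c) (LinearMap.ext fun z => ?_)
    exact (hα0 z).trans (add_comm _ _)
  · intro n
    rw [cochainComplex_d, cochainComplex_d]
    refine ModuleCat.hom_ext (LinearMap.ext fun (c : X.cells (n + 1) → R) => ?_)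
    change dualMap (X.triangulateDegree R (n + 1)) (E (n + 1) ((E (n + 1)).symm
      (dualMap (β (n + 1)) c))) = dualMap (α (n + 1)) (X.coboundary R (n + 1) c) +
        X.coboundary R n (dualMap (α n) c) + c
    rw [LinearEquiv.apply_symm_apply, dualMap_comp, ← dualMap_chainBdry, ← dualMap_chainBdry,
      dualMap_comp, dualMap_comp, ← dualMap_add]
    nth_rw 3 [← dualMap_id c]
    rw [← dualMap_add]
    refine congrArg (dualMap · c) (LinearMap.ext fun z => ?_)
    exact (hα n z).trans ((add_assoc _ _ _).trans (add_comm _ _))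

end BoxSet

/-! ### Multiplicativity -/

namespace BoxSet

open SingularChain

variable {X : BoxSet.{u}} {R : Type v} [CommRing R]

/-- The characteristic map of an iterated face. -/
theorem charMap_iteratedFace (ε : Bool) {m k n : ℕ} (h : k + m = n) (a : Fin m ↪o Fin n)
    (b : Fin k → Fin n) (hb : StrictMono b) (hab : ∀ i j, b i ≠ a j) (x : X.cells n)
    (t : Fin n → unitInterval) (ht : ∀ j, t (a j) = endpoint ε) :
    X.charMap (iteratedFace ε h a x) (t ∘ b) = X.charMap x t := by
  induction m generalizing n with
  | zero =>
    subst h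
    rw [show b = id from hb.eq_id]
    rfl
  | succ m ih =>
    subst h
    -- The largest direction is removed first, so the smaller ones keep their numbers in the facet;
    -- `b'` is `b` renumbered there.
    set p := a (Fin.last m) with hp
    choose b' hb' using fun i => Fin.exists_succAbove_eq (hab i (Fin.last m))
    have hlt : ∀ i : Fin m, (a i.castSucc : ℕ) < p := fun i =>
      Fin.lt_def.mp (a.strictMono (Fin.castSucc_lt_last i))
    have ha' : ∀ i : Fin m, p.succAbove ((a i.castSucc).castLT
        ((hlt i).trans_le (Nat.le_of_lt_succ p.isLt))) = a i.castSucc := fun i => by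
      exact Fin.succAbove_of_castSucc_lt _ _ (Fin.lt_def.mpr (hlt i))
    have h1 : t ∘ b = p.removeNth t ∘ b' := funext fun i => congrArg t (hb' i).symm
    rw [h1]
    refine (ih rfl _ b' (fun i j hij => ?_) (fun i j hij => ?_) _ _ fun j => ?_).trans
      (mk_eq_mk_face x (ht (Fin.last m))).symm
    · rw [← Fin.succAbove_lt_succAbove_iff (p := p), hb', hb']
      exact hb hij
    · refine hab i j.castSucc ?_
      rw [← hb' i, hij]
      exact ha' j
    · exact (congrArg t (ha' j)).trans (ht j.castSucc)

end BoxSet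

/-! ### Shuffles and the faces of the triangulating simplices -/

/-- The sum of permutations of the first `k` and the last `m` positions. -/
def Equiv.Perm.finSum {k m : ℕ} (σ : Equiv.Perm (Fin k)) (τ : Equiv.Perm (Fin m)) :
    Equiv.Perm (Fin (k + m)) :=
  finSumFinEquiv.permCongr (Equiv.Perm.sumCongr σ τ)

theorem Equiv.Perm.sign_finSum {k m : ℕ} (σ : Equiv.Perm (Fin k)) (τ : Equiv.Perm (Fin m)) :
    sign (finSum σ τ) = sign σ * sign τ := by
  rw [finSum, sign_permCongr, sign_sumCongr]

@[simp] theorem Equiv.Perm.finSum_castAdd {k m : ℕ} (σ : Equiv.Perm (Fin k))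
    (τ : Equiv.Perm (Fin m)) (i : Fin k) : finSum σ τ (i.castAdd m) = (σ i).castAdd m := by
  simp [finSum]

@[simp] theorem Equiv.Perm.finSum_natAdd {k m : ℕ} (σ : Equiv.Perm (Fin k))
    (τ : Equiv.Perm (Fin m)) (i : Fin m) : finSum σ τ (i.natAdd k) = (τ i).natAdd k := by
  simp [finSum]

namespace BoxSet

open SingularChain

variable {X : BoxSet.{u}} {R : Type v} [CommRing R] {k m : ℕ}

@[simp] theorem shuffle_castAdd (A : Finset (Fin (k + m))) (hA : A.card = m) (i : Fin k) :
    shuffle rfl A hA (i.castAdd m) = Aᶜ.orderEmbOfFin (card_compl_of_card rfl hA) i := by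
  simp [shuffle]

@[simp] theorem shuffle_natAdd (A : Finset (Fin (k + m))) (hA : A.card = m) (i : Fin m) :
    shuffle rfl A hA (i.natAdd k) = A.orderEmbOfFin hA i := by
  simp [shuffle]

/-- Recovers `A` from the product as the set of values on the last `m` positions, the key to
injectivity of the decomposition. -/
theorem shuffle_mul_finSum_apply_mem_iff (A : Finset (Fin (k + m))) (hA : A.card = m)
    (σ : Equiv.Perm (Fin k)) (τ : Equiv.Perm (Fin m)) (i : Fin (k + m)) :
    (shuffle rfl A hA * Equiv.Perm.finSum σ τ) i ∈ A ↔ k ≤ i := by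
  induction i using Fin.addCases with
  | left i =>
    have := Finset.orderEmbOfFin_mem Aᶜ (card_compl_of_card rfl hA) (σ i)
    rw [Finset.mem_compl] at this
    refine iff_of_false ?_ (by simp)
    rwa [Equiv.Perm.mul_apply, Equiv.Perm.finSum_castAdd, shuffle_castAdd]
  | right i => simp

/-- Every permutation is in a unique way a shuffle of permutations. -/
theorem bijective_shuffle_mul_finSum (k m : ℕ) :
    Function.Bijective fun p : {A : Finset (Fin (k + m)) // A.card = m} × Equiv.Perm (Fin k) ×
      Equiv.Perm (Fin m) => shuffle rfl p.1.1 p.1.2 * Equiv.Perm.finSum p.2.1 p.2.2 := by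
  rw [Fintype.bijective_iff_injective_and_card]
  constructor
  · rintro ⟨⟨A, hA⟩, σ, τ⟩ ⟨⟨A', hA'⟩, σ', τ'⟩ h
    dsimp only at h
    obtain rfl : A = A' := by
      ext a
      obtain ⟨i, rfl⟩ := (shuffle rfl A hA * Equiv.Perm.finSum σ τ).surjective a
      rw [shuffle_mul_finSum_apply_mem_iff, h, shuffle_mul_finSum_apply_mem_iff]
    have h' := Equiv.Perm.sumCongrHom_injective (a₁ := (σ, τ)) (a₂ := (σ', τ'))
      (finSumFinEquiv.permCongr.injective (mul_left_cancel h))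
    rw [h']
  · rw [Fintype.card_prod, Fintype.card_prod, Fintype.card_finset_len, Fintype.card_perm,
      Fintype.card_perm, Fintype.card_perm, Fintype.card_fin, Fintype.card_fin, Fintype.card_fin,
      ← Nat.add_choose_mul_factorial_mul_factorial, mul_assoc]

/-- The first `k + 1` vertices use only directions outside `A`, in the order given by `σ`; all
coordinates in `A` are still 0. -/
theorem simplex_front (A : Finset (Fin (k + m))) (hA : A.card = m) (σ : Equiv.Perm (Fin k))
    (τ : Equiv.Perm (Fin m)) (x : X.cells (k + m)) :
    (TopCat.toSSet.obj (TopCat.of X.Realization)).map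
      (SimplexCategory.subinterval 0 k (by omega) :
        SimplexCategory.mk k ⟶ SimplexCategory.mk (k + m)).op
      (X.simplex (shuffle rfl A hA * Equiv.Perm.finSum σ τ) x) =
    X.simplex σ (faceOfFinset false rfl A hA x) := by
  refine (TopCat.toSSetObjEquiv _ _).injective (ContinuousMap.ext fun s => ?_)
  set ρ := shuffle rfl A hA * Equiv.Perm.finSum σ τ with hρ
  set F : Fin (k + 1) → Fin (k + m + 1) := fun i => ⟨i.1 + 0, by omega⟩
  change X.charMap x (cubeSimplex ρ (stdSimplex.map F s)) =
    X.charMap (iteratedFace false rfl (A.orderEmbOfFin hA) x) (cubeSimplex σ s)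
  rw [← charMap_iteratedFace (X := X) false rfl (A.orderEmbOfFin hA)
    (Aᶜ.orderEmbOfFin (card_compl_of_card rfl hA)) (OrderEmbedding.strictMono _)
    (fun i j h => Finset.mem_compl.mp (Finset.orderEmbOfFin_mem Aᶜ (card_compl_of_card rfl hA) i)
      (h ▸ Finset.orderEmbOfFin_mem A hA j)) x]
  · congr 1
    funext b
    refine Subtype.ext ?_
    refine (cubeSimplex_map_apply _ _ _ _).trans ?_
    have : ρ.symm (Aᶜ.orderEmbOfFin (card_compl_of_card rfl hA) b) = (σ.symm b).castAdd m := by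
      rw [Equiv.symm_apply_eq, hρ]
      simp
    rw [this]
    rfl
  · intro j
    refine Subtype.ext ?_
    refine (cubeSimplex_map_apply _ _ _ _).trans ?_
    have : ρ.symm (A.orderEmbOfFin hA j) = (τ.symm j).natAdd k := by
      rw [Equiv.symm_apply_eq, hρ]
      simp
    rw [this, Finset.filter_false_of_mem]
    · simp
    · intro i _
      simp only [F, Fin.lt_def, Fin.val_castSucc, Fin.val_natAdd]
      omega

/-- The last `m + 1` vertices contain every direction outside `A`, so these coordinates are 1, and
the directions in `A` are added in the order given by `τ`. -/
theorem simplex_back (A : Finset (Fin (k + m))) (hA : A.card = m) (σ : Equiv.Perm (Fin k))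
    (τ : Equiv.Perm (Fin m)) (x : X.cells (k + m)) :
    (TopCat.toSSet.obj (TopCat.of X.Realization)).map
      (SimplexCategory.subinterval k m (by omega) :
        SimplexCategory.mk m ⟶ SimplexCategory.mk (k + m)).op
      (X.simplex (shuffle rfl A hA * Equiv.Perm.finSum σ τ) x) =
    X.simplex τ (faceOfFinset true (Nat.add_comm m k) Aᶜ (card_compl_of_card rfl hA) x) := by
  refine (TopCat.toSSetObjEquiv _ _).injective (ContinuousMap.ext fun s => ?_)
  set ρ := shuffle rfl A hA * Equiv.Perm.finSum σ τ with hρ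
  set F : Fin (m + 1) → Fin (k + m + 1) := fun i => ⟨i.1 + k, by omega⟩
  change X.charMap x (cubeSimplex ρ (stdSimplex.map F s)) =
    X.charMap (iteratedFace true (Nat.add_comm m k) (Aᶜ.orderEmbOfFin
      (card_compl_of_card rfl hA)) x) (cubeSimplex τ s)
  rw [← charMap_iteratedFace (X := X) true (Nat.add_comm m k) (Aᶜ.orderEmbOfFin
    (card_compl_of_card rfl hA)) (A.orderEmbOfFin hA) (OrderEmbedding.strictMono _)
    (fun i j h => Finset.mem_compl.mp (Finset.orderEmbOfFin_mem Aᶜ (card_compl_of_card rfl hA) j)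
      (h ▸ Finset.orderEmbOfFin_mem A hA i)) x]
  · congr 1
    funext b
    refine Subtype.ext ?_
    refine (cubeSimplex_map_apply _ _ _ _).trans ?_
    have : ρ.symm (A.orderEmbOfFin hA b) = (τ.symm b).natAdd k := by
      rw [Equiv.symm_apply_eq, hρ]
      simp
    rw [this]
    refine Finset.sum_congr (Finset.filter_congr fun i _ => ?_) fun _ _ => rfl
    simp only [F, Fin.lt_def, Fin.val_castSucc, Fin.val_natAdd]
    omega
  · intro j
    refine Subtype.ext ?_
    refine (cubeSimplex_map_apply _ _ _ _).trans ?_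
    have : ρ.symm (Aᶜ.orderEmbOfFin (card_compl_of_card rfl hA) j) = (σ.symm j).castAdd m := by
      rw [Equiv.symm_apply_eq, hρ]
      simp
    rw [this, Finset.filter_true_of_mem]
    · exact s.2.2
    · intro i _
      simp only [F, Fin.lt_def, Fin.val_castSucc, Fin.val_castAdd]
      omega

variable (X R) in
/-- Restriction of singular cochains to the triangulated cubes preserves cup products. -/
theorem restriction_cup {n : ℕ} (h : k + m = n)
    (f : (TopCat.toSSet.obj (TopCat.of X.Realization)).obj (op (SimplexCategory.mk k)) → R)
    (g : (TopCat.toSSet.obj (TopCat.of X.Realization)).obj (op (SimplexCategory.mk m)) → R) :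
    ((X.restriction R).f n).hom (SSet.cup h f g) =
      cup h (((X.restriction R).f k).hom f) (((X.restriction R).f m).hom g) := by
  subst h
  funext x
  rw [restriction_apply]
  simp only [cup, restriction_apply]
  rw [← (bijective_shuffle_mul_finSum k m).sum_comp, Fintype.sum_prod_type, Finset.mul_sum]
  refine Finset.sum_congr rfl fun A _ => ?_
  rw [Fintype.sum_prod_type, mul_assoc (_ : R), Finset.sum_mul_sum, Finset.mul_sum, Finset.mul_sum]
  refine Finset.sum_congr rfl fun σ _ => ?_
  rw [Finset.mul_sum, Finset.mul_sum]
  refine Finset.sum_congr rfl fun τ _ => ?_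
  simp only [SSet.cup, simplex_front, simplex_back, Equiv.Perm.sign_mul, Equiv.Perm.sign_finSum]
  push_cast
  ring

variable (X R) in
theorem restriction_one : ((X.restriction R).f 0).hom
    (fun _ : (TopCat.toSSet.obj (TopCat.of X.Realization)).obj (op (SimplexCategory.mk 0)) =>
      (1 : R)) = fun _ => (1 : R) := by
  funext x
  rw [restriction_apply]
  simp

end BoxSet

/-! ### Associativity and units -/

namespace SSet

variable {Y : SSet.{u}} {R : Type v} [CommRing R]

theorem map_subinterval_map_subinterval {i j i' l p n : ℕ} (h₁ : j + l ≤ p) (h₂ : i + p ≤ n)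
    (h₃ : i' + l ≤ n) (h : i + j = i') (y : Y.obj (op (SimplexCategory.mk n))) :
    Y.map (SimplexCategory.subinterval j l h₁).op (Y.map (SimplexCategory.subinterval i p h₂).op y) =
      Y.map (SimplexCategory.subinterval i' l h₃).op y := by
  rw [← Functor.map_comp_apply, ← op_comp]
  congr 4
  refine SimplexCategory.Hom.ext _ _ (OrderHom.ext _ _ (funext fun a => Fin.ext ?_))
  change a.1 + j + i = a.1 + i'
  omega

theorem map_subinterval_zero {n : ℕ} (h : 0 + n ≤ n) (y : Y.obj (op (SimplexCategory.mk n))) :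
    Y.map (SimplexCategory.subinterval 0 n h).op y = y := by
  have : SimplexCategory.subinterval 0 n h = 𝟙 (SimplexCategory.mk n) :=
    SimplexCategory.Hom.ext _ _ (OrderHom.ext _ _ (funext fun a => Fin.ext rfl))
  rw [this]
  exact Functor.map_id_apply Y _ y

theorem cup_assoc {k l m p q n : ℕ} (hp : k + l = p) (hq : l + m = q) (hpn : p + m = n)
    (hqn : k + q = n) (f : Y.obj (op (SimplexCategory.mk k)) → R)
    (g : Y.obj (op (SimplexCategory.mk l)) → R) (h : Y.obj (op (SimplexCategory.mk m)) → R) :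
    cup hpn (cup hp f g) h = cup hqn f (cup hq g h) := by
  funext y
  simp only [cup]
  rw [map_subinterval_map_subinterval (i' := 0) _ _ (by omega) (by omega),
    map_subinterval_map_subinterval (i' := k) _ _ (by omega) (by omega),
    map_subinterval_map_subinterval (i' := k) _ _ (by omega) (by omega),
    map_subinterval_map_subinterval (i' := p) _ _ (by omega) (by omega)]
  -- The signs agree because `k l + (k + l) m = k (l + m) + l m`.
  subst hp hq
  ring

theorem one_cup {n : ℕ} (f : Y.obj (op (SimplexCategory.mk n)) → R) :
    cup (Nat.zero_add n) (fun _ : Y.obj (op (SimplexCategory.mk 0)) => (1 : R)) f = f := by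
  funext y
  simp [cup, map_subinterval_zero]

theorem cup_one {n : ℕ} (f : Y.obj (op (SimplexCategory.mk n)) → R) :
    cup (Nat.add_zero n) f (fun _ : Y.obj (op (SimplexCategory.mk 0)) => (1 : R)) = f := by
  funext y
  simp [cup, map_subinterval_zero]

end SSet

/-! ### Surjectivity of the restriction and transfer of the product laws -/

theorem cubeSimplex_barycenter {n : ℕ} (σ : Equiv.Perm (Fin n)) (a : Fin n) :
    (cubeSimplex σ (stdSimplex.barycenter) a : ℝ) = (n - (σ.symm a : ℕ)) / (n + 1) := by
  change ∑ j ∈ Finset.univ.filter (fun j : Fin (n + 1) => (σ.symm a).castSucc < j),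
    (stdSimplex.barycenter (𝕜 := ℝ) (X := Fin (n + 1))) j = _
  have h : (Finset.univ.filter fun j : Fin (n + 1) => (σ.symm a).castSucc < j) =
      Finset.Ioi (σ.symm a).castSucc := by
    ext
    simp
  have hb : ∀ j : Fin (n + 1), (stdSimplex.barycenter (𝕜 := ℝ) (X := Fin (n + 1))) j =
      ((n : ℝ) + 1)⁻¹ := fun j => by
    refine (stdSimplex.barycenter_apply j).trans ?_
    simp
  rw [h, Finset.sum_congr rfl fun j _ => hb j, Finset.sum_const, Fin.card_Ioi, nsmul_eq_mul,
    div_eq_mul_inv, Nat.add_sub_cancel, Fin.val_castSucc, Nat.cast_sub (σ.symm a).isLt.le]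

namespace BoxSet

variable {X : BoxSet.{u}} {R : Type v} [CommRing R]

/-- The barycenter is mapped into the interior of the cube, so its normal form returns the cell, and
its coordinates are strictly ordered by the permutation, which they determine. -/
theorem simplex_inj {n : ℕ} {σ τ : Equiv.Perm (Fin n)} {x y : X.cells n}
    (h : X.simplex σ x = X.simplex τ y) : σ = τ ∧ x = y := by
  let b : stdSimplex ℝ (Fin (n + 1)) := stdSimplex.barycenter
  have h1 : X.charMap x (cubeSimplex σ b) = X.charMap y (cubeSimplex τ b) :=
    ContinuousMap.congr_fun ((TopCat.toSSetObjEquiv _ _).symm.injective h) b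
  have hint : ∀ (ρ : Equiv.Perm (Fin n)) (i : Fin n), cubeSimplex ρ b i ≠ 0 ∧ cubeSimplex ρ b i ≠ 1 := by
    intro ρ i
    have hlt : ((ρ.symm i : ℕ) : ℝ) < n := by exact_mod_cast (ρ.symm i).isLt
    have hnn : (0 : ℝ) ≤ ((ρ.symm i : ℕ) : ℝ) := Nat.cast_nonneg _
    have hn : (0 : ℝ) < n + 1 := by positivity
    have hb := cubeSimplex_barycenter ρ i
    refine ⟨fun h0 => ?_, fun h0 => ?_⟩
    · have : (0 : ℝ) < (n - (ρ.symm i : ℕ)) / (n + 1) := div_pos (by linarith) hn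
      rw [← hb, h0] at this
      exact lt_irrefl _ this
    · have : ((n : ℝ) - (ρ.symm i : ℕ)) / (n + 1) < 1 := by
        rw [div_lt_one hn]
        linarith
      rw [← hb, h0] at this
      exact lt_irrefl _ this
  have h2 := congrArg X.normalForm h1
  rw [normalForm_mk_of_interior x (hint σ), normalForm_mk_of_interior y (hint τ)] at h2
  simp only [Sigma.mk.injEq, heq_eq_eq, true_and, Prod.mk.injEq] at h2
  refine ⟨?_, h2.1⟩
  rw [← Equiv.symm_bijective.injective.eq_iff]
  refine Equiv.ext fun a => Fin.ext ?_
  have h3 := congrArg Subtype.val (congrFun h2.2 a)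
  rw [cubeSimplex_barycenter, cubeSimplex_barycenter,
    div_left_inj' (by positivity : (n : ℝ) + 1 ≠ 0)] at h3
  exact_mod_cast sub_right_injective h3

variable (X R) in
-- As the simplices are distinct, a cochain can be prescribed freely on those of the identity
-- permutation and set to zero elsewhere; the signed sum then has a single term.
theorem restriction_surjective (n : ℕ) :
    Function.Surjective ((X.restriction R).f n).hom := by
  classical
  intro (f : X.cells n → R)
  refine ⟨fun y => if h : ∃ x, y = X.simplex 1 x then f h.choose else 0, funext fun x => ?_⟩
  refine (X.restriction_apply R n _ x).trans ?_
  rw [Finset.sum_eq_single 1]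
  · have h : ∃ x', X.simplex 1 x = X.simplex 1 x' := ⟨x, rfl⟩
    have h' : h.choose = x := (simplex_inj h.choose_spec).2.symm
    simp [h']
  · intro σ _ hσ
    rw [dif_neg, mul_zero]
    rintro ⟨x', h⟩
    exact hσ (simplex_inj h).1
  · simp

/-- All three factors lift to singular cochains, where associativity is a statement about
subintervals. No calculation with shuffles is needed. -/
theorem cup_assoc {k l m p q n : ℕ} (hp : k + l = p) (hq : l + m = q) (hpn : p + m = n)
    (hqn : k + q = n) (f : X.cells k → R) (g : X.cells l → R) (h : X.cells m → R) :
    cup hpn (cup hp f g) h = cup hqn f (cup hq g h) := by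
  obtain ⟨f, rfl⟩ := X.restriction_surjective R k f
  obtain ⟨g, rfl⟩ := X.restriction_surjective R l g
  obtain ⟨h, rfl⟩ := X.restriction_surjective R m h
  refine (congrArg (cup hpn · _) (X.restriction_cup R hp f g)).symm.trans ?_
  refine Eq.trans ?_ (congrArg (cup hqn _) (X.restriction_cup R hq g h))
  refine (X.restriction_cup R hpn _ h).symm.trans (Eq.trans ?_ (X.restriction_cup R hqn f _))
  exact congrArg ((X.restriction R).f n).hom (SSet.cup_assoc hp hq hpn hqn f g h)

theorem one_cup {n : ℕ} (f : X.cells n → R) :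
    cup (Nat.zero_add n) (fun _ : X.cells 0 => (1 : R)) f = f := by
  obtain ⟨f, rfl⟩ := X.restriction_surjective R n f
  refine (congrArg (cup _ · _) (X.restriction_one R)).symm.trans ?_
  refine (X.restriction_cup R (Nat.zero_add n) _ f).symm.trans ?_
  exact congrArg ((X.restriction R).f n).hom (SSet.one_cup f)

theorem cup_one {n : ℕ} (f : X.cells n → R) :
    cup (Nat.add_zero n) f (fun _ : X.cells 0 => (1 : R)) = f := by
  obtain ⟨f, rfl⟩ := X.restriction_surjective R n f
  refine (congrArg (cup _ _) (X.restriction_one R)).symm.trans ?_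
  refine (X.restriction_cup R (Nat.add_zero n) f _).symm.trans ?_
  exact congrArg ((X.restriction R).f n).hom (SSet.cup_one f)

end BoxSet

theorem mainTheorem10 (X : BoxSet.{u}) (R : Type v) [CommRing R] :
    (∀ {k l m p q n : ℕ} (hp : k + l = p) (hq : l + m = q) (hpn : p + m = n) (hqn : k + q = n)
      (f : X.cells k → R) (g : X.cells l → R) (h : X.cells m → R),
      BoxSet.cup hpn (BoxSet.cup hp f g) h = BoxSet.cup hqn f (BoxSet.cup hq g h)) ∧
    (∀ {n : ℕ} (f : X.cells n → R),
      BoxSet.cup (Nat.zero_add n) (fun _ : X.cells 0 => (1 : R)) f = f ∧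
      BoxSet.cup (Nat.add_zero n) f (fun _ : X.cells 0 => (1 : R)) = f) ∧
    ∃ e : HomotopyEquiv (singularCochainComplex R (TopCat.of X.Realization)) (X.cochainComplex R),
      (∀ (n : ℕ) (c : (TopCat.toSSet.obj (TopCat.of X.Realization)).obj (op (SimplexCategory.mk n)) → R)
        (x : X.cells n),
        (e.hom.f n).hom c x =
          ∑ σ : Equiv.Perm (Fin n), ((Equiv.Perm.sign σ : ℤ) : R) * c (X.simplex σ x)) ∧
      (∀ {k m n : ℕ} (h : k + m = n)
        (f : (TopCat.toSSet.obj (TopCat.of X.Realization)).obj (op (SimplexCategory.mk k)) → R)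
        (g : (TopCat.toSSet.obj (TopCat.of X.Realization)).obj (op (SimplexCategory.mk m)) → R),
        (e.hom.f n).hom (SSet.cup h f g) =
          BoxSet.cup h ((e.hom.f k).hom f) ((e.hom.f m).hom g)) ∧
      (e.hom.f 0).hom
          (fun _ : (TopCat.toSSet.obj (TopCat.of X.Realization)).obj (op (SimplexCategory.mk 0)) => (1 : R)) =
        fun _ => (1 : R) := by
  obtain ⟨e, he⟩ := X.exists_homotopyEquiv R
  refine ⟨BoxSet.cup_assoc, fun f => ⟨BoxSet.one_cup f, BoxSet.cup_one f⟩, e, ?_, ?_, ?_⟩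
  · rw [he]
    exact X.restriction_apply R
  · rw [he]
    exact X.restriction_cup R
  · rw [he]
    exact X.restriction_one R
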